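/- There are positive numerical constants $C_\rho$, $C_s$, $C$ such that the following holds. Let $n\ge 2$, let $L\in\mathbb{R}^{n\times n}$ have rank $r\ge 1$ and reduced singular value decomposition $L=U\Sigma V^*$ with $U,V\in\mathbb{R}^{n\times r}$, and let $\mu$ be the smallest number such that $$\|UU^*e_i\|_2^2\le \frac{\mu r}{n},\qquad \|VV^*e_i\|_2^2\le\frac{\mu r}{n}\quad (1\le i\le n),\qquad \|UV^*\|_\infty\le\frac{\sqrt{\mu r}}{n},$$ where $\|\cdot\|_\infty$ is the largest absolute value of an entry. Fix a matrix $K\in\{-1,1\}^{n\times n}$ and numbers $0<\rho<\frac12$ and $0\le s\le 1$. Let $\Omega\subset O$ be random subsets of $[n]\times[n]$ such that the pairs of indicators $(1_{\{(i,j)\in O\}},1_{\{(i,j)\in\Omega\}})$ are independent over the entries $(i,j)$, with $\mathbb{P}((i,j)\in O)=\rho$ and $\mathbb{P}((i,j)\in\Omega\mid(i,j)\in O)=s$. Let $S$ be a random $n\times n$ matrix with $\mathrm{sgn}(S)=\mathcal{P}_\Omega(K)$; thus $S$ has support $\Omega$, and the magnitudes of its nonzero entries are arbitrary. Here $\mathcal{P}_A(M)$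 keeps the entries of $M$ in $A$ and sets the others to $0$. If $$\rho>C_\rho\frac{\mu r\log^2 n}{n}\quad\text{and}\quad s\le C_s,$$ then, with $\lambda=1/\sqrt{\rho n\log n}$, with probability at least $1-Cn^{-3}$ the problem $$\min_{\widetilde L,\widetilde S}\ \|\widetilde L\|_*+\lambda\|\widetilde S\|_1\quad\text{such that}\quad \mathcal{P}_O(\widetilde L)+\widetilde S=\mathcal{P}_O(L)+S$$ has $(L,S)$ as its unique optimal solution. Here $\|\cdot\|_*$ is the nuclear norm (the sum of the singular values) and $\|\cdot\|_1$ is the sum of the absolute values of the entries. -/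

import Mathlib

open MeasureTheory ProbabilityTheory

noncomputable section

namespace RobustMC

/-- The entrywise projection `P_O`: keep the entries of `M` indexed by `O`, set the others to `0`. -/
def proj {n : ℕ} (O : Finset (Fin n × Fin n)) (M : Matrix (Fin n) (Fin n) ℝ) :
    Matrix (Fin n) (Fin n) ℝ :=
  Matrix.of fun i j => if (i, j) ∈ O then M i j else 0

/-- The nuclear norm: the sum of all the singular values. -/
def nuclearNorm {n : ℕ} (M : Matrix (Fin n) (Fin n) ℝ) : ℝ :=
  ∑ k ∈ Finset.range n, (Matrix.toEuclideanLin M).singularValues k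

/-- The entrywise `ℓ¹` norm. -/
def l1Norm {n : ℕ} (M : Matrix (Fin n) (Fin n) ℝ) : ℝ :=
  ∑ i, ∑ j, |M i j|

/-- `L = U Σ Vᵀ` is a reduced singular value decomposition with `r` positive singular values
`Σ = diag σ` (in no particular order). -/
structure IsReducedSVD {n r : ℕ} (L : Matrix (Fin n) (Fin n) ℝ) (U : Matrix (Fin n) (Fin r) ℝ)
    (σ : Fin r → ℝ) (V : Matrix (Fin n) (Fin r) ℝ) : Prop where
  orthonormal_left : U.transpose * U = 1
  orthonormal_right : V.transpose * V = 1
  pos : ∀ k, 0 < σ k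
  eq : L = U * Matrix.diagonal σ * V.transpose

/-- The incoherence conditions with constant `μ`:
`‖U Uᵀ eᵢ‖₂² ≤ μ r / n`, `‖V Vᵀ eᵢ‖₂² ≤ μ r / n` for all `i`, and `‖U Vᵀ‖_∞ ≤ √(μ r) / n`,
where `‖·‖_∞` is the largest absolute value of an entry. -/
structure IsIncoherent {n r : ℕ} (U V : Matrix (Fin n) (Fin r) ℝ) (μ : ℝ) : Prop where
  left : ∀ i, ‖WithLp.toLp 2 ((U * U.transpose).mulVec (Pi.single i 1))‖ ^ 2 ≤ μ * r / n
  right : ∀ i, ‖WithLp.toLp 2 ((V * V.transpose).mulVec (Pi.single i 1))‖ ^ 2 ≤ μ * r / n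
  cross : ∀ i j, |(U * V.transpose) i j| ≤ √(μ * r) / n

/-- `μ` is the incoherence parameter of the pair `U, V`: the smallest constant for which
the incoherence conditions hold. -/
def IsIncoherenceParameter {n r : ℕ} (U V : Matrix (Fin n) (Fin r) ℝ) (μ : ℝ) : Prop :=
  IsLeast {ν : ℝ | IsIncoherent U V ν} μ

/-- The random model of corrupted entries. `O` is the random set of observed entries, `Om` the
random set of corrupted ones, `S` the random corruption.
* Every entry lies in `O` with probability `ρ`; given that it lies in `O`, it lies in `Om` with
  probability `s`; what happens at different entries is independent, i.e. the pairs
  `(1_{p ∈ O}, 1_{p ∈ Om})` are independent over the entries `p`.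
* `sgn S = P_Om K`; in particular the support of `S` is `Om`. The magnitudes of the entries of `S`
  are arbitrary (and may depend on the sample point). -/
structure IsCorruptionModel {n : ℕ} {α : Type*} [MeasurableSpace α] (P : Measure α) (ρ s : ℝ)
    (K : Matrix (Fin n) (Fin n) ℝ) (O Om : α → Finset (Fin n × Fin n))
    (S : α → Matrix (Fin n) (Fin n) ℝ) : Prop where
  measurable_obs : ∀ p, MeasurableSet {ω | p ∈ O ω}
  measurable_corr : ∀ p, MeasurableSet {ω | p ∈ Om ω}
  subset : ∀ ω, Om ω ⊆ O ω
  indep : iIndepFun (fun (p : Fin n × Fin n) (ω : α) => ((p ∈ O ω, p ∈ Om ω) : Prop × Prop)) P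
  prob_obs : ∀ p, P.real {ω | p ∈ O ω} = ρ
  prob_corr : ∀ p, (ProbabilityTheory.cond P {ω | p ∈ O ω}).real {ω | p ∈ Om ω} = s
  sign : ∀ ω i j, Real.sign (S ω i j) = proj (Om ω) K i j

/-- The pairs `(L', S')` that are feasible for the observed data `P_O(L) + S`, that is,
`P_O(L') + S' = P_O(L) + S`. -/
def feasible {n : ℕ} (O : Finset (Fin n × Fin n)) (L S : Matrix (Fin n) (Fin n) ℝ) :
    Set (Matrix (Fin n) (Fin n) ℝ × Matrix (Fin n) (Fin n) ℝ) :=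
  {X | proj O X.1 + X.2 = proj O L + S}

/-- `X = (L', S')` is an optimal solution of: minimize `‖L'‖_* + lam ‖S'‖₁` subject to
`P_O(L') + S' = P_O(L) + S`. -/
def IsOptimal {n : ℕ} (lam : ℝ) (O : Finset (Fin n × Fin n)) (L S : Matrix (Fin n) (Fin n) ℝ)
    (X : Matrix (Fin n) (Fin n) ℝ × Matrix (Fin n) (Fin n) ℝ) : Prop :=
  X ∈ feasible O L S ∧ IsMinOn (fun Z => nuclearNorm Z.1 + lam * l1Norm Z.2) (feasible O L S) X

/-- Exact recovery: `(L, S)` is the one and only optimal solution. -/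
def ExactRecovery {n : ℕ} (lam : ℝ) (O : Finset (Fin n × Fin n))
    (L S : Matrix (Fin n) (Fin n) ℝ) : Prop :=
  ∀ X, IsOptimal lam O L S X ↔ X = (L, S)

end RobustMC

end

/-!
The pair `(L, S)` is the unique optimum as soon as there is an inexact dual certificate: a matrix
`Q` supported on the observed set `O`, equal to `lam K` on the corrupted set `Om`, smaller than
`lam` on `O \ Om`, whose projection to the tangent space at `L` is close to `U Vᵀ` and whose normal
part has operator norm at most `1 / 2`; moreover the sampling of `O \ Om` has to be injective on the
tangent space (`exactRecovery_of_certificate`). Since `U Vᵀ` and the sign pattern enter linearly,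
`Q` is the sum of two parts, each of which is built with high probability.

The part for `U Vᵀ` is obtained by golfing: `O \ Om` is cut into independent Bernoulli batches, and
each batch produces an estimate of the remaining target which reduces it
(`prob_not_hasCertificate_le`). A first large batch gains a factor `√(log n)`, and `O (log n)` small
ones of density `ρ / log n` bring the residual below any fixed power of `1 / n`; this is why
`ρ ≥ C μ r (log n)² / n` is enough.

For the part with the prescribed signs, a deterministic sign pattern `K` is not centred. The pair
`(O, Om)` is therefore realised as `(D ∪ Γ, D ∩ E)` with independent Bernoulli sets `D`, `E`, `Γ`,
`E` of density `1 / 4` (`prob_obsWeight_eq`). The matrix `w` that equals `lam K` on `D ∩ E` and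
`-lam K / 3` on `D \ E` is centred given `D`, so `w` has small norm. Its tangential part is then
cancelled by golfing with `Γ` outside of `D`. To do this without an error on `D`, the target is
`G w`, where `G` inverts the compression of the projection to the complement of `D` on the tangent
space (`localInverse`), and every round again applies `G`. The inverse exists because `D` is sparse:
it has density `4 ρ s` with `s` small.

All probabilistic estimates come from one matrix concentration inequality
(`prob_not_quadratic_le`), which rests on the Golden–Thompson inequality `trace_exp_add_le`. They
are proved for the product law on finite labellings; `IsCorruptionModel.measureReal_setOf` identifies
this law with the law of `(O, Om)` in the random model.
-/

/-! ### The Golden–Thompson inequality -/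

namespace RobustMC

open Filter Topology Matrix

lemma trace_mul_pow_comm {ι : Type*} [Fintype ι] [DecidableEq ι]
    (A B : Matrix ι ι ℝ) (m : ℕ) :
    ((A * B) ^ m).trace = ((B * A) ^ m).trace := by
  cases m with
  | zero => simp
  | succ m =>
    have h : (A * B) ^ (m + 1) = A * (B * A) ^ m * B := by
      induction m with
      | zero => simp
      | succ m ih =>
        rw [pow_succ, ih, pow_succ (B * A)]
        simp only [Matrix.mul_assoc]
    rw [h, Matrix.trace_mul_comm, ← Matrix.mul_assoc, pow_succ']

lemma trace_sq_le {ι : Type*} [Fintype ι] (M : Matrix ι ι ℝ) : (M * M).trace ≤ (Mᵀ * M).trace := by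
  simp only [Matrix.trace, Matrix.diag_apply, Matrix.mul_apply, Matrix.transpose_apply]
  have h : ∀ i j, M i j * M j i ≤ (M j i * M j i + M i j * M i j) / 2 := fun i j => by
    nlinarith [sq_nonneg (M i j - M j i)]
  calc ∑ i, ∑ j, M i j * M j i ≤ ∑ i, ∑ j, (M j i * M j i + M i j * M i j) / 2 :=
        Finset.sum_le_sum fun i _ => Finset.sum_le_sum fun j _ => h i j
    _ = (∑ i, ∑ j, M j i * M j i + ∑ i, ∑ j, M i j * M i j) / 2 := by
        simp only [← Finset.sum_add_distrib, ← Finset.sum_div]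
    _ = ∑ i, ∑ j, M j i * M j i := by
        rw [Finset.sum_comm (f := fun i j => M i j * M i j)]; ring

lemma trace_mul_le_of_isSymm {ι : Type*} [Fintype ι] {P Q : Matrix ι ι ℝ} (hP : P.IsSymm)
    (hQ : Q.IsSymm) :
    (P * Q).trace ≤ ((P * P).trace + (Q * Q).trace) / 2 := by
  have h := trace_sq_le (P - Q)
  have h2 : 0 ≤ ((P - Q)ᵀ * (P - Q)).trace := by
    simp only [Matrix.trace, Matrix.diag_apply, Matrix.mul_apply, Matrix.transpose_apply]
    exact Finset.sum_nonneg fun i _ => Finset.sum_nonneg fun j _ => mul_self_nonneg _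
  rw [Matrix.transpose_sub, hP.eq, hQ.eq, Matrix.sub_mul, Matrix.mul_sub, Matrix.mul_sub,
    Matrix.trace_sub, Matrix.trace_sub, Matrix.trace_sub, Matrix.trace_mul_comm Q P] at h2
  linarith

/-- Two trace inequalities for powers of two, proved together by induction on the exponent:
each of them follows from both at the previous exponent. -/
lemma trace_pow_two_pow_le {ι : Type*} [Fintype ι] [DecidableEq ι] (k : ℕ) :
    (∀ M : Matrix ι ι ℝ, (M ^ 2 ^ (k + 1)).trace ≤ ((Mᵀ * M) ^ 2 ^ k).trace) ∧
      ∀ P Q : Matrix ι ι ℝ, P.IsSymm → Q.IsSymm →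
        ((P * Q) ^ 2 ^ k).trace ≤ (P ^ 2 ^ k * Q ^ 2 ^ k).trace := by
  induction k with
  | zero =>
    refine ⟨fun M => ?_, fun P Q _ _ => by simp⟩
    simpa [sq] using trace_sq_le M
  | succ k ih =>
    obtain ⟨hS, hC⟩ := ih
    refine ⟨fun M => ?_, fun P Q hP hQ => ?_⟩
    · have hP : (Mᵀ * M).IsSymm := by simp [Matrix.IsSymm, Matrix.transpose_mul]
      have hQ : (M * Mᵀ).IsSymm := by simp [Matrix.IsSymm, Matrix.transpose_mul]
      calc (M ^ 2 ^ (k + 1 + 1)).trace = ((M * M) ^ 2 ^ (k + 1)).trace := by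
            rw [pow_succ' 2 (k + 1), pow_mul, sq]
        _ ≤ (((M * M)ᵀ * (M * M)) ^ 2 ^ k).trace := hS _
        _ = (((Mᵀ * M) * (M * Mᵀ)) ^ 2 ^ k).trace := by
            rw [Matrix.transpose_mul, Matrix.mul_assoc, trace_mul_pow_comm]
            simp only [Matrix.mul_assoc]
        _ ≤ ((Mᵀ * M) ^ 2 ^ k * (M * Mᵀ) ^ 2 ^ k).trace := hC _ _ hP hQ
        _ ≤ _ := trace_mul_le_of_isSymm (hP.pow _) (hQ.pow _)
        _ = ((Mᵀ * M) ^ 2 ^ (k + 1)).trace := by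
            rw [← pow_add, ← pow_add, ← two_mul, ← pow_succ', trace_mul_pow_comm M]
            ring
    · calc ((P * Q) ^ 2 ^ (k + 1)).trace ≤ (((P * Q)ᵀ * (P * Q)) ^ 2 ^ k).trace := hS _
        _ = (((P * P) * (Q * Q)) ^ 2 ^ k).trace := by
            rw [Matrix.transpose_mul, hP.eq, hQ.eq, Matrix.mul_assoc, trace_mul_pow_comm]
            simp only [Matrix.mul_assoc]
        _ ≤ ((P * P) ^ 2 ^ k * (Q * Q) ^ 2 ^ k).trace := hC _ _ (by
              simp [Matrix.IsSymm, Matrix.transpose_mul, hP.eq]) (by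
              simp [Matrix.IsSymm, Matrix.transpose_mul, hQ.eq])
        _ = _ := by rw [← sq, ← sq, ← pow_mul, ← pow_mul, ← pow_succ']

/-- Powers of elements of norm at most `c` depend on the base in a Lipschitz way. -/
lemma norm_pow_sub_pow_le {𝔸 : Type*} [NormedRing 𝔸] [NormOneClass 𝔸]
    {x w : 𝔸} {c d : ℝ} (hc : 1 ≤ c) (hx : ‖x‖ ≤ c) (hw : ‖w‖ ≤ c)
    (hd : ‖x - w‖ ≤ d) (m : ℕ) : ‖x ^ m - w ^ m‖ ≤ m * d * c ^ m := by
  have hd0 : 0 ≤ d := (norm_nonneg _).trans hd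
  induction m with
  | zero => simp
  | succ m ih =>
    have h : x ^ (m + 1) - w ^ (m + 1) = (x ^ m - w ^ m) * x + w ^ m * (x - w) := by
      rw [pow_succ, pow_succ]; noncomm_ring
    have hwm : ‖w ^ m‖ ≤ c ^ m := (norm_pow_le w m).trans (by gcongr)
    calc ‖x ^ (m + 1) - w ^ (m + 1)‖ ≤ ‖x ^ m - w ^ m‖ * ‖x‖ + ‖w ^ m‖ * ‖x - w‖ := by
          rw [h]; exact (norm_add_le _ _).trans (add_le_add (norm_mul_le _ _) (norm_mul_le _ _))
      _ ≤ (m * d * c ^ m) * c + c ^ m * d := by gcongr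
      _ ≤ (m * d * c ^ m) * c + c ^ m * d * c := by
          exact add_le_add le_rfl <| le_mul_of_one_le_right (by positivity) hc
      _ = _ := by push_cast; ring

lemma norm_normedSpace_exp_le {𝔸 : Type*} [NormedRing 𝔸] [NormOneClass 𝔸] [NormedAlgebra ℝ 𝔸]
    (x : 𝔸) : ‖NormedSpace.exp x‖ ≤ Real.exp ‖x‖ := by
  rw [NormedSpace.exp_eq_tsum ℝ, Real.exp_eq_exp_ℝ, NormedSpace.exp_eq_tsum ℝ]
  have hs := NormedSpace.expSeries_summable' (𝕂 := ℝ) ‖x‖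
  refine tsum_of_norm_bounded hs.hasSum fun k => ?_
  rw [norm_smul, smul_eq_mul, Real.norm_of_nonneg (by positivity)]
  gcongr
  exact norm_pow_le x k

/-- The Lie–Trotter product formula along powers of two. -/
lemma tendsto_exp_mul_exp_pow {𝔸 : Type*} [NormedRing 𝔸] [NormOneClass 𝔸] [NormedAlgebra ℝ 𝔸]
    [CompleteSpace 𝔸] (a b : 𝔸) :
    Tendsto (fun k : ℕ => (NormedSpace.exp (((2 : ℝ) ^ k)⁻¹ • a) *
      NormedSpace.exp (((2 : ℝ) ^ k)⁻¹ • b)) ^ 2 ^ k) atTop (𝓝 (NormedSpace.exp (a + b))) := by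
  set f : ℝ → 𝔸 := fun t => NormedSpace.exp (t • a) * NormedSpace.exp (t • b) -
    NormedSpace.exp (t • (a + b)) with hf
  -- `f` vanishes to first order at `0`, and it is multiplied by `2 ^ k` when the factors telescope
  have hder : HasDerivAt f 0 0 := by
    have h1 := ((hasDerivAt_exp_smul_const a (0 : ℝ)).mul
      (hasDerivAt_exp_smul_const b (0 : ℝ))).sub (hasDerivAt_exp_smul_const (a + b) (0 : ℝ))
    convert! h1 using 1
    simp
  have ht : Tendsto (fun k : ℕ => ((2 : ℝ) ^ k)⁻¹) atTop (𝓝[≠] 0) := by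
    refine tendsto_nhdsWithin_iff.2 ⟨?_, Eventually.of_forall fun k => by simp⟩
    exact tendsto_inv_atTop_zero.comp (tendsto_pow_atTop_atTop_of_one_lt (r := (2 : ℝ))
      (by norm_num))
  have hslope := (hasDerivAt_iff_tendsto_slope_zero.1 hder).comp ht
  have hf0 : f 0 = 0 := by simp [hf]
  simp only [Function.comp_def, hf0, sub_zero, zero_add, inv_inv] at hslope
  set C := Real.exp (‖a‖ + ‖b‖)
  have hbound : ∀ k : ℕ, ‖(NormedSpace.exp (((2 : ℝ) ^ k)⁻¹ • a) *
      NormedSpace.exp (((2 : ℝ) ^ k)⁻¹ • b)) ^ 2 ^ k - NormedSpace.exp (a + b)‖ ≤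
      ‖(2 : ℝ) ^ k • f ((2 : ℝ) ^ k)⁻¹‖ * C := by
    intro k
    set t : ℝ := ((2 : ℝ) ^ k)⁻¹
    have ht0 : 0 ≤ t := by positivity
    have hsplit : Real.exp (t * (‖a‖ + ‖b‖)) ^ 2 ^ k = C := by
      rw [← Real.exp_nat_mul]
      congr 1
      simp [t]
    have hx : ‖NormedSpace.exp (t • a) * NormedSpace.exp (t • b)‖ ≤
        Real.exp (t * (‖a‖ + ‖b‖)) := by
      rw [mul_add, Real.exp_add]
      refine (norm_mul_le _ _).trans ?_
      gcongr <;>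
      · refine (norm_normedSpace_exp_le _).trans_eq ?_
        rw [norm_smul, Real.norm_of_nonneg ht0]
    have hw : ‖NormedSpace.exp (t • (a + b))‖ ≤ Real.exp (t * (‖a‖ + ‖b‖)) := by
      refine (norm_normedSpace_exp_le _).trans ?_
      rw [norm_smul, Real.norm_of_nonneg ht0]
      gcongr
      exact norm_add_le a b
    have hpow : NormedSpace.exp (a + b) = NormedSpace.exp (t • (a + b)) ^ 2 ^ k := by
      let _ : NormedAlgebra ℚ 𝔸 := NormedAlgebra.restrictScalars ℚ ℝ 𝔸
      rw [← NormedSpace.exp_nsmul, ← Nat.cast_smul_eq_nsmul ℝ, smul_smul]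
      simp [t]
    have h := norm_pow_sub_pow_le (Real.one_le_exp (by positivity)) hx hw le_rfl (2 ^ k)
    rw [hsplit, ← hpow] at h
    refine h.trans_eq ?_
    rw [norm_smul]
    simp [hf]
  refine tendsto_iff_norm_sub_tendsto_zero.2 (squeeze_zero (fun _ => norm_nonneg _) hbound ?_)
  simpa using (tendsto_norm_zero.comp hslope).mul_const C

open scoped Matrix.Norms.Operator in
/-- The Golden–Thompson inequality for real symmetric matrices. -/
theorem trace_exp_add_le {ι : Type*} [Fintype ι] [DecidableEq ι] [Nonempty ι]
    {A B : Matrix ι ι ℝ} (hA : A.IsSymm) (hB : B.IsSymm) :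
    (NormedSpace.exp (A + B)).trace ≤ (NormedSpace.exp A * NormedSpace.exp B).trace := by
  have hlim := (Continuous.matrix_trace continuous_id).tendsto (NormedSpace.exp (A + B)) |>.comp
    (tendsto_exp_mul_exp_pow A B)
  refine le_of_tendsto hlim (Eventually.of_forall fun k => ?_)
  have hpow : ∀ M : Matrix ι ι ℝ, NormedSpace.exp (((2 : ℝ) ^ k)⁻¹ • M) ^ 2 ^ k =
      NormedSpace.exp M := fun M => by
    rw [← Matrix.exp_nsmul, ← Nat.cast_smul_eq_nsmul ℝ, smul_smul]
    simp
  have h := (trace_pow_two_pow_le k).2 (NormedSpace.exp (((2 : ℝ) ^ k)⁻¹ • A))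
    (NormedSpace.exp (((2 : ℝ) ^ k)⁻¹ • B)) (hA.smul _).exp (hB.smul _).exp
  simp only [hpow] at h
  exact h

end RobustMC

/-! ### Finite product probability spaces -/

namespace RobustMC

open Matrix

/-- A probability weight on a finite type. -/
structure IsWeight {Λ : Type*} [Fintype Λ] (w : Λ → ℝ) : Prop where
  nonneg : ∀ a, 0 ≤ w a
  sum_eq_one : ∑ a, w a = 1

/-- The expectation of `F` when the coordinates of the labelling `f : N → Λ` are independent with
law `w`. -/
noncomputable def expect {N Λ : Type*} [Fintype N] [DecidableEq N] [Fintype Λ] (w : Λ → ℝ)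
    (F : (N → Λ) → ℝ) : ℝ :=
  ∑ f, (∏ x, w (f x)) * F f

open Classical in
/-- The probability of `Q` when the coordinates of the labelling `f : N → Λ` are independent with
law `w`. -/
noncomputable def prob {N Λ : Type*} [Fintype N] [DecidableEq N] [Fintype Λ] (w : Λ → ℝ)
    (Q : (N → Λ) → Prop) : ℝ :=
  expect w fun f => if Q f then 1 else 0

section Expect

variable {N Λ Λ' : Type*} [Fintype N] [DecidableEq N] [Fintype Λ] [Fintype Λ']
  {w : Λ → ℝ} {w' : Λ' → ℝ}

lemma expect_mono (hw : IsWeight w) {F G : (N → Λ) → ℝ} (h : ∀ f, F f ≤ G f) :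
    expect w F ≤ expect w G :=
  Finset.sum_le_sum fun f _ =>
    mul_le_mul_of_nonneg_left (h f) (Finset.prod_nonneg fun _ _ => hw.nonneg _)

lemma expect_add (F G : (N → Λ) → ℝ) :
    expect w (fun f => F f + G f) = expect w F + expect w G := by
  simp [expect, mul_add, Finset.sum_add_distrib]

lemma expect_const_mul (c : ℝ) (F : (N → Λ) → ℝ) :
    expect w (fun f => c * F f) = c * expect w F := by
  simp only [expect, Finset.mul_sum]
  exact Finset.sum_congr rfl fun f _ => by ring

lemma expect_const (hw : IsWeight w) (c : ℝ) : expect (N := N) w (fun _ => c) = c := by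
  have h := Finset.prod_univ_sum (fun _ : N => (Finset.univ : Finset Λ)) fun _ a => w a
  rw [Fintype.piFinset_univ] at h
  rw [expect, ← Finset.sum_mul, ← h, hw.sum_eq_one]
  simp

/-- Drawing the label of one coordinate afresh does not change the expectation. -/
lemma expect_resample (hw : IsWeight w) (x : N) (F : (N → Λ) → ℝ) :
    expect w F = expect w fun f => ∑ a, w a * F (Function.update f x a) := by
  have hinv : Function.Involutive
      (fun p : (N → Λ) × Λ => (Function.update p.1 x p.2, p.1 x)) := fun p => by simp
  have hprod : ∀ (f : N → Λ) (a : Λ),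
      (∏ y, w (Function.update f x a y)) * w (f x) = (∏ y, w (f y)) * w a := fun f a => by
    rw [Fintype.prod_eq_mul_prod_compl x, Fintype.prod_eq_mul_prod_compl x fun y => w (f y),
      Finset.prod_congr rfl (g := fun y => w (f y)) fun y hy => by
        rw [Function.update_of_ne (by simpa using hy)]]
    simp only [Function.update_self]
    ring
  calc expect w F = ∑ p : (N → Λ) × Λ, (∏ y, w (p.1 y)) * w p.2 * F p.1 := by
        rw [Fintype.sum_prod_type, expect]
        refine Finset.sum_congr rfl fun f _ => ?_
        simp only [mul_right_comm _ _ (F f)]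
        rw [← Finset.mul_sum, hw.sum_eq_one, mul_one]
    _ = ∑ p : (N → Λ) × Λ, (∏ y, w (p.1 y)) * w p.2 * F (Function.update p.1 x p.2) := by
        rw [← (Equiv.sum_comp hinv.toPerm
          fun p : (N → Λ) × Λ => (∏ y, w (p.1 y)) * w p.2 * F p.1)]
        refine Finset.sum_congr rfl fun p _ => ?_
        simp only [Function.Involutive.coe_toPerm, hprod]
    _ = _ := by
        rw [Fintype.sum_prod_type, expect]
        refine Finset.sum_congr rfl fun f _ => ?_
        rw [Finset.mul_sum]
        exact Finset.sum_congr rfl fun a _ => by ring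

open Classical in
lemma expect_map (φ : Λ → Λ') (hφ : ∀ b, w' b = ∑ a with φ a = b, w a) (F : (N → Λ') → ℝ) :
    expect w (fun f => F fun x => φ (f x)) = expect w' F := by
  have h : ∀ g : N → Λ', ∏ x, w' (g x) = ∑ f : N → Λ with (fun x => φ (f x)) = g,
      ∏ x, w (f x) := fun g => by
    simp only [hφ]
    rw [Finset.prod_univ_sum]
    refine Finset.sum_congr ?_ fun _ _ => rfl
    ext f
    simp [Fintype.mem_piFinset, funext_iff]
  unfold expect
  simp only [h, Finset.sum_mul]
  rw [← Finset.sum_fiberwise (Finset.univ : Finset (N → Λ)) fun f x => φ (f x)]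
  refine Finset.sum_congr rfl fun g _ => Finset.sum_congr rfl fun f hf => ?_
  rw [(Finset.mem_filter.1 hf).2]

lemma expect_prod (F : (N → Λ × Λ') → ℝ) :
    expect (fun p : Λ × Λ' => w p.1 * w' p.2) F =
      expect w fun f => expect w' fun g => F fun x => (f x, g x) := by
  unfold expect
  rw [← Equiv.sum_comp (Equiv.arrowProdEquivProdArrow N (fun _ => Λ) fun _ => Λ').symm,
    Fintype.sum_prod_type]
  refine Finset.sum_congr rfl fun f _ => ?_
  rw [Finset.mul_sum]
  refine Finset.sum_congr rfl fun g _ => ?_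
  simp only [Equiv.arrowProdEquivProdArrow, Equiv.coe_fn_symm_mk, Finset.prod_mul_distrib]
  ring

lemma IsWeight.prod (hw : IsWeight w) (hw' : IsWeight w') :
    IsWeight fun p : Λ × Λ' => w p.1 * w' p.2 where
  nonneg p := mul_nonneg (hw.nonneg _) (hw'.nonneg _)
  sum_eq_one := by
    rw [Fintype.sum_prod_type]
    simp [← Finset.mul_sum, hw.sum_eq_one, hw'.sum_eq_one]

lemma prob_le_one (hw : IsWeight w) (Q : (N → Λ) → Prop) : prob w Q ≤ 1 :=
  (expect_mono hw fun f => by split_ifs <;> norm_num).trans_eq (expect_const (N := N) hw 1)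

lemma prob_mono (hw : IsWeight w) {Q R : (N → Λ) → Prop} (h : ∀ f, Q f → R f) :
    prob w Q ≤ prob w R :=
  expect_mono hw fun f => by
    by_cases hQ : Q f
    · simp [hQ, h f hQ]
    · simp only [hQ, if_false]; split_ifs <;> norm_num

lemma prob_or_le (hw : IsWeight w) (Q R : (N → Λ) → Prop) :
    prob w (fun f => Q f ∨ R f) ≤ prob w Q + prob w R := by
  rw [prob, prob, prob, ← expect_add]
  refine expect_mono hw fun f => ?_
  by_cases hQ : Q f <;> by_cases hR : R f <;> simp [hQ, hR]

lemma prob_exists_le (hw : IsWeight w) {κ : Type*} [Fintype κ] (Q : κ → (N → Λ) → Prop) {δ : ℝ}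
    (h : ∀ k, prob w (Q k) ≤ δ) : prob w (fun f => ∃ k, Q k f) ≤ Fintype.card κ * δ := by
  classical
  have key : ∀ s : Finset κ, prob w (fun f => ∃ k ∈ s, Q k f) ≤ s.card * δ := fun s => by
    induction s using Finset.induction_on with
    | empty =>
      simp [prob, expect_const hw]
    | insert k s hk ih =>
      rw [Finset.card_insert_of_notMem hk]
      refine (prob_mono hw (R := fun f => Q k f ∨ ∃ k ∈ s, Q k f) fun f hf => ?_).trans ?_
      · simpa using hf
      · push_cast
        linarith [prob_or_le hw (Q k) fun f => ∃ k ∈ s, Q k f, h k]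
  simpa using key Finset.univ

lemma prob_le_expect (hw : IsWeight w) {Q : (N → Λ) → Prop} {F : (N → Λ) → ℝ}
    (h0 : ∀ f, 0 ≤ F f) (h1 : ∀ f, Q f → 1 ≤ F f) : prob w Q ≤ expect w F :=
  expect_mono hw fun f => by
    by_cases hQ : Q f
    · simpa [hQ] using h1 f hQ
    · simpa [hQ] using h0 f

lemma prob_not (hw : IsWeight w) (Q : (N → Λ) → Prop) :
    prob w (fun f => ¬ Q f) = 1 - prob w Q := by
  rw [eq_sub_iff_add_eq, prob, prob, ← expect_add]
  refine Eq.trans ?_ (expect_const (N := N) hw 1)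
  congr 1
  funext f
  by_cases hQ : Q f <;> simp [hQ]

open Classical in
lemma prob_map (φ : Λ → Λ') (hφ : ∀ b, w' b = ∑ a with φ a = b, w a) (Q : (N → Λ') → Prop) :
    prob w (fun f => Q fun x => φ (f x)) = prob w' Q :=
  expect_map φ hφ fun f => if Q f then 1 else 0

/-- The total probability bound for two independent labellings, the first of which may fail. -/
lemma prob_prod_le (hw : IsWeight w) (hw' : IsWeight w') {Q : (N → Λ) → Prop}
    {R : (N → Λ × Λ') → Prop} {δ₁ δ₂ : ℝ} (h₁ : prob w Q ≤ δ₁)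
    (h₂ : ∀ f, ¬ Q f → prob w' (fun g => R fun x => (f x, g x)) ≤ δ₂) (hδ₂ : 0 ≤ δ₂) :
    prob (fun p : Λ × Λ' => w p.1 * w' p.2) R ≤ δ₁ + δ₂ := by
  classical
  calc prob (fun p : Λ × Λ' => w p.1 * w' p.2) R
      = expect w fun f => prob w' fun g => R fun x => (f x, g x) := expect_prod _
    _ ≤ expect w fun f => (if Q f then 1 else 0) + δ₂ := by
        refine expect_mono hw fun f => ?_
        by_cases hQ : Q f
        · simpa [hQ] using (prob_le_one hw' _).trans (by linarith)
        · simpa [hQ] using h₂ f hQ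
    _ ≤ δ₁ + δ₂ := by
        rw [expect_add, expect_const hw]
        gcongr
        exact h₁

end Expect

end RobustMC

/-! ### Matrix concentration -/

namespace RobustMC

open Matrix

/-- Orthogonal diagonalisation of a real symmetric matrix. -/
lemma exists_eq_mul_diagonal_mul_transpose {ι : Type*} [Fintype ι] [DecidableEq ι]
    {A : Matrix ι ι ℝ} (hA : A.IsSymm) :
    ∃ (U : Matrix ι ι ℝ) (e : ι → ℝ), Uᵀ * U = 1 ∧ U * Uᵀ = 1 ∧ A = U * diagonal e * Uᵀ := by
  have hH : A.IsHermitian := by rwa [Matrix.IsHermitian, conjTranspose_eq_transpose_of_trivial]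
  refine ⟨hH.eigenvectorUnitary, hH.eigenvalues, ?_, ?_, ?_⟩
  · simpa [star_eq_conjTranspose] using Unitary.coe_star_mul_self hH.eigenvectorUnitary
  · simpa [star_eq_conjTranspose] using Unitary.coe_mul_star_self hH.eigenvectorUnitary
  · simpa [Unitary.conjStarAlgAut_apply, star_eq_conjTranspose, Function.comp_def] using
      hH.spectral_theorem

lemma exp_mul_diagonal_mul_transpose {ι : Type*} [Fintype ι] [DecidableEq ι]
    {U : Matrix ι ι ℝ} (hU : U * Uᵀ = 1) (e : ι → ℝ) :
    NormedSpace.exp (U * diagonal e * Uᵀ) = U * diagonal (fun i => Real.exp (e i)) * Uᵀ := by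
  have hinv : Uᵀ = U⁻¹ := (Matrix.inv_eq_right_inv hU).symm
  have hunit : IsUnit U := (Matrix.isUnit_iff_isUnit_det U).2 (Matrix.isUnit_det_of_right_inverse hU)
  rw [hinv, Matrix.exp_conj _ _ hunit, Matrix.exp_diagonal]
  congr 3
  funext i
  rw [Pi.coe_exp, Real.exp_eq_exp_ℝ]

lemma dotProduct_mul_diagonal_mul_transpose_mulVec {ι : Type*} [Fintype ι] [DecidableEq ι]
    (U : Matrix ι ι ℝ) (e v : ι → ℝ) :
    v ⬝ᵥ (U * diagonal e * Uᵀ) *ᵥ v = ∑ i, e i * (Uᵀ *ᵥ v) i ^ 2 := by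
  rw [← mulVec_mulVec, ← mulVec_mulVec, dotProduct_mulVec, ← mulVec_transpose,
    dotProduct]
  refine Finset.sum_congr rfl fun i _ => ?_
  rw [mulVec_diagonal]
  ring

lemma sum_transpose_mulVec_sq {ι : Type*} [Fintype ι] [DecidableEq ι]
    {U : Matrix ι ι ℝ} (hU : U * Uᵀ = 1) (v : ι → ℝ) :
    ∑ i, (Uᵀ *ᵥ v) i ^ 2 = v ⬝ᵥ v := by
  have h := dotProduct_mul_diagonal_mul_transpose_mulVec U 1 v
  simp only [Pi.one_apply, one_mul] at h
  rw [← h, show diagonal (1 : ι → ℝ) = (1 : Matrix ι ι ℝ) from diagonal_one, Matrix.mul_one, hU,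
    one_mulVec]

/-- A quadratic form is bounded by any `τ` such that the trace of the exponential is at most
`exp τ`. -/
lemma dotProduct_mulVec_le_of_trace_exp_le {ι : Type*} [Fintype ι] [DecidableEq ι]
    {A : Matrix ι ι ℝ} (hA : A.IsSymm) {τ : ℝ} (h : (NormedSpace.exp A).trace ≤ Real.exp τ)
    (v : ι → ℝ) : v ⬝ᵥ A *ᵥ v ≤ τ * (v ⬝ᵥ v) := by
  obtain ⟨U, e, hU1, hU2, rfl⟩ := exists_eq_mul_diagonal_mul_transpose hA
  rw [exp_mul_diagonal_mul_transpose hU2, Matrix.trace_mul_comm, ← Matrix.mul_assoc, hU1,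
    Matrix.one_mul, Matrix.trace_diagonal] at h
  have he : ∀ i, e i ≤ τ := fun i => Real.exp_le_exp.1 <| le_trans
    (Finset.single_le_sum (f := fun i => Real.exp (e i)) (fun _ _ => (Real.exp_pos _).le)
      (Finset.mem_univ i)) h
  rw [dotProduct_mul_diagonal_mul_transpose_mulVec, ← sum_transpose_mulVec_sq hU2 v,
    Finset.mul_sum]
  exact Finset.sum_le_sum fun i _ => mul_le_mul_of_nonneg_right (he i) (sq_nonneg _)

lemma isSymm_smul_sub {ι : Type*} [Fintype ι] {H : Matrix ι ι ℝ} (hH : H.IsSymm) (a b c : ℝ) :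
    (a • H - b • H - c • (H * H)).IsSymm :=
  ((hH.smul _).sub (hH.smul _)).sub (IsSymm.smul (by simp [IsSymm, transpose_mul, hH.eq]) _)

/-- For a fixed symmetric `H` the compensated exponential moment is at most the identity, hence does
not increase traces against `exp A`. -/
lemma sum_trace_exp_mul_exp_le {ι Λ : Type*} [Fintype ι] [DecidableEq ι] [Fintype Λ] {w : Λ → ℝ}
    {A H : Matrix ι ι ℝ} (hA : A.IsSymm) (hH : H.IsSymm) {ξ : Λ → ℝ} {α β lo hi : ℝ}
    (hlo : ∀ v, lo * (v ⬝ᵥ v) ≤ v ⬝ᵥ H *ᵥ v) (hhi : ∀ v, v ⬝ᵥ H *ᵥ v ≤ hi * (v ⬝ᵥ v))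
    (hmgf : ∀ t, lo ≤ t → t ≤ hi → ∑ a, w a * Real.exp (ξ a * t - α * t - β * t ^ 2) ≤ 1) :
    ∑ a, w a * (NormedSpace.exp A * NormedSpace.exp (ξ a • H - α • H - β • (H * H))).trace ≤
      (NormedSpace.exp A).trace := by
  obtain ⟨V, d, hV1, hV2, rfl⟩ := exists_eq_mul_diagonal_mul_transpose hA
  obtain ⟨U, e, hU1, hU2, rfl⟩ := exists_eq_mul_diagonal_mul_transpose hH
  set P := V * diagonal (fun i => Real.exp (d i)) * Vᵀ with hP
  rw [exp_mul_diagonal_mul_transpose hV2, ← hP]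
  have hcalc : ∀ a, ξ a • (U * diagonal e * Uᵀ) - α • (U * diagonal e * Uᵀ) -
      β • (U * diagonal e * Uᵀ * (U * diagonal e * Uᵀ)) =
      U * diagonal (fun i => ξ a * e i - α * e i - β * e i ^ 2) * Uᵀ := fun a => by
    have h1 : U * diagonal e * Uᵀ * (U * diagonal e * Uᵀ) =
        U * (diagonal e * diagonal e) * Uᵀ := by
      calc U * diagonal e * Uᵀ * (U * diagonal e * Uᵀ)
          = U * diagonal e * (Uᵀ * U) * diagonal e * Uᵀ := by simp only [Matrix.mul_assoc]
        _ = _ := by rw [hU1, Matrix.mul_one]; simp only [Matrix.mul_assoc]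
    have h2 : diagonal (fun i => ξ a * e i - α * e i - β * e i ^ 2) =
        ξ a • diagonal e - α • diagonal e - β • (diagonal e * diagonal e) := by
      ext i j
      by_cases hij : i = j
      · subst hij; simp [sq]
      · simp [hij]
    rw [h1, h2, Matrix.mul_sub, Matrix.mul_sub, Matrix.sub_mul, Matrix.sub_mul]
    simp only [Matrix.mul_smul, Matrix.smul_mul]
  set R := Uᵀ * P * U with hR
  have hRii : ∀ i, 0 ≤ R i i := fun i => by
    have h := dotProduct_mul_diagonal_mul_transpose_mulVec V (fun i => Real.exp (d i))
      (U *ᵥ Pi.single i 1)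
    have h2 : R i i = (U *ᵥ Pi.single i 1) ⬝ᵥ P *ᵥ (U *ᵥ Pi.single i 1) := by
      have h3 : R i i = Pi.single i 1 ⬝ᵥ R *ᵥ Pi.single i 1 := by simp
      rw [h3, hR, ← mulVec_mulVec, ← mulVec_mulVec, dotProduct_mulVec, vecMul_transpose]
    rw [h2, h]
    exact Finset.sum_nonneg fun _ _ => mul_nonneg (Real.exp_pos _).le (sq_nonneg _)
  have htr : ∀ c : ι → ℝ, (P * (U * diagonal c * Uᵀ)).trace = ∑ i, R i i * c i := fun c => by
    rw [← Matrix.mul_assoc, Matrix.trace_mul_comm, ← Matrix.mul_assoc, ← Matrix.mul_assoc, ← hR]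
    simp [Matrix.trace, Matrix.mul_diagonal]
  have hei : ∀ i, lo ≤ e i ∧ e i ≤ hi := fun i => by
    have hUi : Uᵀ *ᵥ (U *ᵥ Pi.single i 1) = Pi.single i 1 := by
      rw [mulVec_mulVec, hU1, one_mulVec]
    have hq := dotProduct_mul_diagonal_mul_transpose_mulVec U e (U *ᵥ Pi.single i 1)
    have hn := sum_transpose_mulVec_sq hU2 (U *ᵥ Pi.single i 1)
    rw [hUi] at hq hn
    have h1 := hlo (U *ᵥ Pi.single i 1)
    have h2 := hhi (U *ᵥ Pi.single i 1)
    rw [hq, ← hn] at h1 h2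
    simpa [Pi.single_apply, ite_pow] using And.intro h1 h2
  have hPtr : P.trace = ∑ i, R i i := by
    have h := htr 1
    rw [show diagonal (1 : ι → ℝ) = (1 : Matrix ι ι ℝ) from diagonal_one, Matrix.mul_one, hU2,
      Matrix.mul_one] at h
    simpa using h
  simp only [hcalc, exp_mul_diagonal_mul_transpose hU2, htr, hPtr, Finset.mul_sum]
  rw [Finset.sum_comm]
  refine Finset.sum_le_sum fun i _ => ?_
  calc ∑ a, w a * (R i i * Real.exp (ξ a * e i - α * e i - β * e i ^ 2))
      = R i i * ∑ a, w a * Real.exp (ξ a * e i - α * e i - β * e i ^ 2) := by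
        rw [Finset.mul_sum]; exact Finset.sum_congr rfl fun a _ => by ring
    _ ≤ R i i * 1 := mul_le_mul_of_nonneg_left (hmgf _ (hei i).1 (hei i).2) (hRii i)
    _ = R i i := mul_one _

section

variable {N Λ ι : Type*} [Fintype N] [DecidableEq N] [Fintype Λ] [Fintype ι] [DecidableEq ι]
  {w : Λ → ℝ}

/-- The matrix Laplace transform bound: adding the independent compensated summands one at a time,
the Golden–Thompson inequality shows that none of them increases the expected trace of the
exponential. -/
theorem expect_trace_exp_le [Nonempty ι] (hw : IsWeight w) {H : N → Matrix ι ι ℝ}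
    (hH : ∀ x, (H x).IsSymm) {ξ : Λ → ℝ} {α β lo hi : ℝ}
    (hlo : ∀ x v, lo * (v ⬝ᵥ v) ≤ v ⬝ᵥ H x *ᵥ v) (hhi : ∀ x v, v ⬝ᵥ H x *ᵥ v ≤ hi * (v ⬝ᵥ v))
    (hmgf : ∀ t, lo ≤ t → t ≤ hi → ∑ a, w a * Real.exp (ξ a * t - α * t - β * t ^ 2) ≤ 1) :
    expect w (fun f => (NormedSpace.exp
      (∑ x, (ξ (f x) • H x - α • H x - β • (H x * H x)))).trace) ≤ Fintype.card ι := by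
  set B : N → Λ → Matrix ι ι ℝ := fun x a => ξ a • H x - α • H x - β • (H x * H x) with hB
  have hBs : ∀ x a, (B x a).IsSymm := fun x a => isSymm_smul_sub (hH x) _ _ _
  have key : ∀ s : Finset N, expect w (fun f => (NormedSpace.exp (∑ x ∈ s, B x (f x))).trace) ≤
      Fintype.card ι := fun s => by
    induction s using Finset.induction_on with
    | empty =>
      simp [expect_const hw]
    | insert y s hy ih =>
      refine le_trans ?_ ih
      rw [expect_resample hw y]
      refine expect_mono hw fun f => ?_
      have hsum : ∀ a, ∑ x ∈ insert y s, B x (Function.update f y a x) =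
          (∑ x ∈ s, B x (f x)) + B y a := fun a => by
        rw [Finset.sum_insert hy, add_comm, Function.update_self]
        congr 1
        refine Finset.sum_congr rfl fun x hx => ?_
        rw [Function.update_of_ne (ne_of_mem_of_not_mem hx hy)]
      have hAs : (∑ x ∈ s, B x (f x)).IsSymm := by
        rw [IsSymm, transpose_sum]
        exact Finset.sum_congr rfl fun x _ => (hBs x _).eq
      simp only [hsum]
      exact (Finset.sum_le_sum fun a _ => mul_le_mul_of_nonneg_left
        (trace_exp_add_le hAs (hBs y a)) (hw.nonneg a)).trans
        (sum_trace_exp_mul_exp_le hAs (hH y) (hlo y) (hhi y) hmgf)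
  exact key Finset.univ

/-- The matrix tail bound in terms of quadratic forms. -/
theorem prob_not_quadratic_le [Nonempty ι] (hw : IsWeight w) {H : N → Matrix ι ι ℝ}
    (hH : ∀ x, (H x).IsSymm) {ξ : Λ → ℝ} {α β lo hi : ℝ}
    (hlo : ∀ x v, lo * (v ⬝ᵥ v) ≤ v ⬝ᵥ H x *ᵥ v) (hhi : ∀ x v, v ⬝ᵥ H x *ᵥ v ≤ hi * (v ⬝ᵥ v))
    (hmgf : ∀ t, lo ≤ t → t ≤ hi → ∑ a, w a * Real.exp (ξ a * t - α * t - β * t ^ 2) ≤ 1)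
    (τ : ℝ) :
    prob w (fun f => ¬ ∀ v : ι → ℝ, ∑ x, ((ξ (f x) - α) * (v ⬝ᵥ H x *ᵥ v) -
      β * ((H x *ᵥ v) ⬝ᵥ (H x *ᵥ v))) ≤ τ * (v ⬝ᵥ v)) ≤ Fintype.card ι * Real.exp (-τ) := by
  have hsymm : ∀ f : N → Λ, (∑ x, (ξ (f x) • H x - α • H x - β • (H x * H x))).IsSymm := by
    intro f
    rw [IsSymm, transpose_sum]
    exact Finset.sum_congr rfl fun x _ => (isSymm_smul_sub (hH x) _ _ _).eq
  have hpos : ∀ A : Matrix ι ι ℝ, A.IsSymm → 0 ≤ (NormedSpace.exp A).trace := fun A hA => by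
    obtain ⟨U, e, hU1, hU2, rfl⟩ := exists_eq_mul_diagonal_mul_transpose hA
    rw [exp_mul_diagonal_mul_transpose hU2, Matrix.trace_mul_comm, ← Matrix.mul_assoc, hU1,
      Matrix.one_mul, Matrix.trace_diagonal]
    exact Finset.sum_nonneg fun _ _ => (Real.exp_pos _).le
  calc _ ≤ expect w fun f => Real.exp (-τ) * (NormedSpace.exp
          (∑ x, (ξ (f x) • H x - α • H x - β • (H x * H x)))).trace := by
        refine prob_le_expect hw (fun f => mul_nonneg (Real.exp_pos _).le (hpos _ (hsymm f)))
          fun f hf => ?_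
        by_contra hlt
        refine hf fun v => ?_
        have h := dotProduct_mulVec_le_of_trace_exp_le (hsymm f) (τ := τ) (by
          rw [Real.exp_neg, not_le, inv_mul_lt_iff₀ (Real.exp_pos _), mul_one] at hlt
          exact hlt.le) v
        refine le_trans (le_of_eq ?_) h
        rw [sum_mulVec, dotProduct_sum]
        refine Finset.sum_congr rfl fun x _ => ?_
        have hsq : (H x *ᵥ v) ⬝ᵥ (H x *ᵥ v) = v ⬝ᵥ (H x * H x) *ᵥ v := by
          rw [dotProduct_mulVec, ← vecMul_transpose, (hH x).eq, vecMul_vecMul, dotProduct_mulVec]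
        rw [hsq]
        simp only [sub_mulVec, smul_mulVec, dotProduct_sub, dotProduct_smul, smul_eq_mul]
        ring
    _ ≤ _ := by
        rw [expect_const_mul, mul_comm]
        exact mul_le_mul_of_nonneg_right (expect_trace_exp_le hw hH hlo hhi hmgf)
          (Real.exp_pos _).le

end

/-- The moment generating function of `ξ` under the weight `w` is at most `exp (β t ^ 2)` for
`|t| ≤ b`. -/
def MgfLe {Λ : Type*} [Fintype Λ] (w : Λ → ℝ) (ξ : Λ → ℝ) (β b : ℝ) : Prop :=
  ∀ t, |t| ≤ b → ∑ a, w a * Real.exp (ξ a * t) ≤ Real.exp (β * t ^ 2)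

lemma MgfLe.sum_le_one {Λ : Type*} [Fintype Λ] {w ξ : Λ → ℝ} {β b : ℝ} (h : MgfLe w ξ β b)
    {t : ℝ} (ht : |t| ≤ b) : ∑ a, w a * Real.exp (ξ a * t - 0 * t - β * t ^ 2) ≤ 1 := by
  have h1 : ∀ a, w a * Real.exp (ξ a * t - 0 * t - β * t ^ 2) =
      w a * Real.exp (ξ a * t) * (Real.exp (β * t ^ 2))⁻¹ := fun a => by
    rw [zero_mul, sub_zero, Real.exp_sub]; ring
  simp only [h1, ← Finset.sum_mul]
  rw [mul_inv_le_iff₀ (Real.exp_pos _), one_mul]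
  exact h t ht

/-- `OpLe Z t` says that the `n × n` matrix with entries `Z (i, j)` has operator norm at most `t`.
The bilinear form is compared with `(‖u‖ ^ 2 + ‖v‖ ^ 2) / 2` instead of `‖u‖ * ‖v‖`, which is the
same condition by scaling. -/
def OpLe {n : ℕ} (Z : Fin n × Fin n → ℝ) (t : ℝ) : Prop :=
  ∀ u v : Fin n → ℝ, ∑ x, Z x * (u x.1 * v x.2) ≤ t * ((u ⬝ᵥ u + v ⬝ᵥ v) / 2)

lemma abs_sum_mul_le_half {n : ℕ} {M : Fin n × Fin n → ℝ} {c : ℝ} (hc : 0 ≤ c)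
    (hM : ∑ y, M y ^ 2 ≤ c ^ 2) (u v : Fin n → ℝ) :
    |∑ y, M y * (u y.1 * v y.2)| ≤ c * ((u ⬝ᵥ u + v ⬝ᵥ v) / 2) := by
  have hu : 0 ≤ u ⬝ᵥ u := Finset.sum_nonneg fun _ _ => mul_self_nonneg _
  have hv : 0 ≤ v ⬝ᵥ v := Finset.sum_nonneg fun _ _ => mul_self_nonneg _
  refine abs_le_of_sq_le_sq ?_ (by positivity)
  have hprod : ∑ y : Fin n × Fin n, (u y.1 * v y.2) ^ 2 = (u ⬝ᵥ u) * (v ⬝ᵥ v) := by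
    rw [Fintype.sum_prod_type, dotProduct, dotProduct, Finset.sum_mul_sum]
    exact Finset.sum_congr rfl fun i _ => Finset.sum_congr rfl fun j _ => by ring
  calc (∑ y, M y * (u y.1 * v y.2)) ^ 2
      ≤ (∑ y, M y ^ 2) * ∑ y : Fin n × Fin n, (u y.1 * v y.2) ^ 2 :=
        Finset.sum_mul_sq_le_sq_mul_sq _ _ _
    _ ≤ c ^ 2 * ((u ⬝ᵥ u) * (v ⬝ᵥ v)) := by
        rw [hprod]; gcongr
    _ ≤ c ^ 2 * ((u ⬝ᵥ u + v ⬝ᵥ v) / 2) ^ 2 := by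
        gcongr; nlinarith [sq_nonneg (u ⬝ᵥ u - v ⬝ᵥ v)]
    _ = _ := by ring

section

variable {N Λ : Type*} [Fintype N] [DecidableEq N] [Fintype Λ] {w ξ : Λ → ℝ} {β b : ℝ} {n : ℕ}

/-- Operator norm bound for a random matrix series `∑ ξ (f x) • M x`, by passing to the Hermitian
dilation. -/
lemma prob_not_opLe_sum_le [NeZero n] (hw : IsWeight w) (hξ : MgfLe w ξ β b) (hβ : 0 ≤ β)
    {M : N → Fin n × Fin n → ℝ} {c σ θ : ℝ} (hc : 0 ≤ c) (hθ : 0 < θ)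
    (hM : ∀ x, ∑ y, M x y ^ 2 ≤ c ^ 2)
    (hleft : ∀ u : Fin n → ℝ, ∑ x, ∑ j, (∑ i, M x (i, j) * u i) ^ 2 ≤ σ * (u ⬝ᵥ u))
    (hright : ∀ v : Fin n → ℝ, ∑ x, ∑ i, (∑ j, M x (i, j) * v j) ^ 2 ≤ σ * (v ⬝ᵥ v))
    (hb : θ * c ≤ b) (τ : ℝ) :
    prob w (fun f => ¬ OpLe (fun y => ∑ x, ξ (f x) * M x y) ((τ + θ ^ 2 * β * σ) / θ)) ≤
      2 * n * Real.exp (-τ) := by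
  set H : N → Matrix (Fin n ⊕ Fin n) (Fin n ⊕ Fin n) ℝ := fun x =>
    θ • fromBlocks 0 (Matrix.of fun i j => M x (i, j)) (Matrix.of fun i j => M x (i, j))ᵀ 0 with hH
  have hHv : ∀ x (u v : Fin n → ℝ), H x *ᵥ Sum.elim u v =
      Sum.elim (fun i => θ * ∑ j, M x (i, j) * v j) (fun j => θ * ∑ i, M x (i, j) * u i) := by
    intro x u v
    rw [hH]
    simp only [smul_mulVec, fromBlocks_mulVec]
    ext k
    cases k <;> simp [mulVec, dotProduct]
  have hquad : ∀ x (u v : Fin n → ℝ), Sum.elim u v ⬝ᵥ H x *ᵥ Sum.elim u v =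
      2 * θ * ∑ y, M x y * (u y.1 * v y.2) := by
    intro x u v
    rw [hHv, sumElim_dotProduct_sumElim, dotProduct, dotProduct]
    have h1 : ∑ i, u i * (θ * ∑ j, M x (i, j) * v j) = θ * ∑ y, M x y * (u y.1 * v y.2) := by
      rw [Fintype.sum_prod_type, Finset.mul_sum]
      refine Finset.sum_congr rfl fun i _ => ?_
      simp only [Finset.mul_sum]
      exact Finset.sum_congr rfl fun j _ => by ring
    have h2 : ∑ j, v j * (θ * ∑ i, M x (i, j) * u i) = θ * ∑ y, M x y * (u y.1 * v y.2) := by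
      rw [Fintype.sum_prod_type_right, Finset.mul_sum]
      refine Finset.sum_congr rfl fun i _ => ?_
      simp only [Finset.mul_sum]
      exact Finset.sum_congr rfl fun j _ => by ring
    rw [h1, h2]; ring
  have helim : ∀ p : Fin n ⊕ Fin n → ℝ, Sum.elim (p ∘ Sum.inl) (p ∘ Sum.inr) = p := fun p =>
    Sum.elim_comp_inl_inr p
  have habs : ∀ x (p : Fin n ⊕ Fin n → ℝ), |p ⬝ᵥ H x *ᵥ p| ≤ b * (p ⬝ᵥ p) := by
    intro x p
    obtain ⟨u, v, rfl⟩ : ∃ u v, p = Sum.elim u v := ⟨_, _, (helim p).symm⟩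
    have huv : 0 ≤ u ⬝ᵥ u + v ⬝ᵥ v := add_nonneg (Finset.sum_nonneg fun _ _ => mul_self_nonneg _)
      (Finset.sum_nonneg fun _ _ => mul_self_nonneg _)
    rw [hquad, sumElim_dotProduct_sumElim, abs_mul, abs_of_pos (by positivity : 0 < 2 * θ)]
    calc 2 * θ * |∑ y, M x y * (u y.1 * v y.2)|
        ≤ 2 * θ * (c * ((u ⬝ᵥ u + v ⬝ᵥ v) / 2)) := by
          gcongr; exact abs_sum_mul_le_half hc (hM x) u v
      _ = θ * c * (u ⬝ᵥ u + v ⬝ᵥ v) := by ring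
      _ ≤ _ := by gcongr
  have main := prob_not_quadratic_le (ι := Fin n ⊕ Fin n) hw (H := H) (ξ := ξ) (α := 0) (β := β)
    (lo := -b) (hi := b) (fun x => by
      rw [hH, IsSymm, transpose_smul, fromBlocks_transpose]; simp)
    (fun x v => by linarith [(abs_le.1 (habs x v)).1])
    (fun x v => (abs_le.1 (habs x v)).2) (fun t h1 h2 => hξ.sum_le_one (abs_le.2 ⟨h1, h2⟩)) τ
  have hcard : (Fintype.card (Fin n ⊕ Fin n) : ℝ) = 2 * n := by
    simp only [Fintype.card_sum, Fintype.card_fin]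
    push_cast
    ring
  rw [hcard] at main
  refine (prob_mono hw fun f hf hall => hf fun u v => ?_).trans main
  · have h := hall (Sum.elim u v)
    simp only [hquad, sub_zero, Finset.sum_sub_distrib] at h
    simp only [hHv, sumElim_dotProduct_sumElim] at h
    rw [← Finset.mul_sum] at h
    have h1 : ∑ x, ((fun i => θ * ∑ j, M x (i, j) * v j) ⬝ᵥ (fun i => θ * ∑ j, M x (i, j) * v j) +
        (fun j => θ * ∑ i, M x (i, j) * u i) ⬝ᵥ (fun j => θ * ∑ i, M x (i, j) * u i)) ≤
        θ ^ 2 * (σ * (u ⬝ᵥ u + v ⬝ᵥ v)) := by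
      have h2 := hleft u
      have h3 := hright v
      rw [Finset.sum_add_distrib]
      calc _ = θ ^ 2 * (∑ x, ∑ i, (∑ j, M x (i, j) * v j) ^ 2 +
            ∑ x, ∑ j, (∑ i, M x (i, j) * u i) ^ 2) := by
            rw [mul_add, Finset.mul_sum, Finset.mul_sum]
            congr 1 <;>
            · refine Finset.sum_congr rfl fun x _ => ?_
              rw [dotProduct, Finset.mul_sum]
              exact Finset.sum_congr rfl fun i _ => by ring
        _ ≤ _ := by gcongr; linarith
    have h4 : ∑ x, ξ (f x) * (2 * θ * ∑ y, M x y * (u y.1 * v y.2)) =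
        2 * θ * ∑ y, (∑ x, ξ (f x) * M x y) * (u y.1 * v y.2) := by
      simp only [Finset.sum_mul, Finset.mul_sum]
      rw [Finset.sum_comm]
      exact Finset.sum_congr rfl fun x _ => Finset.sum_congr rfl fun y _ => by ring
    rw [h4] at h
    have h5 := mul_le_mul_of_nonneg_left h1 hβ
    rw [div_mul_eq_mul_div, le_div_iff₀ hθ]
    linarith

/-- The scalar case of the matrix tail bound, for both signs. With the parameter
`θ = √(l / (β σ))` the exponent `8 l` and the variance term `l` add up to the constant `9`. -/
lemma prob_not_abs_sum_le (hw : IsWeight w) (hξ : MgfLe w ξ β b) (hβ : 0 < β) {c : N → ℝ}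
    {c₀ σ l : ℝ} (hσ : 0 < σ) (hl : 0 < l) (hc : ∀ x, |c x| ≤ c₀) (hsum : ∑ x, c x ^ 2 ≤ σ)
    (hb : √(l / (β * σ)) * c₀ ≤ b) :
    prob w (fun f => ¬ |∑ x, ξ (f x) * c x| ≤ 9 * √(β * σ * l)) ≤ 2 * Real.exp (-(8 * l)) := by
  have hone : ∀ s : ℝ, |s| = 1 →
      prob w (fun f => ¬ s * ∑ x, ξ (f x) * c x ≤ 9 * √(β * σ * l)) ≤ Real.exp (-(8 * l)) := by
    intro s hs
    set θ := √(l / (β * σ)) with hθdef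
    have hθ : 0 < θ := Real.sqrt_pos.2 (by positivity)
    set H : N → Matrix Unit Unit ℝ := fun x => Matrix.of fun _ _ => θ * s * c x with hH
    have hquad : ∀ x (v : Unit → ℝ), v ⬝ᵥ H x *ᵥ v = θ * s * c x * (v ⬝ᵥ v) := fun x v => by
      simp [hH, dotProduct, mulVec]; ring
    have habs : ∀ x (v : Unit → ℝ), |v ⬝ᵥ H x *ᵥ v| ≤ b * (v ⬝ᵥ v) := fun x v => by
      have hv : 0 ≤ v ⬝ᵥ v := Finset.sum_nonneg fun _ _ => mul_self_nonneg _
      rw [hquad, abs_mul, abs_of_nonneg hv, abs_mul, abs_mul, hs, mul_one, abs_of_pos hθ]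
      gcongr
      exact (mul_le_mul_of_nonneg_left (hc x) hθ.le).trans hb
    have main := prob_not_quadratic_le (ι := Unit) hw (H := H) (ξ := ξ) (α := 0) (β := β)
      (lo := -b) (hi := b) (fun x => by ext; simp [hH])
      (fun x v => by linarith [(abs_le.1 (habs x v)).1])
      (fun x v => (abs_le.1 (habs x v)).2) (fun t h1 h2 => hξ.sum_le_one (abs_le.2 ⟨h1, h2⟩))
      (8 * l)
    refine (prob_mono hw fun f hf hall => hf ?_).trans (main.trans_eq (by simp))
    have h := hall 1
    simp only [hquad, sub_zero, Finset.sum_sub_distrib] at h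
    have hHv : ∀ x, (H x *ᵥ 1) ⬝ᵥ (H x *ᵥ 1) = θ ^ 2 * c x ^ 2 := fun x => by
      have hs2 : s ^ 2 = 1 := by rw [← sq_abs, hs, one_pow]
      simp only [hH, dotProduct, mulVec, Finset.univ_unique, of_apply, Pi.one_apply, mul_one,
        Finset.sum_const, Finset.card_singleton, one_smul]
      linear_combination θ ^ 2 * c x ^ 2 * hs2
    simp only [hHv] at h
    simp only [← Finset.mul_sum] at h
    have hone : (1 : Unit → ℝ) ⬝ᵥ 1 = 1 := by simp [dotProduct]
    have h4 : ∑ x, ξ (f x) * (θ * s * c x * ((1 : Unit → ℝ) ⬝ᵥ 1)) =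
        θ * (s * ∑ x, ξ (f x) * c x) := by
      rw [hone]
      simp only [Finset.mul_sum]
      exact Finset.sum_congr rfl fun x _ => by ring
    rw [h4, hone] at h
    have hθ2 : θ ^ 2 = l / (β * σ) := Real.sq_sqrt (by positivity)
    have h5 : β * (θ ^ 2 * ∑ x, c x ^ 2) ≤ l := by
      calc β * (θ ^ 2 * ∑ x, c x ^ 2) ≤ β * (θ ^ 2 * σ) := by gcongr
        _ = l := by rw [hθ2]; field_simp
    have h6 : θ * √(β * σ * l) = l := by
      rw [hθdef, ← Real.sqrt_mul (by positivity), show l / (β * σ) * (β * σ * l) = l ^ 2 by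
        field_simp, Real.sqrt_sq hl.le]
    have h7 : θ * (s * ∑ x, ξ (f x) * c x) ≤ θ * (9 * √(β * σ * l)) := by
      nlinarith
    exact le_of_mul_le_mul_left h7 hθ
  calc _ ≤ prob w (fun f => (¬ 1 * ∑ x, ξ (f x) * c x ≤ 9 * √(β * σ * l)) ∨
        ¬ (-1) * ∑ x, ξ (f x) * c x ≤ 9 * √(β * σ * l)) := by
        refine prob_mono hw fun f hf => ?_
        by_contra hcon
        push Not at hcon
        exact hf (abs_le.2 ⟨by linarith [hcon.2], by linarith [hcon.1]⟩)
    _ ≤ _ := prob_or_le hw _ _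
    _ ≤ _ := by linarith [hone 1 (by simp), hone (-1) (by simp)]

/-- Operator norm bound for the image under a linear map `𝓛` of a vector with independent entries
`ξ (f x) * Z x`. -/
lemma prob_not_opLe_mulVec_le [NeZero n] (hw : IsWeight w) (hξ : MgfLe w ξ β b) (hβ : 0 < β)
    {𝓛 : Matrix (Fin n × Fin n) (Fin n × Fin n) ℝ} {Z : Fin n × Fin n → ℝ} {a γ l : ℝ}
    (ha : 0 < a) (hγ : 0 < γ) (hl : 0 < l) (hZ : ∀ x, |Z x| ≤ a)
    (h𝓛 : ∀ h, (𝓛ᵀ *ᵥ h) ⬝ᵥ (𝓛ᵀ *ᵥ h) ≤ γ ^ 2 * (h ⬝ᵥ h)) (hb : √(l / (n * β)) ≤ b) :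
    prob w (fun f => ¬ OpLe (𝓛 *ᵥ fun x => ξ (f x) * Z x) (9 * (a * γ) * √(n * β * l))) ≤
      2 * n * Real.exp (-(8 * l)) := by
  have hn : (0 : ℝ) < n := by exact_mod_cast Nat.pos_of_ne_zero (NeZero.ne n)
  set θ := √(l / (n * β)) / (a * γ) with hθdef
  have hθ : 0 < θ := div_pos (Real.sqrt_pos.2 (by positivity)) (by positivity)
  have hZ2 : ∀ x, Z x ^ 2 ≤ a ^ 2 := fun x => sq_le_sq.2 ((hZ x).trans (le_abs_self a))
  have hcol : ∀ x, ∑ y, 𝓛 y x ^ 2 ≤ γ ^ 2 := by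
    intro x
    have h1 := h𝓛 fun y => 𝓛 y x
    set s := ∑ y, 𝓛 y x ^ 2 with hs
    have hs0 : 0 ≤ s := Finset.sum_nonneg fun _ _ => sq_nonneg _
    have hx : (𝓛ᵀ *ᵥ fun y => 𝓛 y x) x = s := by
      simp only [mulVec, dotProduct, transpose_apply, hs]
      exact Finset.sum_congr rfl fun y _ => by ring
    have h2 : s * s ≤ (𝓛ᵀ *ᵥ fun y => 𝓛 y x) ⬝ᵥ (𝓛ᵀ *ᵥ fun y => 𝓛 y x) := by
      rw [← hx]
      exact Finset.single_le_sum (f := fun z => (𝓛ᵀ *ᵥ fun y => 𝓛 y x) z *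
        (𝓛ᵀ *ᵥ fun y => 𝓛 y x) z) (fun _ _ => mul_self_nonneg _) (Finset.mem_univ x)
    have h3 : (fun y => 𝓛 y x) ⬝ᵥ (fun y => 𝓛 y x) = s := by
      simp only [dotProduct, hs]
      exact Finset.sum_congr rfl fun y _ => by ring
    rw [h3] at h1
    rcases hs0.eq_or_lt with h0 | h0
    · rw [← h0]; positivity
    · exact le_of_mul_le_mul_right (h2.trans h1) h0
  -- each of the `n` rows (or columns) of a matrix contributes at most `a ^ 2 * γ ^ 2 * K`
  have hvar : ∀ (κ : Fin n → Fin n × Fin n → ℝ) (K : ℝ), (∀ j, κ j ⬝ᵥ κ j = K) →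
      ∑ x, ∑ j, (∑ y, Z x * 𝓛 y x * κ j y) ^ 2 ≤ a ^ 2 * γ ^ 2 * n * K := by
    intro κ K hκ
    rw [Finset.sum_comm]
    calc ∑ j, ∑ x, (∑ y, Z x * 𝓛 y x * κ j y) ^ 2
        ≤ ∑ _j : Fin n, a ^ 2 * (γ ^ 2 * K) := by
          refine Finset.sum_le_sum fun j _ => ?_
          rw [← hκ j]
          refine le_trans ?_ (mul_le_mul_of_nonneg_left (h𝓛 (κ j)) (sq_nonneg a))
          rw [dotProduct, Finset.mul_sum]
          refine Finset.sum_le_sum fun x _ => ?_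
          have : ∑ y, Z x * 𝓛 y x * κ j y = Z x * (𝓛ᵀ *ᵥ κ j) x := by
            simp only [mulVec, dotProduct, transpose_apply, Finset.mul_sum, mul_assoc]
          rw [this, mul_pow, ← sq]
          exact mul_le_mul_of_nonneg_right (hZ2 x) (sq_nonneg _)
      _ = _ := by simp; ring
  have main := prob_not_opLe_sum_le hw hξ hβ.le (M := fun x y => Z x * 𝓛 y x) (c := a * γ)
    (σ := a ^ 2 * γ ^ 2 * n) (by positivity) hθ (fun x => ?_) (fun u => ?_) (fun v => ?_)
    (by rw [hθdef, div_mul_cancel₀ _ (by positivity)]; exact hb) (8 * l)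
  · have hvec : ∀ f : Fin n × Fin n → Λ, (𝓛 *ᵥ fun x => ξ (f x) * Z x) =
        fun y => ∑ x, ξ (f x) * (Z x * 𝓛 y x) := fun f => by
      ext y
      simp only [mulVec, dotProduct]
      exact Finset.sum_congr rfl fun x _ => by ring
    have hconst : (8 * l + θ ^ 2 * β * (a ^ 2 * γ ^ 2 * n)) / θ =
        9 * (a * γ) * √(n * β * l) := by
      set r := √(l / (n * β)) with hr
      have hr0 : 0 < r := Real.sqrt_pos.2 (by positivity)
      have hr2 : r ^ 2 = l / (n * β) := Real.sq_sqrt (by positivity)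
      have hrs : r * √(n * β * l) = l := by
        rw [hr, ← Real.sqrt_mul (by positivity), show l / (n * β) * (n * β * l) = l ^ 2 by
          field_simp, Real.sqrt_sq hl.le]
      have h1 : θ ^ 2 * β * (a ^ 2 * γ ^ 2 * n) = l := by
        rw [hθdef, div_pow, hr2]; field_simp
      rw [h1, div_eq_iff hθ.ne', hθdef]
      generalize √(n * β * l) = z at hrs ⊢
      field_simp
      linear_combination -9 * hrs
    rw [hconst] at main
    simpa only [hvec] using main
  · calc ∑ y, (Z x * 𝓛 y x) ^ 2 = Z x ^ 2 * ∑ y, 𝓛 y x ^ 2 := by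
          rw [Finset.mul_sum]; exact Finset.sum_congr rfl fun y _ => by ring
      _ ≤ a ^ 2 * γ ^ 2 := mul_le_mul (hZ2 x) (hcol x) (Finset.sum_nonneg fun _ _ => sq_nonneg _)
          (sq_nonneg a)
      _ = _ := by ring
  · refine le_trans (le_of_eq ?_) (hvar (fun j y => if y.2 = j then u y.1 else 0) (u ⬝ᵥ u) ?_)
    · refine Finset.sum_congr rfl fun x _ => Finset.sum_congr rfl fun j _ => ?_
      rw [Fintype.sum_prod_type]
      simp
    · intro j
      simp [dotProduct, Fintype.sum_prod_type]
  · refine le_trans (le_of_eq ?_) (hvar (fun j y => if y.1 = j then v y.2 else 0) (v ⬝ᵥ v) ?_)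
    · refine Finset.sum_congr rfl fun x _ => Finset.sum_congr rfl fun j _ => ?_
      rw [Fintype.sum_prod_type_right]
      simp
    · intro j
      simp [dotProduct, Fintype.sum_prod_type_right]

end

end RobustMC

/-! ### The nuclear norm and its dual characterisation -/

namespace RobustMC

open Matrix

lemma dotProduct_self_nonneg' {ι : Type*} [Fintype ι] (v : ι → ℝ) : 0 ≤ v ⬝ᵥ v :=
  Finset.sum_nonneg fun _ _ => mul_self_nonneg _

lemma dotProduct_mulVec_symm {ι κ : Type*} [Fintype ι] [Fintype κ] (A : Matrix ι κ ℝ)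
    (u : ι → ℝ) (v : κ → ℝ) : u ⬝ᵥ A *ᵥ v = (Aᵀ *ᵥ u) ⬝ᵥ v := by
  rw [dotProduct_mulVec, mulVec_transpose]

/-- Pythagoras for an orthogonal projection. -/
lemma dotProduct_self_eq_add_of_proj {ι : Type*} [Fintype ι] [DecidableEq ι] {A : Matrix ι ι ℝ}
    (hs : Aᵀ = A) (hi : A * A = A) (v : ι → ℝ) :
    v ⬝ᵥ v = (A *ᵥ v) ⬝ᵥ (A *ᵥ v) + ((1 - A) *ᵥ v) ⬝ᵥ ((1 - A) *ᵥ v) := by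
  have h : (A *ᵥ v) ⬝ᵥ (A *ᵥ v) = (A *ᵥ v) ⬝ᵥ v := by
    rw [dotProduct_mulVec_symm, hs, mulVec_mulVec, hi]
  rw [sub_mulVec, one_mulVec, sub_dotProduct, dotProduct_sub, dotProduct_sub, h,
    dotProduct_comm v (A *ᵥ v)]
  ring

lemma proj_dotProduct_self_le {ι : Type*} [Fintype ι] [DecidableEq ι] {A : Matrix ι ι ℝ}
    (hs : Aᵀ = A) (hi : A * A = A) (v : ι → ℝ) : (A *ᵥ v) ⬝ᵥ (A *ᵥ v) ≤ v ⬝ᵥ v := by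
  rw [dotProduct_self_eq_add_of_proj hs hi v]
  linarith [dotProduct_self_nonneg' ((1 - A) *ᵥ v)]

/-- The right singular vectors of `M`, as the columns of an orthogonal matrix. -/
lemma exists_singular_basis {n : ℕ} (M : Matrix (Fin n) (Fin n) ℝ) :
    ∃ (B : Matrix (Fin n) (Fin n) ℝ) (s : Fin n → ℝ), Bᵀ * B = 1 ∧ B * Bᵀ = 1 ∧ (∀ i, 0 ≤ s i) ∧
      (M * B)ᵀ * (M * B) = diagonal (fun i => s i ^ 2) ∧ nuclearNorm M = ∑ i, s i := by
  set T := Matrix.toEuclideanLin M with hT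
  have hfin : Module.finrank ℝ (EuclideanSpace ℝ (Fin n)) = n := finrank_euclideanSpace_fin
  set b := T.isSymmetric_adjoint_comp_self.eigenvectorBasis hfin with hb
  set B : Matrix (Fin n) (Fin n) ℝ := Matrix.of fun k i => b i k with hB
  have hTb : ∀ i k, (T (b i)) k = (M * B) k i := fun i k => by
    simp [hT, hB, Matrix.toLpLin_apply, mul_apply, mulVec, dotProduct]
  have h1 : Bᵀ * B = 1 := by
    ext i j
    have h := b.inner_eq_ite i j
    rw [PiLp.inner_apply] at h
    simp only [mul_apply, transpose_apply, hB, of_apply, one_apply, ← h]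
    exact Finset.sum_congr rfl fun k _ => by simp [mul_comm]
  refine ⟨B, fun i => T.singularValues i, h1, mul_eq_one_comm.1 h1,
    fun i => T.singularValues_nonneg i, ?_, ?_⟩
  · ext i j
    have h : inner ℝ (T (b i)) (T (b j)) = if i = j then T.singularValues i ^ 2 else 0 := by
      rw [← LinearMap.adjoint_inner_right, ← LinearMap.comp_apply, hb,
        T.isSymmetric_adjoint_comp_self.apply_eigenvectorBasis hfin j, ← hb, inner_smul_right,
        b.inner_eq_ite]
      split_ifs with hij
      · subst hij
        simp [T.sq_singularValues_fin hfin]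
      · simp
    rw [PiLp.inner_apply] at h
    rw [diagonal_apply, ← h, mul_apply]
    refine Finset.sum_congr rfl fun k _ => ?_
    rw [transpose_apply, ← hTb, ← hTb]
    simp only [RCLike.inner_apply, conj_trivial]
    ring
  · rw [nuclearNorm, ← Fin.sum_univ_eq_sum_range fun k => T.singularValues k]

lemma sum_mul_eq_trace {n : ℕ} (W M : Matrix (Fin n) (Fin n) ℝ) :
    ∑ x : Fin n × Fin n, W x.1 x.2 * M x.1 x.2 = (Wᵀ * M).trace := by
  rw [Fintype.sum_prod_type_right]
  simp [Matrix.trace, mul_apply]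

lemma opLe_iff {n : ℕ} {W : Matrix (Fin n) (Fin n) ℝ} {t : ℝ} :
    OpLe (fun x => W x.1 x.2) t ↔
      ∀ u v : Fin n → ℝ, u ⬝ᵥ W *ᵥ v ≤ t * ((u ⬝ᵥ u + v ⬝ᵥ v) / 2) := by
  have h : ∀ u v : Fin n → ℝ, ∑ x : Fin n × Fin n, W x.1 x.2 * (u x.1 * v x.2) = u ⬝ᵥ W *ᵥ v := by
    intro u v
    rw [Fintype.sum_prod_type]
    simp only [dotProduct, mulVec, Finset.mul_sum]
    exact Finset.sum_congr rfl fun i _ => Finset.sum_congr rfl fun j _ => by ring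
  simp only [OpLe, h]

/-- The nuclear norm is dual to the operator norm. -/
lemma sum_mul_le_nuclearNorm {n : ℕ} {W : Matrix (Fin n) (Fin n) ℝ}
    (hW : OpLe (fun x => W x.1 x.2) 1) (M : Matrix (Fin n) (Fin n) ℝ) :
    ∑ x : Fin n × Fin n, W x.1 x.2 * M x.1 x.2 ≤ nuclearNorm M := by
  obtain ⟨B, s, h1, h2, hs, hMB, hnuc⟩ := exists_singular_basis M
  rw [opLe_iff] at hW
  have htr : (Wᵀ * M).trace = ((W * B)ᵀ * (M * B)).trace := by
    rw [transpose_mul, Matrix.mul_assoc, trace_mul_comm Bᵀ, Matrix.mul_assoc, Matrix.mul_assoc,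
      h2, Matrix.mul_one]
  rw [sum_mul_eq_trace, htr, hnuc, Matrix.trace]
  refine Finset.sum_le_sum fun i _ => ?_
  set p : Fin n → ℝ := fun k => (M * B) k i with hp
  set q : Fin n → ℝ := fun k => B k i with hq
  have hpp : p ⬝ᵥ p = s i ^ 2 := by
    have h := congrFun (congrFun hMB i) i
    rw [mul_apply, diagonal_apply_eq] at h
    exact h
  have hqq : q ⬝ᵥ q = 1 := by
    have h := congrFun (congrFun h1 i) i
    simpa [mul_apply, dotProduct] using h
  have hpq : diag ((W * B)ᵀ * (M * B)) i = p ⬝ᵥ W *ᵥ q := by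
    simp only [diag_apply, mul_apply (M := (W * B)ᵀ), transpose_apply, dotProduct, hp, hq]
    exact Finset.sum_congr rfl fun k _ => by rw [mul_comm]; rfl
  rw [hpq]
  rcases (hs i).eq_or_lt with h0 | h0
  · have hp0 : p = 0 := by
      rw [← dotProduct_self_eq_zero, hpp, ← h0]; norm_num
    rw [hp0, zero_dotProduct, ← h0]
  -- rescaling `p` and `q` to equal norms turns the arithmetic mean in `OpLe` into `s i`
  · have hr : 0 < √(s i) := Real.sqrt_pos.2 h0
    have hr2 : √(s i) ^ 2 = s i := Real.sq_sqrt h0.le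
    have h := hW ((√(s i))⁻¹ • p) (√(s i) • q)
    simp only [mulVec_smul, smul_dotProduct, dotProduct_smul, smul_eq_mul, hpp, hqq] at h
    have e1 : √(s i) * ((√(s i))⁻¹ * p ⬝ᵥ W *ᵥ q) = p ⬝ᵥ W *ᵥ q := by field_simp
    have e2 : (√(s i))⁻¹ * ((√(s i))⁻¹ * s i ^ 2) = s i := by
      rw [← mul_assoc, ← mul_inv, ← sq, hr2]; field_simp
    have e3 : √(s i) * (√(s i) * 1) = s i := by rw [mul_one, ← sq, hr2]
    linarith

/-- The nuclear norm is at most the sum of the weights of any decomposition with orthonormal systems,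
by pairing with its own singular vectors. -/
lemma nuclearNorm_mul_diagonal_mul_transpose_le {n r : ℕ} {U V : Matrix (Fin n) (Fin r) ℝ}
    {σ : Fin r → ℝ} (hU : Uᵀ * U = 1) (hV : Vᵀ * V = 1) (hσ : ∀ k, 0 ≤ σ k) :
    nuclearNorm (U * diagonal σ * Vᵀ) ≤ ∑ k, σ k := by
  obtain ⟨B, s, h1, h2, hs, hMB, hnuc⟩ := exists_singular_basis (U * diagonal σ * Vᵀ)
  set M := U * diagonal σ * Vᵀ with hM
  -- the left singular vectors, with zero columns where the singular value vanishes
  set C := M * B * diagonal (fun i => (s i)⁻¹) with hC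
  have hCC : Cᵀ * C = diagonal fun i => if s i = 0 then 0 else 1 := by
    rw [hC, transpose_mul, diagonal_transpose, Matrix.mul_assoc, ← Matrix.mul_assoc (M * B)ᵀ, hMB,
      diagonal_mul_diagonal, diagonal_mul_diagonal]
    congr 1
    funext i
    split_ifs with h
    · simp [h]
    · field_simp
  have hCP : C * (Cᵀ * C) = C := by
    rw [hCC, hC, Matrix.mul_assoc, diagonal_mul_diagonal]
    congr 2
    funext i
    split_ifs with h <;> simp [h]
  have hproj : ∀ u : Fin n → ℝ, (Cᵀ *ᵥ u) ⬝ᵥ (Cᵀ *ᵥ u) ≤ u ⬝ᵥ u := fun u => by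
    have hi : C * Cᵀ * (C * Cᵀ) = C * Cᵀ := by
      rw [Matrix.mul_assoc, ← Matrix.mul_assoc Cᵀ, ← Matrix.mul_assoc, hCP]
    have hsym : (C * Cᵀ)ᵀ = C * Cᵀ := by simp [transpose_mul]
    have h := proj_dotProduct_self_le hsym hi u
    have h3 : ((C * Cᵀ) *ᵥ u) ⬝ᵥ ((C * Cᵀ) *ᵥ u) = (Cᵀ *ᵥ u) ⬝ᵥ (Cᵀ *ᵥ u) := by
      rw [dotProduct_mulVec_symm, hsym, mulVec_mulVec, hi, dotProduct_comm, ← mulVec_mulVec,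
        dotProduct_mulVec_symm]
    rwa [h3] at h
  have hBv : ∀ v : Fin n → ℝ, (Bᵀ *ᵥ v) ⬝ᵥ (Bᵀ *ᵥ v) = v ⬝ᵥ v := fun v => by
    rw [dotProduct_mulVec_symm, transpose_transpose, mulVec_mulVec, h2, one_mulVec]
  have hop : ∀ u v : Fin n → ℝ, u ⬝ᵥ (C * Bᵀ) *ᵥ v ≤ (u ⬝ᵥ u + v ⬝ᵥ v) / 2 := fun u v => by
    rw [← mulVec_mulVec, dotProduct_mulVec_symm]
    have h := dotProduct_self_nonneg' (Cᵀ *ᵥ u - Bᵀ *ᵥ v)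
    rw [sub_dotProduct, dotProduct_sub, dotProduct_sub, dotProduct_comm (Bᵀ *ᵥ v) (Cᵀ *ᵥ u)] at h
    linarith [hproj u, hBv v]
  have hsum : ∑ i, s i = ((C * Bᵀ)ᵀ * M).trace := by
    rw [transpose_mul, transpose_transpose, Matrix.mul_assoc, trace_mul_comm, Matrix.mul_assoc, hC,
      transpose_mul, Matrix.mul_assoc, hMB, diagonal_transpose, diagonal_mul_diagonal,
      trace_diagonal]
    refine Finset.sum_congr rfl fun i _ => ?_
    by_cases h : s i = 0
    · simp [h]
    · field_simp
  have htr : ((C * Bᵀ)ᵀ * M).trace =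
      ∑ k, σ k * ((fun i => U i k) ⬝ᵥ (C * Bᵀ) *ᵥ fun j => V j k) := by
    have hcyc : ((C * Bᵀ)ᵀ * M).trace = (diagonal σ * (Vᵀ * (C * Bᵀ)ᵀ * U)).trace := by
      rw [hM, Matrix.mul_assoc U, ← Matrix.mul_assoc _ U, trace_mul_comm, Matrix.mul_assoc,
        ← Matrix.mul_assoc Vᵀ]
    rw [hcyc, Matrix.trace]
    refine Finset.sum_congr rfl fun k _ => ?_
    rw [diag_apply, diagonal_mul]
    congr 1
    rw [← transpose_mul, mul_apply, dotProduct]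
    refine Finset.sum_congr rfl fun i _ => ?_
    rw [transpose_apply, mul_comm]
    rfl
  rw [hnuc, hsum, htr]
  refine Finset.sum_le_sum fun k _ => ?_
  have h := hop (fun i => U i k) fun j => V j k
  have hu : (fun i => U i k) ⬝ᵥ (fun i => U i k) = 1 := by
    simpa [mul_apply, dotProduct] using congrFun (congrFun hU k) k
  have hv : (fun i => V i k) ⬝ᵥ (fun i => V i k) = 1 := by
    simpa [mul_apply, dotProduct] using congrFun (congrFun hV k) k
  rw [hu, hv] at h
  nlinarith [hσ k]

end RobustMC

/-! ### The tangent space and exact recovery from a dual certificate -/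

namespace RobustMC

open Matrix

/-- The orthogonal projection onto the tangent space `{U Xᵀ + Y Vᵀ}`, as a matrix acting on vectors
indexed by the entries: `M ↦ M - (1 - U Uᵀ) M (1 - V Vᵀ)`. -/
noncomputable def tangentProj {n r : ℕ} (U V : Matrix (Fin n) (Fin r) ℝ) :
    Matrix (Fin n × Fin n) (Fin n × Fin n) ℝ :=
  1 - kroneckerMap (· * ·) (1 - U * Uᵀ) (1 - V * Vᵀ)

section

variable {n r : ℕ} {U V : Matrix (Fin n) (Fin r) ℝ}

lemma mul_transpose_proj (hU : Uᵀ * U = 1) : U * Uᵀ * (U * Uᵀ) = U * Uᵀ := by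
  rw [Matrix.mul_assoc, ← Matrix.mul_assoc Uᵀ, hU, Matrix.one_mul]

lemma one_sub_mul_self_of_proj {ι : Type*} [Fintype ι] [DecidableEq ι] {A : Matrix ι ι ℝ}
    (hA : A * A = A) : (1 - A) * (1 - A) = 1 - A := by
  rw [Matrix.mul_sub, Matrix.sub_mul, Matrix.sub_mul, hA]; simp

lemma tangentProj_transpose : (tangentProj U V)ᵀ = tangentProj U V := by
  rw [tangentProj, transpose_sub, transpose_one, ← kroneckerMap_transpose]
  simp [transpose_mul]

lemma tangentProj_mul_self (hU : Uᵀ * U = 1) (hV : Vᵀ * V = 1) :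
    tangentProj U V * tangentProj U V = tangentProj U V := by
  refine one_sub_mul_self_of_proj ?_
  have h := (mul_kronecker_mul (1 - U * Uᵀ) (1 - U * Uᵀ) (1 - V * Vᵀ) (1 - V * Vᵀ)).symm
  rw [one_sub_mul_self_of_proj (mul_transpose_proj hU),
    one_sub_mul_self_of_proj (mul_transpose_proj hV)] at h
  exact h

lemma one_sub_tangentProj_mulVec (M : Matrix (Fin n) (Fin n) ℝ) :
    (1 - tangentProj U V) *ᵥ (fun x => M x.1 x.2) =
      fun x => ((1 - U * Uᵀ) * M * (1 - V * Vᵀ) : Matrix (Fin n) (Fin n) ℝ) x.1 x.2 := by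
  have hsym : ∀ j l, (1 - V * Vᵀ : Matrix (Fin n) (Fin n) ℝ) j l = (1 - V * Vᵀ : Matrix _ _ ℝ) l j :=
    fun j l => congrFun (congrFun (show (1 - V * Vᵀ)ᵀ = 1 - V * Vᵀ by simp [transpose_mul]) l) j
  ext ⟨i, j⟩
  rw [tangentProj, sub_sub_cancel]
  simp only [mulVec, dotProduct, kroneckerMap_apply, mul_apply (M := (1 - U * Uᵀ) * M),
    mul_apply (M := 1 - U * Uᵀ), Fintype.sum_prod_type_right, Finset.sum_mul]
  refine Finset.sum_congr rfl fun l _ => Finset.sum_congr rfl fun k _ => ?_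
  rw [hsym j l]; ring

lemma tangentProj_mulVec_of_eq_mul (X : Matrix (Fin r) (Fin n) ℝ) (hU : Uᵀ * U = 1) :
    tangentProj U V *ᵥ (fun x => (U * X) x.1 x.2) = fun x => (U * X) x.1 x.2 := by
  have h := one_sub_tangentProj_mulVec (U := U) (V := V) (U * X)
  have h0 : (1 - U * Uᵀ) * (U * X) = 0 := by
    rw [Matrix.sub_mul, Matrix.one_mul, Matrix.mul_assoc, ← Matrix.mul_assoc Uᵀ, hU, Matrix.one_mul,
      sub_self]
  rw [h0, sub_mulVec, one_mulVec, Matrix.zero_mul] at h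
  exact (sub_eq_zero.1 h).symm

lemma sum_one_sub_tangentProj_mulVec_mul (Z : Fin n × Fin n → ℝ) (u v : Fin n → ℝ) :
    ∑ x, ((1 - tangentProj U V) *ᵥ Z) x * (u x.1 * v x.2) =
      ∑ x, Z x * (((1 - U * Uᵀ) *ᵥ u) x.1 * ((1 - V * Vᵀ) *ᵥ v) x.2) := by
  have hT : (1 - tangentProj U V)ᵀ = 1 - tangentProj U V := by
    rw [transpose_sub, transpose_one, tangentProj_transpose]
  have hk : (1 - tangentProj U V) *ᵥ (fun x : Fin n × Fin n => u x.1 * v x.2) =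
      fun x => ((1 - U * Uᵀ) *ᵥ u) x.1 * ((1 - V * Vᵀ) *ᵥ v) x.2 := by
    ext ⟨i, j⟩
    rw [tangentProj, sub_sub_cancel]
    simp only [mulVec, dotProduct, kroneckerMap_apply, Fintype.sum_prod_type, Finset.sum_mul_sum]
    exact Finset.sum_congr rfl fun k _ => Finset.sum_congr rfl fun l _ => by ring
  have h := dotProduct_mulVec_symm (1 - tangentProj U V) Z fun x => u x.1 * v x.2
  rw [hT, hk] at h
  exact h.symm

lemma OpLe.one_sub_tangentProj (hU : Uᵀ * U = 1) (hV : Vᵀ * V = 1) {Z : Fin n × Fin n → ℝ}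
    {t : ℝ} (ht : 0 ≤ t) (hZ : OpLe Z t) : OpLe ((1 - tangentProj U V) *ᵥ Z) t := by
  intro u v
  rw [sum_one_sub_tangentProj_mulVec_mul]
  refine (hZ _ _).trans ?_
  have h1 := dotProduct_self_eq_add_of_proj (by simp [transpose_mul]) (mul_transpose_proj hU) u
  have h2 := dotProduct_self_eq_add_of_proj (by simp [transpose_mul]) (mul_transpose_proj hV) v
  have h3 := dotProduct_self_nonneg' ((U * Uᵀ) *ᵥ u)
  have h4 := dotProduct_self_nonneg' ((V * Vᵀ) *ᵥ v)
  exact mul_le_mul_of_nonneg_left (by linarith) ht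

lemma OpLe.add {Z Z' : Fin n × Fin n → ℝ} {t t' : ℝ} (h : OpLe Z t) (h' : OpLe Z' t') :
    OpLe (Z + Z') (t + t') := by
  intro u v
  simp only [Pi.add_apply, add_mul, Finset.sum_add_distrib]
  exact add_le_add (h u v) (h' u v)

lemma OpLe.neg {Z : Fin n × Fin n → ℝ} {t : ℝ} (h : OpLe Z t) : OpLe (-Z) t := by
  intro u v
  have h1 := h (-u) v
  simp only [Pi.neg_apply, dotProduct_neg, neg_dotProduct, neg_neg] at h1
  refine (le_of_eq ?_).trans h1
  exact Finset.sum_congr rfl fun x _ => by simp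

lemma OpLe.mono {Z : Fin n × Fin n → ℝ} {t t' : ℝ} (h : OpLe Z t) (ht : t ≤ t') : OpLe Z t' :=
  fun u v => (h u v).trans <| mul_le_mul_of_nonneg_right ht <| by
    linarith [dotProduct_self_nonneg' u, dotProduct_self_nonneg' v]

/-- Adding to `U Vᵀ` a matrix of the orthogonal complement of the tangent space with operator norm at
most one gives a subgradient of the nuclear norm. -/
lemma opLe_cross_add (hU : Uᵀ * U = 1) (hV : Vᵀ * V = 1) {W : Fin n × Fin n → ℝ}
    (hW : OpLe W 1) (hWT : (1 - tangentProj U V) *ᵥ W = W) :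
    OpLe ((fun x => (U * Vᵀ) x.1 x.2) + W) 1 := by
  intro u v
  simp only [Pi.add_apply, add_mul, Finset.sum_add_distrib]
  have h1 := dotProduct_self_eq_add_of_proj (by simp [transpose_mul]) (mul_transpose_proj hU) u
  have h2 := dotProduct_self_eq_add_of_proj (by simp [transpose_mul]) (mul_transpose_proj hV) v
  have h3 : ∀ (X : Matrix (Fin n) (Fin r) ℝ) (z : Fin n → ℝ), Xᵀ * X = 1 →
      ((X * Xᵀ) *ᵥ z) ⬝ᵥ ((X * Xᵀ) *ᵥ z) = (Xᵀ *ᵥ z) ⬝ᵥ (Xᵀ *ᵥ z) := fun X z hX => by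
    rw [← mulVec_mulVec, dotProduct_mulVec_symm, mulVec_mulVec, hX, one_mulVec]
  rw [h3 U u hU] at h1
  rw [h3 V v hV] at h2
  have h4 : ∑ x : Fin n × Fin n, (U * Vᵀ) x.1 x.2 * (u x.1 * v x.2) =
      (Uᵀ *ᵥ u) ⬝ᵥ (Vᵀ *ᵥ v) := by
    rw [← dotProduct_mulVec_symm, mulVec_mulVec, Fintype.sum_prod_type]
    simp only [dotProduct, mulVec, Finset.mul_sum]
    exact Finset.sum_congr rfl fun i _ => Finset.sum_congr rfl fun j _ => by ring
  have h5 := dotProduct_self_nonneg' (Uᵀ *ᵥ u - Vᵀ *ᵥ v)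
  rw [sub_dotProduct, dotProduct_sub, dotProduct_sub, dotProduct_comm (Vᵀ *ᵥ v)] at h5
  have h6 := hW ((1 - U * Uᵀ) *ᵥ u) ((1 - V * Vᵀ) *ᵥ v)
  rw [← sum_one_sub_tangentProj_mulVec_mul, hWT] at h6
  linarith

end

lemma dotProduct_le_sqrt_mul_sqrt {ι : Type*} [Fintype ι] (a b : ι → ℝ) :
    a ⬝ᵥ b ≤ √(a ⬝ᵥ a) * √(b ⬝ᵥ b) := by
  simpa [dotProduct, sq] using Real.sum_mul_le_sqrt_mul_sqrt Finset.univ a b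

lemma sqrt_sum_sq_le_sum_abs {ι : Type*} (s : Finset ι) (a : ι → ℝ) :
    √(∑ x ∈ s, a x ^ 2) ≤ ∑ x ∈ s, |a x| := by
  refine Real.sqrt_le_iff.2 ⟨Finset.sum_nonneg fun _ _ => abs_nonneg _, ?_⟩
  simpa only [sq_abs] using Finset.sum_sq_le_sq_sum_of_nonneg (s := s) (f := fun x => |a x|)
    fun _ _ => abs_nonneg _

lemma abs_sub_ge_of_sign {s k h : ℝ} (hk : k = 1 ∨ k = -1) (hs : Real.sign s = k) :
    |s| - k * h ≤ |s - h| := by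
  rcases lt_trichotomy s 0 with h0 | h0 | h0
  · rw [Real.sign_of_neg h0] at hs
    rw [abs_of_neg h0, ← hs]
    linarith [neg_abs_le (s - h)]
  · rw [h0, Real.sign_zero] at hs
    rcases hk with hk | hk <;> norm_num [hk] at hs
  · rw [Real.sign_of_pos h0] at hs
    rw [abs_of_pos h0, ← hs]
    linarith [le_abs_self (s - h)]

/-- The `ℓ¹` part of the objective grows at least linearly along feasible directions. -/
lemma l1_gain {n : ℕ} {O Om : Finset (Fin n × Fin n)} {S K : Matrix (Fin n) (Fin n) ℝ}
    {lam : ℝ} {Q h : Fin n × Fin n → ℝ} (hlam : 0 < lam)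
    (hK : ∀ i j, K i j = 1 ∨ K i j = -1)
    (hS : ∀ i j, Real.sign (S i j) = proj Om K i j)
    (hQ0 : ∀ x, x ∉ O → Q x = 0) (hQ1 : ∀ x ∈ Om, Q x = lam * K x.1 x.2)
    (hQ2 : ∀ x ∈ O \ Om, |Q x| ≤ 3 / 4 * lam) :
    lam * l1Norm S - Q ⬝ᵥ h + lam / 4 * ∑ x ∈ O \ Om, |h x| ≤
      lam * ∑ x : Fin n × Fin n, |S x.1 x.2 - if x ∈ O then h x else 0| := by
  have hl1 : l1Norm S = ∑ x : Fin n × Fin n, |S x.1 x.2| := by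
    rw [l1Norm, Fintype.sum_prod_type]
  rw [hl1, Finset.mul_sum, Finset.mul_sum, Finset.mul_sum, dotProduct, ← Finset.sum_sub_distrib,
    ← Finset.univ_inter (O \ Om), ← Finset.sum_ite_mem, ← Finset.sum_add_distrib]
  refine Finset.sum_le_sum fun x _ => ?_
  have hSx := hS x.1 x.2
  simp only [proj, of_apply, Prod.mk.eta] at hSx
  by_cases hxO : x ∈ O
  · by_cases hxm : x ∈ Om
    · rw [if_pos hxm] at hSx
      have h1 := abs_sub_ge_of_sign (h := h x) (hK x.1 x.2) hSx
      simp only [Finset.mem_sdiff, hxO, hxm, not_true_eq_false, and_false, if_false, if_true,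
        hQ1 x hxm]
      nlinarith
    · rw [if_neg hxm, Real.sign_eq_zero_iff] at hSx
      have hx : x ∈ O \ Om := Finset.mem_sdiff.2 ⟨hxO, hxm⟩
      simp only [if_pos hx, if_pos hxO, hSx, abs_zero, zero_sub, abs_neg, mul_zero]
      have h1 := neg_abs_le (Q x * h x)
      rw [abs_mul] at h1
      have h2 := mul_le_mul_of_nonneg_right (hQ2 x hx) (abs_nonneg (h x))
      nlinarith
  · have hx : x ∉ O \ Om := fun hx => hxO (Finset.mem_sdiff.1 hx).1
    simp [hx, hxO, hQ0 x hxO]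

/-- A dual certificate `Q` that is exact on the corrupted entries, strictly feasible on the clean
ones and inexact on the tangent space, together with the injectivity of the sampling of the clean
entries on the tangent space, forces exact recovery. -/
theorem exactRecovery_of_certificate {n r : ℕ} {L : Matrix (Fin n) (Fin n) ℝ}
    {U V : Matrix (Fin n) (Fin r) ℝ} {σ : Fin r → ℝ} (hsvd : IsReducedSVD L U σ V)
    {O Om : Finset (Fin n × Fin n)} {S K : Matrix (Fin n) (Fin n) ℝ} {lam ε κ : ℝ}
    {Q : Fin n × Fin n → ℝ} (hlam : 0 < lam) (hlam1 : lam ≤ 1) (hκ : 0 < κ)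
    (hK : ∀ i j, K i j = 1 ∨ K i j = -1)
    (hS : ∀ i j, Real.sign (S i j) = proj Om K i j)
    (hQ0 : ∀ x, x ∉ O → Q x = 0) (hQ1 : ∀ x ∈ Om, Q x = lam * K x.1 x.2)
    (hQ2 : ∀ x ∈ O \ Om, |Q x| ≤ 3 / 4 * lam)
    (hQop : OpLe ((1 - tangentProj U V) *ᵥ Q) (1 / 2))
    (hε0 : 0 ≤ ε)
    (hQT : (tangentProj U V *ᵥ Q - fun x => (U * Vᵀ) x.1 x.2) ⬝ᵥ
      (tangentProj U V *ᵥ Q - fun x => (U * Vᵀ) x.1 x.2) ≤ ε ^ 2)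
    (hε : ε ≤ κ * (lam / 8))
    (hinj : ∀ h, κ ^ 2 * ((tangentProj U V *ᵥ h) ⬝ᵥ (tangentProj U V *ᵥ h)) ≤
      ∑ x ∈ O \ Om, (tangentProj U V *ᵥ h) x ^ 2) :
    ExactRecovery lam O L S := by
  obtain ⟨hU, hV, hσ, hL⟩ := hsvd
  set P := tangentProj U V with hP
  set E : Fin n × Fin n → ℝ := fun x => (U * Vᵀ) x.1 x.2 with hE
  have hPs : Pᵀ = P := tangentProj_transpose
  have hPi : P * P = P := tangentProj_mul_self hU hV
  have hcs : (1 - P)ᵀ = 1 - P := by rw [transpose_sub, transpose_one, hPs]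
  have hci : (1 - P) * (1 - P) = 1 - P := one_sub_mul_self_of_proj hPi
  have hPE : P *ᵥ E = E := tangentProj_mulVec_of_eq_mul _ hU
  have hPL : P *ᵥ (fun x => L x.1 x.2) = fun x => L x.1 x.2 := by
    rw [hL, Matrix.mul_assoc]; exact tangentProj_mulVec_of_eq_mul _ hU
  have hEL : E ⬝ᵥ (fun x => L x.1 x.2) = ∑ k, σ k := by
    have h := sum_mul_eq_trace (U * Vᵀ) L
    rw [dotProduct, hE, h, hL, transpose_mul, transpose_transpose, Matrix.mul_assoc,
      Matrix.mul_assoc, ← Matrix.mul_assoc Uᵀ, hU, Matrix.one_mul, trace_mul_comm,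
      Matrix.mul_assoc, hV, Matrix.mul_one, trace_diagonal]
  have hnL : nuclearNorm L ≤ ∑ k, σ k := by
    rw [hL]; exact nuclearNorm_mul_diagonal_mul_transpose_le hU hV fun k => (hσ k).le
  -- the gain in the objective along a feasible direction
  have gain : ∀ X ∈ feasible O L S, ∀ h : Fin n × Fin n → ℝ,
      h = (fun x => (X.1 - L) x.1 x.2) →
      nuclearNorm L + lam * l1Norm S + lam / 8 * (√(((1 - P) *ᵥ h) ⬝ᵥ ((1 - P) *ᵥ h)) +
        √(∑ x ∈ O \ Om, h x ^ 2)) ≤ nuclearNorm X.1 + lam * l1Norm X.2 := by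
    intro X hX h hh
    set hp := (1 - P) *ᵥ h with hhp
    set ν := √(hp ⬝ᵥ hp) with hν
    set g := √(∑ x ∈ O \ Om, h x ^ 2) with hg
    have hν0 : 0 ≤ ν := Real.sqrt_nonneg _
    have hg0 : 0 ≤ g := Real.sqrt_nonneg _
    have hν2 : ν ^ 2 = hp ⬝ᵥ hp := Real.sq_sqrt (dotProduct_self_nonneg' _)
    have hPhp : (1 - P) *ᵥ hp = hp := by rw [hhp, mulVec_mulVec, hci]
    -- if `ν = 0`, then `hp = 0`, and the junk value `1 / 0 = 0` does no harm
    set W : Fin n × Fin n → ℝ := (1 - P) *ᵥ Q + (1 / (2 * ν)) • hp with hW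
    have hWT : (1 - P) *ᵥ W = W := by
      rw [hW, mulVec_add, mulVec_mulVec, hci, mulVec_smul, hPhp]
    have hWop : OpLe W 1 := by
      have h1 : OpLe ((1 / (2 * ν)) • hp) (1 / 2) := fun u v => by
        refine (le_abs_self _).trans (abs_sum_mul_le_half (by norm_num) ?_ u v)
        have h2 : ∑ y, ((1 / (2 * ν)) • hp) y ^ 2 = (1 / (2 * ν)) ^ 2 * ν ^ 2 := by
          rw [hν2, dotProduct, Finset.mul_sum]
          exact Finset.sum_congr rfl fun y _ => by
            rw [Pi.smul_apply, smul_eq_mul]; ring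
        rw [h2]
        rcases hν0.eq_or_lt with h0 | h0
        · rw [← h0]; norm_num
        · exact le_of_eq (by field_simp)
      exact (hQop.add h1).mono (by norm_num)
    have hsub := opLe_cross_add hU hV hWop hWT
    have hnX : (E + W) ⬝ᵥ (fun x => X.1 x.1 x.2) ≤ nuclearNorm X.1 :=
      sum_mul_le_nuclearNorm (W := Matrix.of fun i j => (E + W) (i, j)) hsub X.1
    have hX1 : (fun x : Fin n × Fin n => X.1 x.1 x.2) = (fun x => L x.1 x.2) + h := by
      rw [hh]; ext x; simp
    have hWL : W ⬝ᵥ (fun x => L x.1 x.2) = 0 := by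
      rw [← hPL, dotProduct_mulVec_symm, hPs, ← hWT, mulVec_mulVec, Matrix.mul_sub, hPi,
        Matrix.mul_one, sub_self, zero_mulVec, zero_dotProduct]
    have hWh : W ⬝ᵥ h = ((1 - P) *ᵥ Q) ⬝ᵥ h + ν / 2 := by
      have h1 : hp ⬝ᵥ h = ν ^ 2 := by
        rw [hν2, ← hPhp, dotProduct_comm, dotProduct_mulVec_symm, hcs, hPhp]
      rw [hW, add_dotProduct, smul_dotProduct, h1, smul_eq_mul]
      rcases hν0.eq_or_lt with h0 | h0
      · rw [← h0]; norm_num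
      · field_simp
    have hdec : E ⬝ᵥ h + ((1 - P) *ᵥ Q) ⬝ᵥ h - Q ⬝ᵥ h = -((P *ᵥ Q - E) ⬝ᵥ (P *ᵥ h)) := by
      rw [dotProduct_mulVec_symm, hPs, mulVec_sub, mulVec_mulVec, hPi, hPE, sub_mulVec, one_mulVec,
        sub_dotProduct, sub_dotProduct]
      ring
    have hl1 : lam * l1Norm S - Q ⬝ᵥ h + lam / 4 * ∑ x ∈ O \ Om, |h x| ≤ lam * l1Norm X.2 := by
      refine (l1_gain (h := h) hlam hK hS hQ0 hQ1 hQ2).trans_eq ?_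
      rw [l1Norm, Fintype.sum_prod_type]
      congr 1
      refine Finset.sum_congr rfl fun i _ => Finset.sum_congr rfl fun j _ => ?_
      have hf := congrFun (congrFun (show proj O X.1 + X.2 = proj O L + S from hX) i) j
      simp only [Matrix.add_apply, proj, of_apply] at hf
      rw [hh]
      simp only [Matrix.sub_apply]
      congr 1
      split_ifs at hf ⊢ <;> linarith
    have hgs : g ≤ ∑ x ∈ O \ Om, |h x| := sqrt_sum_sq_le_sum_abs _ _
    -- the tangential part is controlled by the sampled and by the normal part
    have hPh : κ * √((P *ᵥ h) ⬝ᵥ (P *ᵥ h)) ≤ g + ν := by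
      have h1 : P *ᵥ h = h - hp := by rw [hhp, sub_mulVec, one_mulVec, sub_sub_cancel]
      have h2 : ∑ x ∈ O \ Om, hp x ^ 2 ≤ ν ^ 2 := by
        rw [hν2, dotProduct]
        simp only [← sq]
        exact Finset.sum_le_sum_of_subset_of_nonneg (Finset.subset_univ _) fun _ _ _ => sq_nonneg _
      have hg2 : g ^ 2 = ∑ x ∈ O \ Om, h x ^ 2 :=
        Real.sq_sqrt (Finset.sum_nonneg fun _ _ => sq_nonneg _)
      have h3 : -∑ x ∈ O \ Om, h x * hp x ≤ g * ν := by
        have h4 := Real.sum_mul_le_sqrt_mul_sqrt (O \ Om) (fun x => -h x) hp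
        simp only [neg_mul, Finset.sum_neg_distrib, neg_sq] at h4
        refine h4.trans (mul_le_mul_of_nonneg_left ?_ hg0)
        exact (Real.sqrt_le_sqrt h2).trans_eq (Real.sqrt_sq hν0)
      have h5 := hinj h
      have h6 : ∑ x ∈ O \ Om, (P *ᵥ h) x ^ 2 ≤ (g + ν) ^ 2 := by
        have : ∑ x ∈ O \ Om, (P *ᵥ h) x ^ 2 = ∑ x ∈ O \ Om, h x ^ 2 +
            ∑ x ∈ O \ Om, hp x ^ 2 - 2 * ∑ x ∈ O \ Om, h x * hp x := by
          rw [h1, Finset.mul_sum, ← Finset.sum_add_distrib, ← Finset.sum_sub_distrib]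
          exact Finset.sum_congr rfl fun x _ => by rw [Pi.sub_apply]; ring
        rw [this, ← hg2]
        nlinarith
      refine le_of_sq_le_sq ?_ (by positivity)
      rw [mul_pow, Real.sq_sqrt (dotProduct_self_nonneg' _)]
      exact h5.trans h6
    have herr : (P *ᵥ Q - E) ⬝ᵥ (P *ᵥ h) ≤ lam / 8 * (g + ν) := by
      refine (dotProduct_le_sqrt_mul_sqrt _ _).trans ?_
      calc √((P *ᵥ Q - E) ⬝ᵥ (P *ᵥ Q - E)) * √((P *ᵥ h) ⬝ᵥ (P *ᵥ h))
          ≤ (κ * (lam / 8)) * √((P *ᵥ h) ⬝ᵥ (P *ᵥ h)) := by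
            gcongr
            exact ((Real.sqrt_le_sqrt hQT).trans_eq (Real.sqrt_sq hε0)).trans hε
        _ = lam / 8 * (κ * √((P *ᵥ h) ⬝ᵥ (P *ᵥ h))) := by ring
        _ ≤ _ := by gcongr
    rw [hX1, dotProduct_add, add_dotProduct E W, add_dotProduct E W, hWL, hEL, hWh] at hnX
    nlinarith [mul_le_mul_of_nonneg_left hgs hlam.le, mul_le_mul_of_nonneg_right hlam1 hν0]
  have hmin : ∀ X ∈ feasible O L S, nuclearNorm L + lam * l1Norm S ≤
      nuclearNorm X.1 + lam * l1Norm X.2 := fun X hX => by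
    have h1 := gain X hX _ rfl
    exact (le_add_of_nonneg_right (mul_nonneg (by linarith)
      (add_nonneg (Real.sqrt_nonneg _) (Real.sqrt_nonneg _)))).trans h1
  have hfeas : (L, S) ∈ feasible O L S := rfl
  intro X
  constructor
  · rintro ⟨hX, hXmin⟩
    have h1 := gain X hX _ rfl
    set h : Fin n × Fin n → ℝ := fun x => (X.1 - L) x.1 x.2 with hh
    have h2 := isMinOn_iff.1 hXmin _ hfeas
    dsimp only at h2
    have h3 : √(((1 - P) *ᵥ h) ⬝ᵥ ((1 - P) *ᵥ h)) + √(∑ x ∈ O \ Om, h x ^ 2) ≤ 0 := by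
      by_contra hcon
      push Not at hcon
      have := mul_pos (by linarith : 0 < lam / 8) hcon
      linarith
    have h4 : √(((1 - P) *ᵥ h) ⬝ᵥ ((1 - P) *ᵥ h)) = 0 :=
      le_antisymm (by linarith [Real.sqrt_nonneg (∑ x ∈ O \ Om, h x ^ 2)]) (Real.sqrt_nonneg _)
    have h5 : √(∑ x ∈ O \ Om, h x ^ 2) = 0 :=
      le_antisymm (by linarith) (Real.sqrt_nonneg _)
    rw [Real.sqrt_eq_zero (dotProduct_self_nonneg' _), dotProduct_self_eq_zero] at h4
    rw [Real.sqrt_eq_zero (Finset.sum_nonneg fun _ _ => sq_nonneg _)] at h5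
    have hPh : P *ᵥ h = h := by
      rw [sub_mulVec, one_mulVec, sub_eq_zero] at h4; exact h4.symm
    have h6 := hinj h
    rw [hPh, h5] at h6
    have h7 : h = 0 := by
      rw [← dotProduct_self_eq_zero]
      exact le_antisymm (le_of_mul_le_mul_left (by simpa using h6) (by positivity : 0 < κ ^ 2))
        (dotProduct_self_nonneg' _)
    have hX1 : X.1 = L := by
      ext i j
      have := congrFun h7 (i, j)
      simp only [hh, Matrix.sub_apply, Pi.zero_apply] at this
      linarith
    have hX2 : X.2 = S := by
      have hf : proj O X.1 + X.2 = proj O L + S := hX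
      rw [hX1] at hf
      exact add_left_cancel hf
    exact Prod.ext hX1 hX2
  · rintro rfl
    exact ⟨hfeas, isMinOn_iff.2 hmin⟩

end RobustMC

/-! ### The golfing scheme -/

namespace RobustMC

open Matrix

/-- The law of a Bernoulli variable with parameter `q`, as a weight on `Bool`. -/
noncomputable def berWeight (q : ℝ) : Bool → ℝ := fun b => if b then q else 1 - q

lemma isWeight_berWeight {q : ℝ} (h0 : 0 ≤ q) (h1 : q ≤ 1) : IsWeight (berWeight q) where
  nonneg a := by
    cases a
    · simpa [berWeight] using h1
    · simpa [berWeight] using h0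
  sum_eq_one := by simp [berWeight]

/-- The rescaled and centred Bernoulli variable `1 - γ / q` has mean zero and variance at most
`1 / q`. -/
lemma mgfLe_berWeight {q : ℝ} (h0 : 0 < q) (h1 : q ≤ 1) :
    MgfLe (berWeight q) (fun b => 1 - (if b then 1 else 0) / q) (1 / q) q := by
  intro t ht
  set s := t / q with hs
  have hts : t = q * s := by rw [hs]; field_simp
  have hs1 : |s| ≤ 1 := by rw [hs, abs_div, abs_of_pos h0]; exact (div_le_one h0).2 ht
  have hexp : Real.exp (-s) ≤ 1 - s + s ^ 2 := by
    have := (abs_le.1 (Real.abs_exp_sub_one_sub_id_le (x := -s) (by rwa [abs_neg]))).2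
    nlinarith
  calc ∑ a, berWeight q a * Real.exp ((1 - (if a then 1 else 0) / q) * t)
      = Real.exp t * (q * (Real.exp (-s) - 1) + 1) := by
        have e1 : Real.exp ((1 - 1 / q) * t) = Real.exp t * Real.exp (-s) := by
          rw [← Real.exp_add]; congr 1; rw [hs]; ring
        simp only [Fintype.sum_bool, berWeight, if_true, Bool.false_eq_true, if_false, zero_div,
          sub_zero, one_mul, e1]
        ring
    _ ≤ Real.exp t * Real.exp (q * (Real.exp (-s) - 1)) := by
        gcongr; exact Real.add_one_le_exp _
    _ = Real.exp (t + q * (Real.exp (-s) - 1)) := (Real.exp_add _ _).symm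
    _ ≤ Real.exp (1 / q * t ^ 2) := by
        refine Real.exp_le_exp.2 ?_
        have e2 : 1 / q * t ^ 2 = q * s ^ 2 := by rw [hts]; field_simp
        rw [e2]
        nlinarith [mul_le_mul_of_nonneg_left hexp h0.le]

/-- The coordinate projection onto the entries in `D`. -/
def mask {N : Type*} [DecidableEq N] (D : Finset N) : Matrix N N ℝ :=
  diagonal fun x => if x ∈ D then 1 else 0

lemma mask_transpose {N : Type*} [DecidableEq N] (D : Finset N) : (mask D)ᵀ = mask D :=
  diagonal_transpose _

section Mask

variable {N : Type*} [Fintype N] [DecidableEq N] (D : Finset N)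

lemma mask_mulVec (v : N → ℝ) : mask D *ᵥ v = fun x => if x ∈ D then v x else 0 := by
  ext x
  simp [mask, mulVec_diagonal]

lemma mask_mul_self : mask D * mask D = mask D := by
  rw [mask, diagonal_mul_diagonal]; congr 1; funext x; split_ifs <;> simp

lemma mask_compl : mask Dᶜ = 1 - mask D := by
  rw [mask, mask, ← diagonal_one, diagonal_sub]
  congr 1
  funext x
  by_cases h : x ∈ D <;> simp [h]

lemma mask_mulVec_dotProduct_self_le (v : N → ℝ) : (mask D *ᵥ v) ⬝ᵥ (mask D *ᵥ v) ≤ v ⬝ᵥ v :=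
  proj_dotProduct_self_le (mask_transpose D) (mask_mul_self D) v

end Mask

/-- `G` inverts, on the range of the projection `P`, the restriction of `P` to the entries outside
of `D`, and is incoherent with the entries at level `g`. -/
structure IsLocalInverse {N : Type*} [Fintype N] [DecidableEq N] (P G : Matrix N N ℝ)
    (D : Finset N) (g : ℝ) : Prop where
  transpose_eq : Gᵀ = G
  mul_eq : P * G = G
  inverse : P * mask Dᶜ * G = P
  norm_le : ∀ v, (G *ᵥ v) ⬝ᵥ (G *ᵥ v) ≤ 4 * (v ⬝ᵥ v)
  sum_sq_le : ∀ x, ∑ y, G y x ^ 2 ≤ g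
  abs_le : ∀ x y, |G x y| ≤ g

/-- One round of golfing: `X` is the difference between the target `Z` outside of `D` and its
estimate from a Bernoulli sample, and `G X` is the next target. -/
lemma prob_not_golf_step_le {n : ℕ} [NeZero n] {P G : Matrix (Fin n × Fin n) (Fin n × Fin n) ℝ}
    {D : Finset (Fin n × Fin n)} {g q l a : ℝ} (hG : IsLocalInverse P G D g) (hg : 0 < g)
    (hq0 : 0 < q) (hq1 : q ≤ 1) (hl : 0 < l) (hlq : l ≤ n * q) (hgq : l * g ≤ q) (ha : 0 < a)
    {Z : Fin n × Fin n → ℝ} (hZ : ∀ x, |Z x| ≤ a) :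
    prob (berWeight q) (fun γ => ¬ ∀ X : Fin n × Fin n → ℝ,
      (X = mask Dᶜ *ᵥ fun x => (1 - (if γ x then 1 else 0) / q) * Z x) →
      OpLe X (9 * a * √(n * l / q)) ∧ OpLe (mask D *ᵥ (G *ᵥ X)) (18 * a * √(n * l / q)) ∧
        ∀ x, |(G *ᵥ X) x| ≤ 9 * √(g * l / q) * a) ≤
      (4 * n + 2 * n ^ 2) * Real.exp (-(8 * l)) := by
  have hn : (0 : ℝ) < n := by exact_mod_cast Nat.pos_of_ne_zero (NeZero.ne n)
  have hw := isWeight_berWeight hq0.le hq1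
  have hξ := mgfLe_berWeight hq0 hq1
  have hb : √(l / (n * (1 / q))) ≤ q := by
    refine Real.sqrt_le_iff.2 ⟨hq0.le, ?_⟩
    rw [mul_one_div, div_div_eq_mul_div, div_le_iff₀ hn]
    nlinarith
  have h1 := prob_not_opLe_mulVec_le hw hξ (by positivity) (𝓛 := mask Dᶜ) ha one_pos hl hZ
    (fun h => by
      rw [mask_transpose, one_pow, one_mul]; exact mask_mulVec_dotProduct_self_le _ h) hb
  have h2 := prob_not_opLe_mulVec_le hw hξ (by positivity) (𝓛 := mask D * G * mask Dᶜ) ha two_pos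
    hl hZ (fun h => by
      rw [transpose_mul, transpose_mul, mask_transpose, mask_transpose, hG.transpose_eq,
        ← mulVec_mulVec, ← mulVec_mulVec]
      refine (mask_mulVec_dotProduct_self_le _ _).trans ((hG.norm_le _).trans ?_)
      have := mask_mulVec_dotProduct_self_le D h
      linarith) hb
  have h3 : ∀ y, prob (berWeight q) (fun γ => ¬ |∑ x, (1 - (if γ x then 1 else 0) / q) *
      (if x ∈ D then 0 else Z x * G y x)| ≤ 9 * √(1 / q * (a ^ 2 * g) * l)) ≤
      2 * Real.exp (-(8 * l)) := fun y => by
    have hGy : ∀ x, |if x ∈ D then 0 else Z x * G y x| ≤ a * |G y x| := fun x => by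
      split_ifs
      · rw [abs_zero]; positivity
      · rw [abs_mul]; gcongr; exact hZ x
    refine prob_not_abs_sum_le hw hξ (by positivity) (c₀ := a * g) (by positivity) hl
      (fun x => (hGy x).trans (by gcongr; exact hG.abs_le y x)) ?_ ?_
    · calc ∑ x, (if x ∈ D then 0 else Z x * G y x) ^ 2 ≤ ∑ x, a ^ 2 * G x y ^ 2 := by
            refine Finset.sum_le_sum fun x _ => ?_
            have hsym : G x y = G y x := congrFun (congrFun hG.transpose_eq y) x
            rw [← sq_abs, ← mul_pow, hsym, ← sq_abs (a * G y x), abs_mul, abs_of_pos ha]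
            exact pow_le_pow_left₀ (abs_nonneg _) (hGy x) 2
        _ ≤ a ^ 2 * g := by
            rw [← Finset.mul_sum]; gcongr; exact hG.sum_sq_le y
    · rw [← Real.sqrt_sq (by positivity : 0 ≤ a * g), ← Real.sqrt_mul (by positivity)]
      refine Real.sqrt_le_iff.2 ⟨hq0.le, ?_⟩
      have : l / (1 / q * (a ^ 2 * g)) * (a * g) ^ 2 = q * (l * g) := by field_simp
      rw [this, sq]
      gcongr
  have h3' := prob_exists_le hw _ h3
  have hcard : (Fintype.card (Fin n × Fin n) : ℝ) = n ^ 2 := by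
    simp [Fintype.card_prod, sq]
  rw [hcard] at h3'
  have e1 : √(n * (1 / q) * l) = √(n * l / q) := by congr 1; ring
  have e3 : √(1 / q * (a ^ 2 * g) * l) = a * √(g * l / q) := by
    rw [show 1 / q * (a ^ 2 * g) * l = a ^ 2 * (g * l / q) by ring,
      Real.sqrt_mul (by positivity), Real.sqrt_sq ha.le]
  rw [e1] at h1 h2
  rw [e3] at h3'
  refine (prob_mono hw ?_).trans (((prob_or_le hw _ _).trans
    (add_le_add ((prob_or_le hw _ _).trans (add_le_add h1 h2)) h3')).trans_eq (by ring))
  intro γ hγ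
  by_contra hcon
  push Not at hcon
  obtain ⟨⟨c1, c2⟩, c3⟩ := hcon
  refine hγ fun X hX => ⟨?_, ?_, fun y => ?_⟩
  · rw [hX]; exact c1.mono (by rw [mul_one])
  · rw [hX, mulVec_mulVec, mulVec_mulVec]
    exact c2.mono (le_of_eq (by ring))
  · refine (le_of_eq ?_).trans ((c3 y).trans_eq (by ring))
    rw [hX, mask_mulVec, mulVec, dotProduct]
    congr 1
    refine Finset.sum_congr rfl fun x _ => ?_
    by_cases hx : x ∈ D
    · simp [hx]
    · simp [hx]; ring

/-- `Y` is an approximate certificate for the target `Z`, supported on the sampled entries outside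
of `D`, with entries at most `B`, normal part of operator norm at most `T`, and residual of
Frobenius norm at most `ε`. -/
def HasCertificate {n r : ℕ} (U V : Matrix (Fin n) (Fin r) ℝ) (D : Finset (Fin n × Fin n))
    (Z : Fin n × Fin n → ℝ) (B T ε : ℝ) (γ : Fin n × Fin n → Bool) : Prop :=
  ∃ Y : Fin n × Fin n → ℝ, (∀ x, Y x ≠ 0 → x ∉ D ∧ γ x = true) ∧ (∀ x, |Y x| ≤ B) ∧
    OpLe ((1 - tangentProj U V) *ᵥ Y) T ∧
    (tangentProj U V *ᵥ (Y - mask Dᶜ *ᵥ Z)) ⬝ᵥ (tangentProj U V *ᵥ (Y - mask Dᶜ *ᵥ Z)) ≤ ε ^ 2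

/-- The union of two independent Bernoulli samples is a Bernoulli sample. -/
lemma prob_berWeight_or {N : Type*} [Fintype N] [DecidableEq N] {p q p' : ℝ}
    (h : 1 - p = (1 - q) * (1 - p')) (Q : (N → Bool) → Prop) :
    prob (fun b : Bool × Bool => berWeight q b.1 * berWeight p' b.2)
      (fun f => Q fun x => (f x).1 || (f x).2) = prob (berWeight p) Q := by
  refine prob_map (fun b : Bool × Bool => b.1 || b.2) (fun b => ?_) Q
  rw [Finset.sum_filter, Fintype.sum_prod_type]
  cases b
  · simpa [berWeight] using h
  · simp only [berWeight, Fintype.sum_bool, if_true, Bool.or_true, Bool.or_false,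
      Bool.false_eq_true, if_false]
    linarith

section

variable {n r : ℕ} {U V : Matrix (Fin n) (Fin r) ℝ}
  {G : Matrix (Fin n × Fin n) (Fin n × Fin n) ℝ} {D : Finset (Fin n × Fin n)} {g l : ℝ}

/-- Adding one round of golfing in front of a certificate for the next target. -/
lemma HasCertificate.step (hU : Uᵀ * U = 1) (hV : Vᵀ * V = 1)
    (hG : IsLocalInverse (tangentProj U V) G D g) {Z X : Fin n × Fin n → ℝ} {a b q : ℝ}
    (hq : 0 < q) (hZP : tangentProj U V *ᵥ Z = Z) (hZ : ∀ x, |Z x| ≤ a)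
    (hZD : OpLe (mask D *ᵥ Z) b) (hb : 0 ≤ b) {γ γ' : Fin n × Fin n → Bool}
    (hX : X = mask Dᶜ *ᵥ fun x => (1 - (if γ x then 1 else 0) / q) * Z x) {t B T ε : ℝ}
    (ht : 0 ≤ t) (hXop : OpLe X t) (h : HasCertificate U V D (G *ᵥ X) B T ε γ') :
    HasCertificate U V D Z (a / q + B) (b + t + T) ε fun x => γ x || γ' x := by
  obtain ⟨Y, hsupp, hB, hT, hε⟩ := h
  have hY1 : ∀ x, (mask Dᶜ *ᵥ Z - X) x = if x ∉ D ∧ γ x = true then Z x / q else 0 := fun x => by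
    rw [Pi.sub_apply, hX, mask_mulVec, mask_mulVec]
    by_cases hx : x ∈ D
    · simp [hx]
    · by_cases hγ : γ x = true
      · simp [hx, hγ]; ring
      · simp [hx, hγ]
  refine ⟨mask Dᶜ *ᵥ Z - X + Y, fun x hx => ?_, fun x => ?_, ?_, ?_⟩
  · by_contra hcon
    refine hx ?_
    have h1 : ¬ (x ∉ D ∧ γ x = true) := fun hh => hcon ⟨hh.1, by simp [hh.2]⟩
    have h2 : Y x = 0 := by
      by_contra hY
      exact hcon ⟨(hsupp x hY).1, by simp [(hsupp x hY).2]⟩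
    rw [Pi.add_apply, hY1, if_neg h1, h2, add_zero]
  · rw [Pi.add_apply, hY1]
    refine (abs_add_le _ _).trans (add_le_add ?_ (hB x))
    have ha : 0 ≤ a := (abs_nonneg _).trans (hZ x)
    split_ifs
    · rw [abs_div, abs_of_pos hq]; gcongr; exact hZ x
    · rw [abs_zero]; positivity
  · have e : (1 - tangentProj U V) *ᵥ (mask Dᶜ *ᵥ Z - X + Y) =
        (1 - tangentProj U V) *ᵥ (-(mask D *ᵥ Z)) + (1 - tangentProj U V) *ᵥ (-X) +
          (1 - tangentProj U V) *ᵥ Y := by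
      have h0 : (1 - tangentProj U V) *ᵥ Z = 0 := by
        rw [sub_mulVec, one_mulVec, hZP, sub_self]
      rw [mask_compl, sub_mulVec 1 (mask D), one_mulVec, mulVec_add, mulVec_sub, mulVec_sub, h0,
        mulVec_neg, mulVec_neg]
      abel
    rw [e]
    exact ((hZD.neg.one_sub_tangentProj hU hV hb).add
      (hXop.neg.one_sub_tangentProj hU hV ht)).add hT
  · have e : tangentProj U V *ᵥ (mask Dᶜ *ᵥ Z - X + Y - mask Dᶜ *ᵥ Z) =
        tangentProj U V *ᵥ (Y - mask Dᶜ *ᵥ (G *ᵥ X)) := by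
      rw [show mask Dᶜ *ᵥ Z - X + Y - mask Dᶜ *ᵥ Z = Y - X by abel, mulVec_sub, mulVec_sub,
        mulVec_mulVec, mulVec_mulVec, hG.inverse]
    rw [e]; exact hε

variable [NeZero n]

/-- The probabilistic form of `HasCertificate.step`: one Bernoulli batch of density `q`, followed by
whatever certificate the rest of the sample provides for the new target, which is smaller by the
factor `κ`. -/
lemma prob_not_hasCertificate_step_le (hU : Uᵀ * U = 1) (hV : Vᵀ * V = 1)
    (hG : IsLocalInverse (tangentProj U V) G D g) (hg : 0 < g) {Z : Fin n × Fin n → ℝ}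
    {a b q κ p p' B T ε δ : ℝ} (hq0 : 0 < q) (hq1 : q ≤ 1) (hl : 0 < l) (hlq : l ≤ n * q)
    (hgq : l * g ≤ q) (hκ : 9 * √(g * l / q) ≤ κ) (ha : 0 < a)
    (hp : 1 - p = (1 - q) * (1 - p')) (hp0 : 0 ≤ p') (hp1 : p' ≤ 1)
    (hZP : tangentProj U V *ᵥ Z = Z) (hZ : ∀ x, |Z x| ≤ a)
    (hZD : OpLe (mask D *ᵥ Z) b) (hb : 0 ≤ b) (hδ : 0 ≤ δ)
    (hnext : ∀ Z', tangentProj U V *ᵥ Z' = Z' → (∀ x, |Z' x| ≤ κ * a) →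
      OpLe (mask D *ᵥ Z') (18 * a * √(n * l / q)) →
      prob (berWeight p') (fun γ => ¬ HasCertificate U V D Z' B T ε γ) ≤ δ) :
    prob (berWeight p) (fun γ => ¬ HasCertificate U V D Z (a / q + B)
      (b + 9 * a * √(n * l / q) + T) ε γ) ≤
      (4 * n + 2 * n ^ 2) * Real.exp (-(8 * l)) + δ := by
  rw [← prob_berWeight_or hp]
  refine prob_prod_le (isWeight_berWeight hq0.le hq1) (isWeight_berWeight hp0 hp1)
    (prob_not_golf_step_le hG hg hq0 hq1 hl hlq hgq ha hZ) (fun γ hγ => ?_) hδ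
  rw [not_not] at hγ
  obtain ⟨h1, h2, h3⟩ := hγ _ rfl
  set X := mask Dᶜ *ᵥ fun x => (1 - (if γ x then 1 else 0) / q) * Z x with hX
  refine (prob_mono (isWeight_berWeight hp0 hp1) fun γ' hγ' hcert => hγ' ?_).trans
    (hnext (G *ᵥ X) (by rw [mulVec_mulVec, hG.mul_eq])
      (fun x => (h3 x).trans (by gcongr)) h2)
  exact hcert.step hU hV hG hq0 hZP hZ hZD hb hX (by positivity) h1

/-- Iterated golfing with `m` batches of equal size, each of which halves the target. The batch
that remains after the first has density `p' = (p - q) / (1 - q)`, since the union of the two has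
density `p`. -/
lemma prob_not_hasCertificate_iterate_le (hU : Uᵀ * U = 1) (hV : Vᵀ * V = 1)
    (hG : IsLocalInverse (tangentProj U V) G D g) (hg : 0 < g) {q : ℝ} (hq0 : 0 < q) (hq1 : q < 1)
    (hl : 0 < l) (hlq : l ≤ n * q) (hgq : 324 * (g * l) ≤ q) (m : ℕ) :
    ∀ {Z : Fin n × Fin n → ℝ} {a b p : ℝ}, 0 < a → m * q ≤ p → p ≤ 1 →
      tangentProj U V *ᵥ Z = Z → (∀ x, |Z x| ≤ a) → OpLe (mask D *ᵥ Z) b → 0 ≤ b →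
      prob (berWeight p) (fun γ => ¬ HasCertificate U V D Z (2 * a / q)
        (b + 54 * a * √(n * l / q)) (n * a / 2 ^ m) γ) ≤
        m * ((4 * n + 2 * n ^ 2) * Real.exp (-(8 * l))) := by
  have hκ : 9 * √(g * l / q) ≤ 1 / 2 := by
    have : √(g * l / q) ≤ 1 / 18 := by
      refine Real.sqrt_le_iff.2 ⟨by norm_num, ?_⟩
      rw [div_le_iff₀ hq0]; linarith
    linarith
  induction m with
  | zero =>
    intro Z a b p ha hp0 hp1 hZP hZ hZD hb
    have hcert : ∀ γ, HasCertificate U V D Z (2 * a / q)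
        (b + 54 * a * √(n * l / q)) (n * a / 2 ^ 0) γ := fun γ => by
      refine ⟨0, fun x hx => absurd rfl hx, fun x => ?_, fun u v => ?_, ?_⟩
      · rw [Pi.zero_apply, abs_zero]; positivity
      · rw [mulVec_zero]
        simp only [Pi.zero_apply, zero_mul, Finset.sum_const_zero]
        have := dotProduct_self_nonneg' u
        have := dotProduct_self_nonneg' v
        positivity
      · refine (proj_dotProduct_self_le tangentProj_transpose (tangentProj_mul_self hU hV) _).trans
          ?_
        rw [zero_sub, neg_dotProduct_neg]
        refine (mask_mulVec_dotProduct_self_le _ _).trans ?_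
        calc Z ⬝ᵥ Z ≤ ∑ _x : Fin n × Fin n, a ^ 2 :=
              Finset.sum_le_sum fun x _ => by
                rw [← sq]; exact sq_le_sq.2 ((hZ x).trans (le_abs_self a))
          _ = (n * a / 2 ^ 0) ^ 2 := by simp [Fintype.card_prod]; ring
    have hw := isWeight_berWeight (by simpa using hp0) hp1
    refine (prob_mono hw (R := fun _ => False) fun γ hγ => hγ (hcert γ)).trans ?_
    simp [prob, expect_const hw]
  | succ m ih =>
    intro Z a b p ha hp0 hp1 hZP hZ hZD hb
    push_cast at hp0 ⊢
    have hq1' : 0 < 1 - q := by linarith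
    set p' := (p - q) / (1 - q) with hp'
    have hmq : m * q ≤ p - q := by linarith
    have hpp : m * q ≤ p' := by
      rw [hp', le_div_iff₀ hq1']
      have : (0 : ℝ) ≤ m * q := by positivity
      nlinarith
    have hp1' : p' ≤ 1 := by rw [hp', div_le_one hq1']; linarith
    have h := prob_not_hasCertificate_step_le hU hV hG hg (p := p) (p' := p') hq0 hq1.le hl hlq
      (by nlinarith [mul_pos hg hl]) hκ ha (by rw [hp']; field_simp; ring)
      ((by positivity : (0 : ℝ) ≤ m * q).trans hpp) hp1' hZP hZ hZD hb
      (by positivity : 0 ≤ m * ((4 * n + 2 * n ^ 2) * Real.exp (-(8 * l))))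
      (fun Z' h1 h2 h3 => ih (by positivity) hpp hp1' h1 h2 h3 (by positivity))
    have eB : 2 * a / q = a / q + 2 * (1 / 2 * a) / q := by ring
    have eT : b + 54 * a * √(n * l / q) = b + 9 * a * √(n * l / q) +
        (18 * a * √(n * l / q) + 54 * (1 / 2 * a) * √(n * l / q)) := by ring
    have eε : n * a / 2 ^ (m + 1) = n * (1 / 2 * a) / 2 ^ m := by rw [pow_succ]; ring
    rw [eB, eT, eε]
    exact h.trans_eq (by ring)

/-- The complete golfing scheme: one large batch, which reduces the target by the factor `κ`,
followed by `m` small ones. -/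
lemma prob_not_hasCertificate_le (hU : Uᵀ * U = 1) (hV : Vᵀ * V = 1)
    (hG : IsLocalInverse (tangentProj U V) G D g) (hg : 0 < g) {q₁ q : ℝ} (hq₁ : q₁ < 1)
    (hq0 : 0 < q) (hqq : q ≤ q₁) (hl : 0 < l) (hlq : l ≤ n * q) (hgq : 324 * (g * l) ≤ q) {κ : ℝ}
    (hκ : 9 * √(g * l / q₁) ≤ κ) (hκ0 : 0 < κ) (m : ℕ) {Z : Fin n × Fin n → ℝ} {a b p : ℝ}
    (ha : 0 < a) (hp0 : q₁ + m * q ≤ p) (hp1 : p ≤ 1) (hZP : tangentProj U V *ᵥ Z = Z)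
    (hZ : ∀ x, |Z x| ≤ a) (hZD : OpLe (mask D *ᵥ Z) b) (hb : 0 ≤ b) :
    prob (berWeight p) (fun γ => ¬ HasCertificate U V D Z (a / q₁ + 2 * (κ * a) / q)
      (b + 27 * a * √(n * l / q₁) + 54 * (κ * a) * √(n * l / q)) (n * (κ * a) / 2 ^ m) γ) ≤
      (m + 1) * ((4 * n + 2 * n ^ 2) * Real.exp (-(8 * l))) := by
  have hq₁0 : 0 < q₁ := hq0.trans_le hqq
  have hq1' : 0 < 1 - q₁ := by linarith
  set p' := (p - q₁) / (1 - q₁) with hp'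
  have hpp : m * q ≤ p' := by
    rw [hp', le_div_iff₀ hq1']
    have : (0 : ℝ) ≤ m * q := by positivity
    nlinarith
  have hp1' : p' ≤ 1 := by rw [hp', div_le_one hq1']; linarith
  have hn : (0 : ℝ) ≤ n := Nat.cast_nonneg n
  have h := prob_not_hasCertificate_step_le hU hV hG hg (p := p) (p' := p') hq₁0 hq₁.le hl
    (hlq.trans (by gcongr)) (by nlinarith [mul_pos hg hl]) hκ ha (by rw [hp']; field_simp; ring)
    ((by positivity : (0 : ℝ) ≤ m * q).trans hpp) hp1' hZP hZ hZD hb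
    (by positivity : 0 ≤ m * ((4 * n + 2 * n ^ 2) * Real.exp (-(8 * l))))
    (fun Z' h1 h2 h3 => prob_not_hasCertificate_iterate_le hU hV hG hg hq0 (hqq.trans_lt hq₁) hl
      hlq hgq m (by positivity) hpp hp1' h1 h2 h3 (by positivity))
  have eT : b + 27 * a * √(n * l / q₁) + 54 * (κ * a) * √(n * l / q) =
      b + 9 * a * √(n * l / q₁) + (18 * a * √(n * l / q₁) + 54 * (κ * a) * √(n * l / q)) := by
    ring
  rw [eT]
  exact h.trans_eq (by ring)

end

end RobustMC

/-! ### Incoherent projections restricted to random sets of entries -/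

namespace RobustMC

open Matrix

lemma sum_sq_column_eq {N : Type*} [Fintype N] {P : Matrix N N ℝ} (hs : Pᵀ = P) (hi : P * P = P)
    (x : N) : ∑ y, P y x ^ 2 = P x x := by
  conv_rhs => rw [← hi, mul_apply]
  refine Finset.sum_congr rfl fun y _ => ?_
  rw [sq]
  congr 1
  exact congrFun (congrFun hs x) y

/-- An entry of `P v` is the inner product of `v` with a column of `P`, whose squared norm is a
diagonal entry of `P`. -/
lemma mulVec_sq_le {N : Type*} [Fintype N] {P : Matrix N N ℝ} {g : ℝ} (hs : Pᵀ = P)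
    (hi : P * P = P) (hg : ∀ x, P x x ≤ g) (v : N → ℝ) (x : N) :
    (P *ᵥ v) x ^ 2 ≤ g * (v ⬝ᵥ v) := by
  have h := Finset.sum_mul_sq_le_sq_mul_sq Finset.univ (fun y => P y x) v
  rw [sum_sq_column_eq hs hi] at h
  have e : (P *ᵥ v) x = ∑ y, P y x * v y :=
    Finset.sum_congr rfl fun y _ => congrArg (· * v y) (congrFun (congrFun hs y) x)
  have e2 : ∑ y, v y ^ 2 = v ⬝ᵥ v := Finset.sum_congr rfl fun y _ => sq _
  rw [e, ← e2]
  exact h.trans (mul_le_mul_of_nonneg_right (hg x) (Finset.sum_nonneg fun y _ => sq_nonneg _))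

/-- Matrices with columns in the range of an incoherent projection have small entries. -/
lemma apply_sq_le {N : Type*} [Fintype N] {P G : Matrix N N ℝ} {g c : ℝ} (hs : Pᵀ = P)
    (hi : P * P = P) (hg : ∀ x, P x x ≤ g) (hg0 : 0 ≤ g) (hG : P * G = G) {y : N}
    (hc : ∑ z, G z y ^ 2 ≤ c) (x : N) : G x y ^ 2 ≤ g * c := by
  have h := mulVec_sq_le hs hi hg (fun z => G z y) x
  have e1 : (P *ᵥ fun z => G z y) x = G x y := congrFun (congrFun hG x) y
  have e2 : (fun z => G z y) ⬝ᵥ (fun z => G z y) = ∑ z, G z y ^ 2 :=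
    Finset.sum_congr rfl fun y _ => (sq _).symm
  rw [e1, e2] at h
  exact h.trans (by gcongr)

section

variable {N : Type*} [Fintype N] [DecidableEq N] {P : Matrix N N ℝ} {g : ℝ}

lemma isLocalInverse_empty (hs : Pᵀ = P) (hi : P * P = P) (hg : ∀ x, P x x ≤ g) (hg0 : 0 ≤ g) :
    IsLocalInverse P P ∅ g where
  transpose_eq := hs
  mul_eq := hi
  inverse := by
    rw [mask_compl, show mask (∅ : Finset N) = 0 by simp [mask], sub_zero, mul_one, hi]
  norm_le v := by
    have := proj_dotProduct_self_le hs hi v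
    have := dotProduct_self_nonneg' v
    linarith
  sum_sq_le x := (sum_sq_column_eq hs hi x).trans_le (hg x)
  abs_le x y := abs_le_of_sq_le_sq (by
    rw [sq g]
    exact apply_sq_le hs hi hg hg0 hi ((sum_sq_column_eq hs hi y).trans_le (hg y)) x) hg0

/-- The set `D` is so sparse that restriction to `D` reduces the squared norm of vectors in the range
of `P` by the factor `c`. -/
def IsSparseFor (P : Matrix N N ℝ) (D : Finset N) (c : ℝ) : Prop :=
  ∀ v, (mask D *ᵥ (P *ᵥ v)) ⬝ᵥ (mask D *ᵥ (P *ᵥ v)) ≤ c * (v ⬝ᵥ v)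

/-- The inverse, on the range of `P`, of the compression of `mask Dᶜ` to this range, extended by zero
to the orthogonal complement. -/
noncomputable def localInverse (P : Matrix N N ℝ) (D : Finset N) : Matrix N N ℝ :=
  (1 - P * mask D * P)⁻¹ * P

variable {D : Finset N} {c : ℝ}

lemma dotProduct_self_le_of_half_le {N : Type*} [Fintype N] {M : Matrix N N ℝ}
    (h : ∀ v, 1 / 2 * (v ⬝ᵥ v) ≤ v ⬝ᵥ (M *ᵥ v)) (v : N → ℝ) :
    v ⬝ᵥ v ≤ 4 * ((M *ᵥ v) ⬝ᵥ (M *ᵥ v)) := by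
  have h0 := dotProduct_self_nonneg' (v - (2 : ℝ) • (M *ᵥ v))
  have e : (v - (2 : ℝ) • (M *ᵥ v)) ⬝ᵥ (v - (2 : ℝ) • (M *ᵥ v)) =
      v ⬝ᵥ v - 4 * (v ⬝ᵥ (M *ᵥ v)) + 4 * ((M *ᵥ v) ⬝ᵥ (M *ᵥ v)) := by
    rw [sub_dotProduct, dotProduct_sub, dotProduct_sub, dotProduct_smul, smul_dotProduct,
      smul_dotProduct, dotProduct_smul, dotProduct_comm (M *ᵥ v) v]
    simp only [smul_eq_mul]
    ring
  have := h v
  linarith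

lemma IsSparseFor.half_le (hs : Pᵀ = P) (hD : IsSparseFor P D c) (hc : c ≤ 1 / 2) (v : N → ℝ) :
    1 / 2 * (v ⬝ᵥ v) ≤ v ⬝ᵥ ((1 - P * mask D * P) *ᵥ v) := by
  have e : v ⬝ᵥ ((P * mask D * P) *ᵥ v) = (mask D *ᵥ (P *ᵥ v)) ⬝ᵥ (mask D *ᵥ (P *ᵥ v)) := by
    have h : v ⬝ᵥ ((P * mask D * P) *ᵥ v) = (P *ᵥ v) ⬝ᵥ (mask D *ᵥ (P *ᵥ v)) := by
      rw [Matrix.mul_assoc, ← mulVec_mulVec, dotProduct_mulVec_symm, hs, ← mulVec_mulVec]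
    rw [h, dotProduct_mulVec_symm (mask D), mask_transpose, dotProduct_comm]
    conv_lhs => rw [← mask_mul_self, ← mulVec_mulVec]
    rw [dotProduct_mulVec_symm (mask D), mask_transpose]
  rw [sub_mulVec, one_mulVec, dotProduct_sub, e]
  have := hD v
  have := dotProduct_self_nonneg' v
  nlinarith

lemma IsSparseFor.mul_localInverse (hs : Pᵀ = P) (hD : IsSparseFor P D c) (hc : c ≤ 1 / 2) :
    (1 - P * mask D * P) * localInverse P D = P := by
  have hu : IsUnit (1 - P * mask D * P).det := by
    rw [← isUnit_iff_isUnit_det, ← mulVec_injective_iff_isUnit]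
    intro u v huv
    have h := dotProduct_self_le_of_half_le (hD.half_le hs hc) (u - v)
    have huv' : (1 - P * mask D * P) *ᵥ (u - v) = 0 := by
      rw [mulVec_sub]; exact sub_eq_zero.2 huv
    rw [huv', dotProduct_zero, mul_zero] at h
    exact sub_eq_zero.1 (dotProduct_self_eq_zero.1 (h.antisymm (dotProduct_self_nonneg' _)))
  rw [localInverse, ← Matrix.mul_assoc, mul_nonsing_inv _ hu, Matrix.one_mul]

lemma IsSparseFor.localInverse_norm_le (hs : Pᵀ = P) (hD : IsSparseFor P D c) (hc : c ≤ 1 / 2)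
    (v : N → ℝ) :
    (localInverse P D *ᵥ v) ⬝ᵥ (localInverse P D *ᵥ v) ≤ 4 * ((P *ᵥ v) ⬝ᵥ (P *ᵥ v)) := by
  have h := dotProduct_self_le_of_half_le (hD.half_le hs hc) (localInverse P D *ᵥ v)
  rwa [mulVec_mulVec, hD.mul_localInverse hs hc] at h

lemma IsSparseFor.proj_mul_localInverse (hs : Pᵀ = P) (hi : P * P = P) (hD : IsSparseFor P D c)
    (hc : c ≤ 1 / 2) : P * localInverse P D = localInverse P D := by
  have h := hD.mul_localInverse hs hc
  rw [Matrix.sub_mul, Matrix.one_mul, sub_eq_iff_eq_add] at h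
  rw [h, Matrix.mul_add, hi, Matrix.mul_assoc, Matrix.mul_assoc, ← Matrix.mul_assoc P P, hi]

lemma localInverse_transpose (hs : Pᵀ = P) (hi : P * P = P) (hD : IsSparseFor P D c)
    (hc : c ≤ 1 / 2) : (localInverse P D)ᵀ = localInverse P D := by
  have hM : (1 - P * mask D * P)ᵀ = 1 - P * mask D * P := by
    rw [transpose_sub, transpose_one, transpose_mul, transpose_mul, hs, mask_transpose,
      Matrix.mul_assoc]
  have h1 := hD.mul_localInverse hs hc
  have h2 : (localInverse P D)ᵀ * (1 - P * mask D * P) = P := by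
    rw [← hM, ← transpose_mul, h1, hs]
  have h3 := hD.proj_mul_localInverse hs hi hc
  calc (localInverse P D)ᵀ = (localInverse P D)ᵀ * P := by
        conv_lhs => rw [← h3, transpose_mul, hs]
    _ = (localInverse P D)ᵀ * ((1 - P * mask D * P) * localInverse P D) := by rw [h1]
    _ = localInverse P D := by rw [← Matrix.mul_assoc, h2, h3]

lemma sum_sq_column_eq_dotProduct (G : Matrix N N ℝ) (x : N) :
    ∑ y, G y x ^ 2 = (G *ᵥ Pi.single x 1) ⬝ᵥ (G *ᵥ Pi.single x 1) := by
  rw [mulVec_single_one]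
  exact Finset.sum_congr rfl fun y _ => sq _

lemma IsSparseFor.sum_sq_localInverse_le (hs : Pᵀ = P) (hi : P * P = P) (hg : ∀ x, P x x ≤ g)
    (hD : IsSparseFor P D c) (hc : c ≤ 1 / 2) (x : N) :
    ∑ y, localInverse P D y x ^ 2 ≤ 4 * g := by
  have h := hD.localInverse_norm_le hs hc (Pi.single x 1)
  rw [← sum_sq_column_eq_dotProduct, ← sum_sq_column_eq_dotProduct, sum_sq_column_eq hs hi] at h
  linarith [hg x]

lemma IsSparseFor.isLocalInverse (hs : Pᵀ = P) (hi : P * P = P) (hg : ∀ x, P x x ≤ g)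
    (hg0 : 0 ≤ g) (hD : IsSparseFor P D c) (hc : c ≤ 1 / 2) :
    IsLocalInverse P (localInverse P D) D (4 * g) where
  transpose_eq := localInverse_transpose hs hi hD hc
  mul_eq := hD.proj_mul_localInverse hs hi hc
  inverse := by
    have h := hD.mul_localInverse hs hc
    have h3 := hD.proj_mul_localInverse hs hi hc
    rw [Matrix.sub_mul, Matrix.one_mul, Matrix.mul_assoc, h3] at h
    rw [mask_compl, Matrix.mul_sub, Matrix.sub_mul, Matrix.mul_one, h3, h]
  norm_le v := (hD.localInverse_norm_le hs hc v).trans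
    (mul_le_mul_of_nonneg_left (proj_dotProduct_self_le hs hi v) (by norm_num))
  sum_sq_le := hD.sum_sq_localInverse_le hs hi hg hc
  abs_le x y := abs_le_of_sq_le_sq ((apply_sq_le hs hi hg hg0 (hD.proj_mul_localInverse hs hi hc)
    (hD.sum_sq_localInverse_le hs hi hg hc y) x).trans (by nlinarith)) (by positivity)

lemma IsSparseFor.mask_localInverse_le (hs : Pᵀ = P) (hi : P * P = P) (hD : IsSparseFor P D c)
    (hc0 : 0 ≤ c) (hc : c ≤ 1 / 2) (v : N → ℝ) :
    (mask D *ᵥ (localInverse P D *ᵥ v)) ⬝ᵥ (mask D *ᵥ (localInverse P D *ᵥ v)) ≤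
      4 * c * ((P *ᵥ v) ⬝ᵥ (P *ᵥ v)) := by
  have h := hD (localInverse P D *ᵥ v)
  rw [mulVec_mulVec v P, hD.proj_mul_localInverse hs hi hc] at h
  nlinarith [hD.localInverse_norm_le hs hc v]

/-- By duality, `P` contracts the vectors supported on `D` as much as restriction to `D` contracts
the vectors in the range of `P`. -/
lemma IsSparseFor.proj_mask_le (hs : Pᵀ = P) (hi : P * P = P) (hD : IsSparseFor P D c)
    (v : N → ℝ) : (P *ᵥ (mask D *ᵥ v)) ⬝ᵥ (P *ᵥ (mask D *ᵥ v)) ≤ c * (v ⬝ᵥ v) := by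
  set u := P *ᵥ (mask D *ᵥ v) with hu
  have hPu : P *ᵥ u = u := by rw [hu, mulVec_mulVec, hi]
  have e : u ⬝ᵥ u = v ⬝ᵥ (mask D *ᵥ (P *ᵥ u)) := by
    rw [dotProduct_mulVec_symm (mask D), mask_transpose, dotProduct_mulVec_symm P, hs,
      dotProduct_comm]
  have h1 := dotProduct_le_sqrt_mul_sqrt v (mask D *ᵥ (P *ᵥ u))
  have h2 := hD u
  rw [← e, ← Real.sqrt_mul (dotProduct_self_nonneg' v)] at h1
  have hu0 := dotProduct_self_nonneg' u
  have hv0 := dotProduct_self_nonneg' v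
  rcases hu0.eq_or_lt with h0 | h0
  · rw [← h0]
    exact (dotProduct_self_nonneg' _).trans (hD v)
  · have h3 : (u ⬝ᵥ u) ^ 2 ≤ (v ⬝ᵥ v) * (c * (u ⬝ᵥ u)) :=
      ((Real.le_sqrt' h0).1 h1).trans (by gcongr)
    refine le_of_mul_le_mul_right ?_ h0
    linarith

lemma IsSparseFor.mask_localInverse_mask_le (hs : Pᵀ = P) (hi : P * P = P)
    (hD : IsSparseFor P D c) (hc0 : 0 ≤ c) (hc : c ≤ 1 / 2) (v : N → ℝ) :
    ((mask D * localInverse P D * mask D) *ᵥ v) ⬝ᵥ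
      ((mask D * localInverse P D * mask D) *ᵥ v) ≤ (2 * c) ^ 2 * (v ⬝ᵥ v) := by
  rw [← mulVec_mulVec, ← mulVec_mulVec]
  have h1 := hD.mask_localInverse_le hs hi hc0 hc (mask D *ᵥ v)
  have h2 := hD.proj_mask_le hs hi v
  nlinarith

end

/-! ### Random sets of entries -/

/-- The set of the entries that carry the label `true`. -/
def labelled {N : Type*} [Fintype N] (δ : N → Bool) : Finset N :=
  Finset.univ.filter fun x => δ x = true

lemma mem_labelled {N : Type*} [Fintype N] {δ : N → Bool} {x : N} :
    x ∈ labelled δ ↔ δ x = true := by simp [labelled]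

lemma sum_labelled {N : Type*} [Fintype N] (δ : N → Bool) (F : N → ℝ) :
    ∑ x ∈ labelled δ, F x = ∑ x, (if δ x then 1 else 0) * F x := by
  rw [labelled, Finset.sum_filter]
  exact Finset.sum_congr rfl fun x _ => by split_ifs <;> simp

section

variable {N : Type*} [Fintype N] [DecidableEq N] {P : Matrix N N ℝ} {g : ℝ}

lemma dotProduct_rankOne_mulVec {N : Type*} [Fintype N] {P : Matrix N N ℝ} (k : ℝ) (x : N)
    (v : N → ℝ) : v ⬝ᵥ ((k • vecMulVec (P x) (P x)) *ᵥ v) = k * (P *ᵥ v) x ^ 2 := by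
  rw [smul_mulVec, dotProduct_smul, vecMulVec_mulVec, smul_eq_mul]
  congr 1
  rw [sq, show (P *ᵥ v) x = P x ⬝ᵥ v from rfl]
  simp [dotProduct_smul, dotProduct_comm]

lemma isSymm_rankOne {N : Type*} (P : Matrix N N ℝ) (k : ℝ) (x : N) :
    (k • vecMulVec (P x) (P x)).IsSymm := by
  rw [IsSymm, transpose_smul, transpose_vecMulVec]

/-- Upper tail: matrix concentration applied to the forms `v ↦ (P v)ₓ² / g`, whose values lie
between `0` and `‖v‖²`. -/
lemma prob_not_sum_sq_labelled_le [Nonempty N] (hs : Pᵀ = P) (hi : P * P = P)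
    (hg : ∀ x, P x x ≤ g) (hg0 : 0 < g) {d : ℝ} (hd0 : 0 ≤ d) (hd1 : d ≤ 1) (τ : ℝ) :
    prob (berWeight d) (fun δ => ¬ ∀ v, ∑ x ∈ labelled δ, (P *ᵥ v) x ^ 2 ≤
      2 * d * ((P *ᵥ v) ⬝ᵥ (P *ᵥ v)) + τ * g * (v ⬝ᵥ v)) ≤
      Fintype.card N * Real.exp (-τ) := by
  have hw := isWeight_berWeight hd0 hd1
  have h := prob_not_quadratic_le hw (H := fun x => (1 / g) • vecMulVec (P x) (P x))
    (fun x => isSymm_rankOne P _ x) (ξ := fun b => if b then 1 else 0) (α := 2 * d) (β := 0)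
    (lo := 0) (hi := 1) (fun x v => by
      rw [dotProduct_rankOne_mulVec, zero_mul]; positivity)
    (fun x v => by
      rw [dotProduct_rankOne_mulVec, one_mul, one_div_mul_eq_div, div_le_iff₀ hg0, mul_comm]
      exact mulVec_sq_le hs hi hg v x)
    (fun t ht0 ht1 => by
      have hexp : Real.exp t ≤ 1 + 2 * t := by
        have := (abs_le.1 (Real.abs_exp_sub_one_sub_id_le (x := t) (abs_le.2 ⟨by linarith, ht1⟩))).2
        nlinarith
      have e1 : Real.exp (1 * t - 2 * d * t - 0 * t ^ 2) =
          Real.exp t * Real.exp (-(2 * d * t)) := by rw [← Real.exp_add]; congr 1; ring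
      have e2 : Real.exp (0 * t - 2 * d * t - 0 * t ^ 2) = Real.exp (-(2 * d * t)) := by
        congr 1; ring
      rw [Fintype.sum_bool]
      simp only [berWeight, if_true, Bool.false_eq_true, if_false, e1, e2]
      calc d * (Real.exp t * Real.exp (-(2 * d * t))) + (1 - d) * Real.exp (-(2 * d * t))
          = (d * (Real.exp t - 1) + 1) * Real.exp (-(2 * d * t)) := by ring
        _ ≤ Real.exp (2 * d * t) * Real.exp (-(2 * d * t)) := by
            gcongr
            exact (Real.add_one_le_exp _).trans' (by nlinarith)
        _ = 1 := by rw [← Real.exp_add, add_neg_cancel, Real.exp_zero]) τ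
  refine (prob_mono hw fun δ hδ hall => hδ fun v => ?_).trans h
  have h1 := hall v
  simp only [dotProduct_rankOne_mulVec, zero_mul, sub_zero] at h1
  have e : ∑ x, ((if δ x then 1 else 0) - 2 * d) * (1 / g * (P *ᵥ v) x ^ 2) =
      (∑ x ∈ labelled δ, (P *ᵥ v) x ^ 2 - 2 * d * ((P *ᵥ v) ⬝ᵥ (P *ᵥ v))) / g := by
    rw [sum_labelled, dotProduct, Finset.mul_sum, ← Finset.sum_sub_distrib, Finset.sum_div]
    exact Finset.sum_congr rfl fun x _ => by ring
  rw [e, div_le_iff₀ hg0] at h1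
  linarith

/-- Lower tail: matrix concentration applied to the forms `v ↦ -(P v)ₓ² / g`, whose values lie
between `-‖v‖²` and `0`. -/
lemma prob_not_le_sum_sq_labelled_le [Nonempty N] (hs : Pᵀ = P) (hi : P * P = P)
    (hg : ∀ x, P x x ≤ g) (hg0 : 0 < g) {p : ℝ} (hp0 : 0 ≤ p) (hp1 : p ≤ 1) (τ : ℝ) :
    prob (berWeight p) (fun γ => ¬ ∀ v, (p / 2) * ((P *ᵥ v) ⬝ᵥ (P *ᵥ v)) ≤
      ∑ x ∈ labelled γ, (P *ᵥ v) x ^ 2 + τ * g * (v ⬝ᵥ v)) ≤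
      Fintype.card N * Real.exp (-τ) := by
  have hw := isWeight_berWeight hp0 hp1
  have h := prob_not_quadratic_le hw (H := fun x => (-(1 / g)) • vecMulVec (P x) (P x))
    (fun x => isSymm_rankOne P _ x) (ξ := fun b => if b then 1 else 0) (α := p / 2) (β := 0)
    (lo := -1) (hi := 0) (fun x v => by
      have := mulVec_sq_le hs hi hg v x
      rw [dotProduct_rankOne_mulVec, neg_mul, neg_mul, neg_le_neg_iff, one_mul,
        one_div_mul_eq_div, div_le_iff₀ hg0, mul_comm]
      exact this)
    (fun x v => by
      rw [dotProduct_rankOne_mulVec, zero_mul, neg_mul, neg_nonpos]; positivity)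
    (fun t ht0 ht1 => by
      have hexp : Real.exp t ≤ 1 + t / 2 := by
        have h1 : 1 - t ≤ Real.exp (-t) := by linarith [Real.add_one_le_exp (-t)]
        have h2 : Real.exp t * (1 - t) ≤ 1 := by
          calc Real.exp t * (1 - t) ≤ Real.exp t * Real.exp (-t) := by gcongr
            _ = 1 := by rw [← Real.exp_add, add_neg_cancel, Real.exp_zero]
        have h3 : 0 ≤ (-t) * (1 + t) := mul_nonneg (by linarith) (by linarith)
        refine le_of_mul_le_mul_right (h2.trans ?_) (by linarith : 0 < 1 - t)
        nlinarith
      have e1 : Real.exp (1 * t - p / 2 * t - 0 * t ^ 2) =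
          Real.exp t * Real.exp (-(p / 2 * t)) := by rw [← Real.exp_add]; congr 1; ring
      have e2 : Real.exp (0 * t - p / 2 * t - 0 * t ^ 2) = Real.exp (-(p / 2 * t)) := by
        congr 1; ring
      rw [Fintype.sum_bool]
      simp only [berWeight, if_true, Bool.false_eq_true, if_false, e1, e2]
      calc p * (Real.exp t * Real.exp (-(p / 2 * t))) + (1 - p) * Real.exp (-(p / 2 * t))
          = (p * (Real.exp t - 1) + 1) * Real.exp (-(p / 2 * t)) := by ring
        _ ≤ Real.exp (p / 2 * t) * Real.exp (-(p / 2 * t)) := by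
            gcongr
            exact (Real.add_one_le_exp _).trans' (by nlinarith)
        _ = 1 := by rw [← Real.exp_add, add_neg_cancel, Real.exp_zero]) τ
  refine (prob_mono hw fun δ hδ hall => hδ fun v => ?_).trans h
  have h1 := hall v
  simp only [dotProduct_rankOne_mulVec, zero_mul, sub_zero] at h1
  have e : ∑ x, ((if δ x then 1 else 0) - p / 2) * (-(1 / g) * (P *ᵥ v) x ^ 2) =
      (p / 2 * ((P *ᵥ v) ⬝ᵥ (P *ᵥ v)) - ∑ x ∈ labelled δ, (P *ᵥ v) x ^ 2) / g := by
    rw [sum_labelled, dotProduct, Finset.mul_sum, ← Finset.sum_sub_distrib, Finset.sum_div]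
    exact Finset.sum_congr rfl fun x _ => by ring
  rw [e, div_le_iff₀ hg0] at h1
  linarith

lemma isSparseFor_labelled (hs : Pᵀ = P) (hi : P * P = P) {δ : N → Bool} {d k c : ℝ}
    (hd0 : 0 ≤ d) (hc : 2 * d + k ≤ c) (h : ∀ v, ∑ x ∈ labelled δ, (P *ᵥ v) x ^ 2 ≤
      2 * d * ((P *ᵥ v) ⬝ᵥ (P *ᵥ v)) + k * (v ⬝ᵥ v)) : IsSparseFor P (labelled δ) c := by
  intro v
  have e : (mask (labelled δ) *ᵥ (P *ᵥ v)) ⬝ᵥ (mask (labelled δ) *ᵥ (P *ᵥ v)) =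
      ∑ x ∈ labelled δ, (P *ᵥ v) x ^ 2 := by
    rw [mask_mulVec, dotProduct, ← Finset.sum_subset (Finset.subset_univ (labelled δ))
      fun x _ hx => by rw [if_neg hx, zero_mul]]
    exact Finset.sum_congr rfl fun x hx => by rw [if_pos hx, sq]
  rw [e]
  have h1 := proj_dotProduct_self_le hs hi v
  have h2 := dotProduct_self_nonneg' v
  refine (h v).trans ?_
  nlinarith [mul_le_mul_of_nonneg_left h1 hd0]

end

end RobustMC

/-! ### The dual certificate in the random model -/

namespace RobustMC

open Matrix

lemma HasCertificate.mono {n r : ℕ} {U V : Matrix (Fin n) (Fin r) ℝ} {D : Finset (Fin n × Fin n)}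
    {Z : Fin n × Fin n → ℝ} {B B' T T' ε ε' : ℝ} {γ : Fin n × Fin n → Bool}
    (h : HasCertificate U V D Z B T ε γ) (hB : B ≤ B') (hT : T ≤ T') (hε0 : 0 ≤ ε) (hε : ε ≤ ε') :
    HasCertificate U V D Z B' T' ε' γ := by
  obtain ⟨Y, h1, h2, h3, h4⟩ := h
  exact ⟨Y, h1, fun x => (h2 x).trans hB, h3.mono hT, h4.trans (by gcongr)⟩

/-- The range of the parameters in which recovery is proved: `ρ` and `ρ s` are the densities of the
observed and of the corrupted entries, `g` bounds the squared norms of the projections of the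
standard basis matrices to the tangent space, `l` stands for `log n`, and `2 ^ m ≥ n` is the factor
that `m` rounds of golfing gain. -/
structure IsRecoveryRegime (n m : ℕ) (ρ s g l : ℝ) : Prop where
  one_le_l : 1 ≤ l
  rho_pos : 0 < ρ
  rho_lt : ρ < 1 / 2
  s_nonneg : 0 ≤ s
  s_le : 10 ^ 5 * s ≤ 1
  le_g : 2 ≤ n * g
  g_le : 10 ^ 10 * (g * l ^ 2) ≤ ρ
  le_two_pow : (n : ℝ) ≤ 2 ^ m
  m_le : m ≤ 3 * l

/-- The weight of the `ℓ¹` norm in the convex program, with `l` in place of `log n`. -/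
noncomputable def penalty (n : ℕ) (ρ l : ℝ) : ℝ := 1 / √(ρ * n * l)

section

variable {n m : ℕ} {ρ s g l : ℝ}

lemma IsRecoveryRegime.g_pos (h : IsRecoveryRegime n m ρ s g l) : 0 < g :=
  pos_of_mul_pos_right (two_pos.trans_le h.le_g) (Nat.cast_nonneg n)

lemma IsRecoveryRegime.n_pos (h : IsRecoveryRegime n m ρ s g l) : (0 : ℝ) < n :=
  pos_of_mul_pos_left (two_pos.trans_le h.le_g) h.g_pos.le

lemma IsRecoveryRegime.g_mul_le (h : IsRecoveryRegime n m ρ s g l) : 10 ^ 10 * (g * l) ≤ ρ := by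
  have := h.g_le
  have := mul_pos h.g_pos (zero_lt_one.trans_le h.one_le_l)
  nlinarith [h.one_le_l]

lemma IsRecoveryRegime.sq_le (h : IsRecoveryRegime n m ρ s g l) : 10 ^ 10 * l ^ 2 ≤ ρ * n := by
  nlinarith [h.g_le, h.le_g, h.n_pos, h.one_le_l, mul_le_mul_of_nonneg_right h.g_le h.n_pos.le,
    mul_le_mul_of_nonneg_right h.le_g (sq_nonneg l)]

lemma IsRecoveryRegime.prod_pos (h : IsRecoveryRegime n m ρ s g l) : 0 < ρ * n * l :=
  mul_pos (mul_pos h.rho_pos h.n_pos) (zero_lt_one.trans_le h.one_le_l)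

lemma IsRecoveryRegime.penalty_pos (h : IsRecoveryRegime n m ρ s g l) : 0 < penalty n ρ l :=
  one_div_pos.2 (Real.sqrt_pos.2 h.prod_pos)

lemma IsRecoveryRegime.penalty_sq (h : IsRecoveryRegime n m ρ s g l) :
    penalty n ρ l ^ 2 * (ρ * n * l) = 1 := by
  rw [penalty, div_pow, one_pow, Real.sq_sqrt h.prod_pos.le, one_div,
    inv_mul_cancel₀ h.prod_pos.ne']

lemma IsRecoveryRegime.penalty_le_one (h : IsRecoveryRegime n m ρ s g l) :
    penalty n ρ l ≤ 1 := by
  have h1 : 1 ≤ ρ * n * l := by nlinarith [h.sq_le, h.one_le_l]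
  rw [penalty, div_le_one (Real.sqrt_pos.2 h.prod_pos)]
  exact Real.one_le_sqrt.2 h1

/-- The bound on the entries of a target from which golfing starts. The factor `1 / 4000` is small
enough for the resulting certificate to use up only a fraction of the budget of the dual
certificate. -/
noncomputable def targetLevel (n : ℕ) (ρ l : ℝ) : ℝ := 1 / 4000 * (penalty n ρ l * ρ / √l)

lemma IsRecoveryRegime.targetLevel_pos (h : IsRecoveryRegime n m ρ s g l) :
    0 < targetLevel n ρ l := by
  have := h.penalty_pos
  have := h.rho_pos
  have := h.one_le_l
  rw [targetLevel]; positivity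

lemma IsRecoveryRegime.targetLevel_sq (h : IsRecoveryRegime n m ρ s g l) :
    targetLevel n ρ l ^ 2 * (16 * 10 ^ 6 * (n * l ^ 2)) = ρ := by
  have h1 := h.penalty_sq
  have h2 : √l ^ 2 = l := Real.sq_sqrt (zero_le_one.trans h.one_le_l)
  have hl : 0 < l := zero_lt_one.trans_le h.one_le_l
  rw [targetLevel, mul_pow, div_pow (penalty n ρ l * ρ), h2]
  have hρ := h.rho_pos
  calc (1 / 4000) ^ 2 * ((penalty n ρ l * ρ) ^ 2 / l) * (16 * 10 ^ 6 * (n * l ^ 2))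
      = ρ * (penalty n ρ l ^ 2 * (ρ * n * l)) := by field_simp; ring
    _ = ρ := by rw [h1, mul_one]

lemma IsRecoveryRegime.one_le_sqrt (h : IsRecoveryRegime n m ρ s g l) : 1 ≤ √l :=
  Real.one_le_sqrt.2 h.one_le_l

lemma IsRecoveryRegime.golf_ratio_le (h : IsRecoveryRegime n m ρ s g l) :
    9 * √(4 * g * l / (ρ / 8)) ≤ 1 / (2 * √l) := by
  have hl : 0 < l := zero_lt_one.trans_le h.one_le_l
  have hρ := h.rho_pos
  have : √(4 * g * l / (ρ / 8)) ≤ 1 / (18 * √l) := by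
    refine Real.sqrt_le_iff.2 ⟨by positivity, ?_⟩
    rw [div_pow, mul_pow, Real.sq_sqrt hl.le, div_le_div_iff₀ (by positivity) (by positivity)]
    nlinarith [h.g_le]
  calc 9 * √(4 * g * l / (ρ / 8)) ≤ 9 * (1 / (18 * √l)) := by gcongr
    _ = 1 / (2 * √l) := by field_simp; norm_num

lemma IsRecoveryRegime.golf_entry_le (h : IsRecoveryRegime n m ρ s g l) :
    targetLevel n ρ l / (ρ / 8) + 2 * (1 / (2 * √l) * targetLevel n ρ l) / (ρ / (24 * l)) ≤
      penalty n ρ l / 8 := by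
  have hl : 0 < l := zero_lt_one.trans_le h.one_le_l
  have hsl1 := h.one_le_sqrt
  have hsl : 0 < √l := zero_lt_one.trans_le hsl1
  have hρ := h.rho_pos
  have hlam := h.penalty_pos
  have e : targetLevel n ρ l / (ρ / 8) + 2 * (1 / (2 * √l) * targetLevel n ρ l) / (ρ / (24 * l)) =
      penalty n ρ l / 4000 * (8 / √l + 24 * (l / √l ^ 2)) := by
    rw [targetLevel]
    field_simp
  have h1 : l / √l ^ 2 = 1 := by rw [Real.sq_sqrt hl.le, div_self hl.ne']
  rw [e, h1]
  have : 8 / √l ≤ 8 := div_le_self (by norm_num) hsl1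
  nlinarith

lemma IsRecoveryRegime.golf_opLe_le (h : IsRecoveryRegime n m ρ s g l) (b : ℝ) :
    b + 27 * targetLevel n ρ l * √(n * l / (ρ / 8)) +
      54 * (1 / (2 * √l) * targetLevel n ρ l) * √(n * l / (ρ / (24 * l))) ≤ b + 1 / 10 := by
  have hl1 := h.one_le_l
  have hl : 0 < l := zero_lt_one.trans_le hl1
  have hρ := h.rho_pos
  have hn := h.n_pos
  have ha := h.targetLevel_pos
  have hasq := h.targetLevel_sq
  set a := targetLevel n ρ l
  have e1 : a * √(n * l / (ρ / 8)) ≤ 1 / 1000 := by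
    rw [← Real.sqrt_sq ha.le, ← Real.sqrt_mul (by positivity)]
    refine Real.sqrt_le_iff.2 ⟨by norm_num, ?_⟩
    calc a ^ 2 * (n * l / (ρ / 8))
        = a ^ 2 * (16 * 10 ^ 6 * (n * l ^ 2)) * (8 / (16 * 10 ^ 6 * (ρ * l))) := by
          field_simp
      _ = 8 / (16 * 10 ^ 6 * l) := by rw [hasq]; field_simp
      _ ≤ (1 / 1000) ^ 2 := by
          rw [div_le_iff₀ (by positivity)]; norm_num; linarith
  have e2 : 1 / (2 * √l) * a * √(n * l / (ρ / (24 * l))) ≤ 1 / 1000 := by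
    rw [← Real.sqrt_sq (by positivity : 0 ≤ 1 / (2 * √l) * a), ← Real.sqrt_mul (by positivity)]
    refine Real.sqrt_le_iff.2 ⟨by norm_num, ?_⟩
    rw [mul_pow, div_pow, mul_pow, Real.sq_sqrt hl.le]
    calc 1 ^ 2 / (2 ^ 2 * l) * a ^ 2 * (n * l / (ρ / (24 * l)))
        = a ^ 2 * (16 * 10 ^ 6 * (n * l ^ 2)) * (6 / (16 * 10 ^ 6 * (ρ * l))) := by
          field_simp; norm_num
      _ = 6 / (16 * 10 ^ 6 * l) := by rw [hasq]; field_simp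
      _ ≤ (1 / 1000) ^ 2 := by
          rw [div_le_iff₀ (by positivity)]; norm_num; linarith
  linarith

lemma IsRecoveryRegime.golf_residual_le (h : IsRecoveryRegime n m ρ s g l) :
    n * (1 / (2 * √l) * targetLevel n ρ l) / 2 ^ m ≤ √(ρ / 8) * (penalty n ρ l / 16) := by
  have hρ := h.rho_pos
  have hρ1 := h.rho_lt
  have hlam := h.penalty_pos
  have hsl1 := h.one_le_sqrt
  have ha := h.targetLevel_pos
  have h1 : (n : ℝ) / 2 ^ m ≤ 1 := (div_le_one (by positivity)).2 h.le_two_pow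
  have h2 : 1 / (2 * √l) ≤ 1 / 2 := by gcongr; linarith
  have h3 : targetLevel n ρ l ≤ 1 / 4000 * (penalty n ρ l * ρ) := by
    rw [targetLevel]; gcongr; exact div_le_self (by positivity) hsl1
  have e1 : ρ / 3 ≤ √(ρ / 8) := by
    refine Real.le_sqrt_of_sq_le ?_
    nlinarith
  calc n * (1 / (2 * √l) * targetLevel n ρ l) / 2 ^ m
      = (n / 2 ^ m) * (1 / (2 * √l) * targetLevel n ρ l) := by ring
    _ ≤ 1 * (1 / 2 * (1 / 4000 * (penalty n ρ l * ρ))) := by gcongr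
    _ ≤ ρ / 3 * (penalty n ρ l / 16) := by nlinarith [mul_pos hlam hρ]
    _ ≤ √(ρ / 8) * (penalty n ρ l / 16) := by gcongr

variable [NeZero n] {r : ℕ} {U V : Matrix (Fin n) (Fin r) ℝ} {D : Finset (Fin n × Fin n)}
  {G : Matrix (Fin n × Fin n) (Fin n × Fin n) ℝ}

/-- Golfing from a target at the level `targetLevel`, with a large batch of density `ρ / 8` and `m`
small ones of density `ρ / (24 l)`; these add up to at most `ρ / 4`, as `m ≤ 3 l`. -/
lemma IsRecoveryRegime.prob_not_hasCertificate_le (h : IsRecoveryRegime n m ρ s g l)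
    (hU : Uᵀ * U = 1) (hV : Vᵀ * V = 1) (hG : IsLocalInverse (tangentProj U V) G D (4 * g))
    {Z : Fin n × Fin n → ℝ} {b p : ℝ} (hp : ρ / 4 ≤ p) (hp1 : p ≤ 1)
    (hZP : tangentProj U V *ᵥ Z = Z) (hZ : ∀ x, |Z x| ≤ targetLevel n ρ l)
    (hZD : OpLe (mask D *ᵥ Z) b) (hb : 0 ≤ b) :
    prob (berWeight p) (fun γ => ¬ HasCertificate U V D Z (penalty n ρ l / 8) (b + 1 / 10)
      (√(ρ / 8) * (penalty n ρ l / 16)) γ) ≤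
      (m + 1) * ((4 * n + 2 * n ^ 2) * Real.exp (-(8 * l))) := by
  have hl : 0 < l := zero_lt_one.trans_le h.one_le_l
  have hl1 := h.one_le_l
  have hρ := h.rho_pos
  have hρ1 := h.rho_lt
  have hn := h.n_pos
  have hg := h.g_pos
  have hsl : 0 < √l := Real.sqrt_pos.2 hl
  have ha := h.targetLevel_pos
  have hw := isWeight_berWeight ((by positivity : 0 ≤ ρ / 4).trans hp) hp1
  have hq : ρ / (24 * l) ≤ ρ / 8 := by gcongr; linarith
  have hlq : l ≤ n * (ρ / (24 * l)) := by
    rw [mul_div_assoc', le_div_iff₀ (by positivity)]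
    nlinarith [h.sq_le]
  have hgq : 324 * (4 * g * l) ≤ ρ / (24 * l) := by
    rw [le_div_iff₀ (by positivity)]
    nlinarith [h.g_le]
  have hmq : ρ / 8 + m * (ρ / (24 * l)) ≤ p := by
    have : m * (ρ / (24 * l)) ≤ 3 * l * (ρ / (24 * l)) := by gcongr; exact h.m_le
    have e : 3 * l * (ρ / (24 * l)) = ρ / 8 := by field_simp; norm_num
    linarith
  have hmain := RobustMC.prob_not_hasCertificate_le hU hV hG (by positivity) (q₁ := ρ / 8)
    (q := ρ / (24 * l)) (by linarith) (by positivity) hq hl hlq hgq h.golf_ratio_le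
    (by positivity) m ha hmq hp1 hZP hZ hZD hb
  exact (prob_mono hw fun γ hγ hc => hγ (HasCertificate.mono hc h.golf_entry_le
    (h.golf_opLe_le b) (by positivity) h.golf_residual_le)).trans hmain

end

end RobustMC

/-! ### Random signs -/

namespace RobustMC

open Matrix

/-- The two values of a mean zero variable that is positive with probability `1 / 4`. -/
noncomputable def skewSign : Bool → ℝ := fun b => if b then 1 else -(1 / 3)

/-- For a mean zero variable the linear term on the right has no expectation, so this bounds its
moment generating function. -/
lemma exp_le_add_exp_sq (x : ℝ) : Real.exp x ≤ x + Real.exp (x ^ 2) := by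
  have h2 : x ^ 2 + 1 ≤ Real.exp (x ^ 2) := Real.add_one_le_exp _
  rcases le_total x (-1) with h | h
  · have h1 : Real.exp x ≤ 1 := Real.exp_le_one_iff.2 (by linarith)
    nlinarith
  rcases le_total x 1 with h' | h'
  · have := (abs_le.1 (Real.abs_exp_sub_one_sub_id_le (x := x) (abs_le.2 ⟨h, h'⟩))).2
    linarith
  · have : Real.exp x ≤ Real.exp (x ^ 2) := Real.exp_le_exp.2 (by nlinarith)
    linarith

lemma mgfLe_skewSign (b : ℝ) : MgfLe (berWeight (1 / 4)) skewSign 1 b := by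
  intro t _
  have h1 := exp_le_add_exp_sq t
  have h2 := exp_le_add_exp_sq (-(1 / 3) * t)
  have h3 : Real.exp ((-(1 / 3) * t) ^ 2) ≤ Real.exp (t ^ 2) :=
    Real.exp_le_exp.2 (by nlinarith [sq_nonneg t])
  rw [Fintype.sum_bool]
  simp only [berWeight, skewSign, if_true, Bool.false_eq_true, if_false, one_mul]
  linarith

/-- A skew sign that is kept only with probability `d` has a moment generating function governed by
its variance. -/
lemma mgfLe_sparse_skewSign {d β : ℝ} (hd0 : 0 ≤ d) (hd : 2 * d ≤ β) :
    MgfLe (fun b : Bool × Bool => berWeight d b.1 * berWeight (1 / 4) b.2)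
      (fun b => if b.1 then skewSign b.2 else 0) β 1 := by
  intro t ht
  have h := mgfLe_skewSign 1 t ht
  have ht2 : t ^ 2 ≤ 1 := (sq_le_one_iff_abs_le_one t).2 ht
  have hexp : Real.exp (t ^ 2) ≤ 1 + 2 * t ^ 2 := by
    have := (abs_le.1 (Real.abs_exp_sub_one_sub_id_le (x := t ^ 2)
      (abs_le.2 ⟨by linarith [sq_nonneg t], ht2⟩))).2
    nlinarith [sq_nonneg t]
  have e : ∑ b : Bool × Bool, berWeight d b.1 * berWeight (1 / 4) b.2 *
      Real.exp ((if b.1 then skewSign b.2 else 0) * t) =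
      1 - d + d * ∑ a, berWeight (1 / 4) a * Real.exp (skewSign a * t) := by
    rw [Fintype.sum_prod_type]
    simp only [Fintype.sum_bool, berWeight, if_true, Bool.false_eq_true, if_false, zero_mul,
      Real.exp_zero]
    ring
  rw [e, one_mul] at *
  calc 1 - d + d * ∑ a, berWeight (1 / 4) a * Real.exp (skewSign a * t)
      ≤ 2 * d * t ^ 2 + 1 := by nlinarith
    _ ≤ Real.exp (2 * d * t ^ 2) := Real.add_one_le_exp _
    _ ≤ Real.exp (β * t ^ 2) := Real.exp_le_exp.2 (by nlinarith [sq_nonneg t])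

/-- The part of the dual certificate on the entries in `labelled δ`: it equals `lam K` where the
skew sign is positive. -/
noncomputable def signPart {N : Type*} (K : N → ℝ) (lam : ℝ) (δ e : N → Bool) : N → ℝ :=
  fun x => if δ x then skewSign (e x) * (lam * K x) else 0

section

variable {n m : ℕ} [NeZero n] {ρ s g l : ℝ} {K : Fin n × Fin n → ℝ}

lemma signPart_eq_mask_mulVec {N : Type*} [Fintype N] [DecidableEq N] (K : N → ℝ) (lam : ℝ)
    (δ e : N → Bool) :
    signPart K lam δ e = mask (labelled δ) *ᵥ fun x => skewSign (e x) * (lam * K x) := by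
  rw [mask_mulVec]
  funext x
  simp [signPart, mem_labelled]

/-- The sign part has operator norm at most `1 / 10`: the sparsity of its support, and not only the
centring of the signs, is needed here. -/
lemma IsRecoveryRegime.prob_not_opLe_signPart_le (h : IsRecoveryRegime n m ρ s g l)
    (hK : ∀ x, |K x| ≤ 1) :
    prob (fun b : Bool × Bool => berWeight (4 * (ρ * s)) b.1 * berWeight (1 / 4) b.2)
      (fun f => ¬ OpLe (signPart K (penalty n ρ l) (fun x => (f x).1) fun x => (f x).2) (1 / 10)) ≤
      2 * n * Real.exp (-(8 * l)) := by
  have hl : 0 < l := zero_lt_one.trans_le h.one_le_l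
  have hρ := h.rho_pos
  have hn := h.n_pos
  have hs := h.s_nonneg
  have hlam := h.penalty_pos
  have hd1 : 4 * (ρ * s) ≤ 1 := by nlinarith [h.s_le, h.rho_lt]
  have hw := (isWeight_berWeight (by positivity) hd1).prod
    (isWeight_berWeight (q := 1 / 4) (by norm_num) (by norm_num))
  have hmgf := mgfLe_sparse_skewSign (d := 4 * (ρ * s)) (β := ρ / 8100) (by positivity)
    (by nlinarith [h.s_le])
  have hb : √(l / (n * (ρ / 8100))) ≤ 1 := by
    refine Real.sqrt_le_iff.2 ⟨zero_le_one, ?_⟩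
    rw [one_pow, div_le_one (by positivity)]
    nlinarith [h.sq_le, h.one_le_l]
  have hmain := prob_not_opLe_mulVec_le hw hmgf (by positivity) (𝓛 := 1)
    (Z := fun x => penalty n ρ l * K x) (a := penalty n ρ l) (γ := 1) (l := l) hlam one_pos hl
    (fun x => by rw [abs_mul, abs_of_pos hlam]; nlinarith [hK x])
    (fun v => by rw [transpose_one, one_mulVec, one_pow, one_mul]) hb
  refine (prob_mono hw fun f hf hc => hf ?_).trans hmain
  rw [one_mulVec] at hc
  have e : signPart K (penalty n ρ l) (fun x => (f x).1) (fun x => (f x).2) =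
      fun x => (if (f x).1 then skewSign (f x).2 else 0) * (penalty n ρ l * K x) := by
    funext x
    rw [signPart, ite_mul, zero_mul]
  rw [e]
  refine hc.mono ?_
  have e2 : penalty n ρ l * √(n * (ρ / 8100) * l) = 1 / 90 := by
    rw [← Real.sqrt_sq hlam.le, ← Real.sqrt_mul (by positivity),
      show penalty n ρ l ^ 2 * (n * (ρ / 8100) * l) =
        penalty n ρ l ^ 2 * (ρ * n * l) * (1 / 90) ^ 2 by ring, h.penalty_sq, one_mul,
      Real.sqrt_sq (by norm_num)]
  linarith

/-- Given the set `labelled δ`, the image under the local inverse of the sign part is a good target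
for golfing, since the signs are independent of `δ`. -/
lemma IsRecoveryRegime.prob_not_localInverse_signPart_le (h : IsRecoveryRegime n m ρ s g l)
    (hK : ∀ x, |K x| ≤ 1) {P : Matrix (Fin n × Fin n) (Fin n × Fin n) ℝ} (hs : Pᵀ = P)
    (hi : P * P = P) (hg : ∀ x, P x x ≤ g) {δ : Fin n × Fin n → Bool}
    (hδ : IsSparseFor P (labelled δ) (ρ / 400)) :
    prob (berWeight (1 / 4)) (fun e => ¬ ((∀ y,
      |(localInverse P (labelled δ) *ᵥ signPart K (penalty n ρ l) δ e) y| ≤ targetLevel n ρ l) ∧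
      OpLe (mask (labelled δ) *ᵥ
        (localInverse P (labelled δ) *ᵥ signPart K (penalty n ρ l) δ e)) (1 / 20))) ≤
      (2 * n ^ 2 + 2 * n) * Real.exp (-(8 * l)) := by
  have hl : 0 < l := zero_lt_one.trans_le h.one_le_l
  have hρ := h.rho_pos
  have hρ1 := h.rho_lt
  have hn := h.n_pos
  have hg0 := h.g_pos
  have hlam := h.penalty_pos
  have hw := isWeight_berWeight (q := 1 / 4) (by norm_num) (by norm_num)
  set lam := penalty n ρ l with hlam_def
  set D := labelled δ with hD
  set G := localInverse P D with hG
  have hc0 : 0 ≤ ρ / 400 := by positivity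
  have hc : ρ / 400 ≤ 1 / 2 := by linarith
  have hlK : ∀ x, |lam * K x| ≤ lam := fun x => by
    rw [abs_mul, abs_of_pos hlam]; nlinarith [hK x]
  have hGt : Gᵀ = G := localInverse_transpose hs hi hδ hc
  have h1 : ∀ y, prob (berWeight (1 / 4)) (fun e => ¬ |∑ x, skewSign (e x) *
      (if δ x then lam * K x * G y x else 0)| ≤ 9 * √(1 * (lam ^ 2 * (ρ / 100 * g)) * l)) ≤
      2 * Real.exp (-(8 * l)) := fun y => by
    refine prob_not_abs_sum_le hw (mgfLe_skewSign _) one_pos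
      (c₀ := ∑ x, |if δ x then lam * K x * G y x else 0|)
      (by positivity) hl (fun x => Finset.single_le_sum (f := fun x =>
        |if δ x then lam * K x * G y x else 0|) (fun x _ => abs_nonneg _) (Finset.mem_univ x)) ?_
      le_rfl
    have h2 := hδ.mask_localInverse_le hs hi hc0 hc (Pi.single y 1)
    rw [← sum_sq_column_eq_dotProduct P, sum_sq_column_eq hs hi, mask_mulVec] at h2
    calc ∑ x, (if δ x then lam * K x * G y x else 0) ^ 2
        ≤ ∑ x, lam ^ 2 * (if x ∈ D then (G *ᵥ Pi.single y 1) x else 0) ^ 2 := by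
          refine Finset.sum_le_sum fun x _ => ?_
          simp only [hD, mem_labelled]
          rw [mulVec_single_one]
          split_ifs
          · have hsym : G y x = G x y := congrFun (congrFun hGt x) y
            rw [mul_pow, hsym]
            exact mul_le_mul_of_nonneg_right (sq_le_sq.2 ((hlK x).trans (le_abs_self lam)))
              (sq_nonneg _)
          · simp
      _ ≤ lam ^ 2 * (ρ / 100 * g) := by
          rw [← Finset.mul_sum]
          refine mul_le_mul_of_nonneg_left ?_ (sq_nonneg _)
          refine (le_of_eq (Finset.sum_congr rfl fun x _ => sq _)).trans (h2.trans ?_)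
          nlinarith [hg y]
  have h2 := prob_not_opLe_mulVec_le hw (mgfLe_skewSign (√(l / (n * 1)))) one_pos
    (𝓛 := mask D * G * mask D) (Z := fun x => lam * K x) (a := lam) (γ := 2 * (ρ / 400)) (l := l)
    hlam (by positivity) hl hlK (fun v => by
      rw [transpose_mul, transpose_mul, mask_transpose, hGt, ← Matrix.mul_assoc]
      exact hδ.mask_localInverse_mask_le hs hi hc0 hc v) le_rfl
  have h1' := prob_exists_le hw _ h1
  have hcard : (Fintype.card (Fin n × Fin n) : ℝ) = n ^ 2 := by
    simp [Fintype.card_prod, sq]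
  rw [hcard] at h1'
  refine (prob_mono hw ?_).trans (((prob_or_le hw _ _).trans (add_le_add h1' h2)).trans_eq
    (by ring))
  intro e he
  by_contra hcon
  push Not at hcon
  refine he ⟨fun y => ?_, ?_⟩
  · have e1 : (G *ᵥ signPart K lam δ e) y =
        ∑ x, skewSign (e x) * (if δ x then lam * K x * G y x else 0) := by
      refine Finset.sum_congr rfl fun x _ => ?_
      rw [signPart]
      split_ifs <;> ring
    rw [e1]
    refine (hcon.1 y).trans ?_
    have ha := h.targetLevel_pos
    have e2 : √(1 * (lam ^ 2 * (ρ / 100 * g)) * l) ≤ targetLevel n ρ l / 9 := by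
      refine Real.sqrt_le_iff.2 ⟨by positivity, ?_⟩
      rw [targetLevel, div_pow, mul_pow, div_pow (penalty n ρ l * ρ), Real.sq_sqrt hl.le,
        mul_pow, ← hlam_def]
      have e3 : (1 / 4000) ^ 2 * (lam ^ 2 * ρ ^ 2 / l) / 9 ^ 2 =
          lam ^ 2 * (ρ / l) * (ρ / (81 * 16 * 10 ^ 6)) := by ring
      have e4 : 1 * (lam ^ 2 * (ρ / 100 * g)) * l =
          lam ^ 2 * (ρ / l) * (g * l ^ 2 / 100) := by field_simp
      rw [e3, e4]
      refine mul_le_mul_of_nonneg_left ?_ (by positivity)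
      linarith [h.g_le]
    linarith
  · rw [signPart_eq_mask_mulVec, mulVec_mulVec, mulVec_mulVec]
    refine OpLe.mono (by simpa only [Matrix.mul_assoc] using hcon.2) ?_
    have e2 : lam * √(n * 1 * l) ≤ √(1 / ρ) := by
      rw [← Real.sqrt_sq hlam.le, ← Real.sqrt_mul (by positivity)]
      refine Real.sqrt_le_sqrt ?_
      rw [le_div_iff₀ hρ]
      have := h.penalty_sq
      linarith
    have e3 : ρ * √(1 / ρ) ≤ 1 := by
      conv_lhs => rw [← Real.sqrt_sq hρ.le, ← Real.sqrt_mul (by positivity), Real.sqrt_sq hρ.le]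
      refine Real.sqrt_le_iff.2 ⟨zero_le_one, ?_⟩
      rw [one_pow, sq, mul_one_div, mul_div_assoc, div_self hρ.ne']
      linarith
    calc 9 * (lam * (2 * (ρ / 400))) * √(n * 1 * l)
        = 18 / 400 * (ρ * (lam * √(n * 1 * l))) := by ring
      _ ≤ 18 / 400 * (ρ * √(1 / ρ)) := by gcongr
      _ ≤ 1 / 20 := by linarith

/-- The joint law of the two indicators of an entry: being observed, and being corrupted. Only
observed entries can be corrupted. -/
noncomputable def obsWeight (ρ s : ℝ) : Bool × Bool → ℝ := fun b =>
  if b.1 then (if b.2 then ρ * s else ρ * (1 - s)) else (if b.2 then 0 else 1 - ρ)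

lemma isWeight_obsWeight {ρ s : ℝ} (h0 : 0 ≤ ρ) (h1 : ρ ≤ 1) (hs0 : 0 ≤ s) (hs1 : s ≤ 1) :
    IsWeight (obsWeight ρ s) where
  nonneg b := by
    rw [obsWeight]
    have := sub_nonneg.2 h1
    have := sub_nonneg.2 hs1
    split_ifs <;> positivity
  sum_eq_one := by
    rw [Fintype.sum_prod_type]
    simp [obsWeight]
    ring

/-- There is a matrix supported on the observed entries that agrees with `lam K` on the corrupted ones, and
whose tangential part nearly vanishes. -/
def HasSignCertificate {n r : ℕ} (U V : Matrix (Fin n) (Fin r) ℝ) (K : Fin n × Fin n → ℝ)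
    (lam T ε : ℝ) (O Om : Finset (Fin n × Fin n)) : Prop :=
  ∃ W : Fin n × Fin n → ℝ, (∀ x ∉ O, W x = 0) ∧ (∀ x ∈ Om, W x = lam * K x) ∧
    (∀ x ∈ O \ Om, |W x| ≤ lam / 3) ∧ OpLe ((1 - tangentProj U V) *ᵥ W) T ∧
    (tangentProj U V *ᵥ W) ⬝ᵥ (tangentProj U V *ᵥ W) ≤ ε ^ 2

/-- Golfing with target `-G w` outside of `D` cancels the tangential part of the sign part `w`,
because `P (mask Dᶜ) G = P`. -/
lemma hasSignCertificate_of_hasCertificate {n r : ℕ} {U V : Matrix (Fin n) (Fin r) ℝ}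
    {K : Fin n × Fin n → ℝ} {lam T t ε g : ℝ} {G : Matrix (Fin n × Fin n) (Fin n × Fin n) ℝ}
    {δ e γ : Fin n × Fin n → Bool} (hU : Uᵀ * U = 1) (hV : Vᵀ * V = 1) (hlam : 0 < lam)
    (hK : ∀ x, |K x| ≤ 1) (ht : 0 ≤ t) (hG : IsLocalInverse (tangentProj U V) G (labelled δ) g)
    (hw : OpLe (signPart K lam δ e) t)
    (h : HasCertificate U V (labelled δ) (-(G *ᵥ signPart K lam δ e)) (lam / 8) T ε γ) :
    HasSignCertificate U V K lam (t + T) ε (labelled fun x => δ x || γ x)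
      (labelled fun x => δ x && e x) := by
  obtain ⟨Y, hsupp, hB, hT, hε⟩ := h
  refine ⟨signPart K lam δ e + Y, fun x hx => ?_, fun x hx => ?_, fun x hx => ?_, ?_, ?_⟩
  · rw [mem_labelled, Bool.or_eq_true, not_or] at hx
    have hY : Y x = 0 := by
      by_contra hY
      exact hx.2 (hsupp x hY).2
    simp [signPart, hx.1, hY]
  · rw [mem_labelled, Bool.and_eq_true] at hx
    have hY : Y x = 0 := by
      by_contra hY
      exact (hsupp x hY).1 (mem_labelled.2 hx.1)
    simp [signPart, hx.1, hx.2, hY, skewSign]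
  · rw [Finset.mem_sdiff, mem_labelled, mem_labelled, Bool.and_eq_true, not_and] at hx
    rw [Pi.add_apply]
    by_cases hδ : δ x = true
    · have hY : Y x = 0 := by
        by_contra hY
        exact (hsupp x hY).1 (mem_labelled.2 hδ)
      rw [hY, add_zero, signPart, if_pos hδ, skewSign, if_neg (hx.2 hδ), abs_mul, abs_mul,
        abs_of_pos hlam, abs_neg, abs_of_pos (by norm_num : (0 : ℝ) < 1 / 3)]
      nlinarith [hK x]
    · rw [signPart, if_neg hδ, zero_add]
      exact (hB x).trans (by linarith)
  · rw [mulVec_add]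
    exact (hw.one_sub_tangentProj hU hV ht).add hT
  · have hmask : mask (labelled δ) *ᵥ signPart K lam δ e = signPart K lam δ e := by
      rw [signPart_eq_mask_mulVec, mulVec_mulVec, mask_mul_self]
    have e1 : tangentProj U V *ᵥ (signPart K lam δ e + Y) = tangentProj U V *ᵥ
        (Y - mask (labelled δ)ᶜ *ᵥ (-(G *ᵥ signPart K lam δ e))) := by
      rw [mulVec_neg, sub_neg_eq_add, mulVec_add, mulVec_add, mulVec_mulVec, mulVec_mulVec,
        hG.inverse, add_comm]
    rw [e1]
    exact hε

/-- The observed and the corrupted entries can be sampled as `D ∪ Γ` and `D ∩ E` with independent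
Bernoulli sets `D`, `E`, `Γ` of densities `4 ρ s`, `1 / 4` and `p`. -/
lemma prob_obsWeight_eq {N : Type*} [Fintype N] [DecidableEq N] {ρ s p : ℝ}
    (hp : 4 * (ρ * s) + (1 - 4 * (ρ * s)) * p = ρ) (Q : (N → Bool × Bool) → Prop) :
    prob (fun b : (Bool × Bool) × Bool =>
      (berWeight (4 * (ρ * s)) b.1.1 * berWeight (1 / 4) b.1.2) * berWeight p b.2)
      (fun f => Q fun x => ((f x).1.1 || (f x).2, (f x).1.1 && (f x).1.2)) =
      prob (obsWeight ρ s) Q := by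
  refine prob_map (fun b : (Bool × Bool) × Bool => (b.1.1 || b.2, b.1.1 && b.1.2))
    (fun b => ?_) Q
  rw [Finset.sum_filter, Fintype.sum_prod_type, Fintype.sum_prod_type]
  rcases b with ⟨b1, b2⟩
  cases b1 <;> cases b2 <;> simp [obsWeight, berWeight] <;> linarith

lemma prob_berWeight_of_obsWeight {N : Type*} [Fintype N] [DecidableEq N] {ρ s : ℝ}
    (Q : (N → Bool) → Prop) :
    prob (obsWeight ρ s) (fun f => Q fun x => (f x).1 && !(f x).2) =
      prob (berWeight (ρ * (1 - s))) Q := by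
  refine prob_map (fun b : Bool × Bool => b.1 && !b.2) (fun b => ?_) Q
  rw [Finset.sum_filter, Fintype.sum_prod_type]
  cases b <;> simp [obsWeight, berWeight]
  ring

lemma IsRecoveryRegime.prob_not_hasSignCertificate_le (h : IsRecoveryRegime n m ρ s g l) {r : ℕ}
    {U V : Matrix (Fin n) (Fin r) ℝ} (hU : Uᵀ * U = 1) (hV : Vᵀ * V = 1)
    (hg : ∀ x, tangentProj U V x x ≤ g) (hK : ∀ x, |K x| ≤ 1) :
    prob (obsWeight ρ s) (fun f => ¬ HasSignCertificate U V K (penalty n ρ l) (1 / 4)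
      (√(ρ / 8) * (penalty n ρ l / 16)) (labelled fun x => (f x).1) (labelled fun x => (f x).2)) ≤
      (3 * n ^ 2 + 4 * n) * Real.exp (-(8 * l)) +
        (m + 1) * ((4 * n + 2 * n ^ 2) * Real.exp (-(8 * l))) := by
  have hρ := h.rho_pos
  have hρ1 := h.rho_lt
  have hs := h.s_nonneg
  have hg0 := h.g_pos
  have hPs : (tangentProj U V)ᵀ = tangentProj U V := tangentProj_transpose
  have hPi := tangentProj_mul_self hU hV
  have hcard : (Fintype.card (Fin n × Fin n) : ℝ) = n ^ 2 := by
    simp [Fintype.card_prod, sq]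
  have hs4 : 4 * (ρ * s) ≤ ρ / 4 := by nlinarith [h.s_le]
  have hd0 : 0 ≤ 4 * (ρ * s) := by positivity
  set d := 4 * (ρ * s) with hd
  have hd1 : 0 < 1 - d := by linarith
  set p := (ρ - d) / (1 - d) with hp_def
  have hp : d + (1 - d) * p = ρ := by rw [hp_def]; field_simp; ring
  have hp4 : ρ / 4 ≤ p := by rw [hp_def, le_div_iff₀ hd1]; nlinarith
  have hp1 : p ≤ 1 := by rw [hp_def, div_le_one hd1]; linarith
  have hwd := isWeight_berWeight hd0 (by linarith)
  have hw4 := isWeight_berWeight (q := 1 / 4) (by norm_num) (by norm_num)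
  have hwp := isWeight_berWeight ((by positivity : 0 ≤ ρ / 4).trans hp4) hp1
  have h1 : prob (berWeight d) (fun δ => ¬ IsSparseFor (tangentProj U V) (labelled δ) (ρ / 400)) ≤
      n ^ 2 * Real.exp (-(8 * l)) := by
    have hd1' : d ≤ 1 := by linarith
    have hmain := prob_not_sum_sq_labelled_le hPs hPi hg hg0 hd0 hd1' (8 * l)
    rw [hcard] at hmain
    refine (prob_mono hwd fun δ hδ hc => hδ ?_).trans hmain
    refine isSparseFor_labelled hPs hPi hd0 ?_ hc
    nlinarith [h.s_le, h.g_mul_le]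
  have h2 := prob_prod_le hwd hw4 (R := fun f : Fin n × Fin n → Bool × Bool =>
    ¬ (IsSparseFor (tangentProj U V) (labelled fun x => (f x).1) (ρ / 400) ∧
      (∀ y, |(localInverse (tangentProj U V) (labelled fun x => (f x).1) *ᵥ
        signPart K (penalty n ρ l) (fun x => (f x).1) fun x => (f x).2) y| ≤ targetLevel n ρ l) ∧
      OpLe (mask (labelled fun x => (f x).1) *ᵥ
        (localInverse (tangentProj U V) (labelled fun x => (f x).1) *ᵥ
          signPart K (penalty n ρ l) (fun x => (f x).1) fun x => (f x).2)) (1 / 20))) h1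
    (δ₂ := (2 * n ^ 2 + 2 * n) * Real.exp (-(8 * l)))
    (fun δ hδ => by
      rw [not_not] at hδ
      refine (prob_mono hw4 fun e he hc => he ⟨hδ, hc⟩).trans
        (h.prob_not_localInverse_signPart_le hK hPs hPi hg hδ)) (by positivity)
  have h3 := h.prob_not_opLe_signPart_le hK
  rw [← hd] at h3
  rw [← prob_obsWeight_eq hp]
  refine (prob_prod_le (hwd.prod hw4) hwp ((prob_or_le (hwd.prod hw4) _ _).trans
    (add_le_add h2 h3)) (fun f hf => ?_) (by positivity)).trans_eq
    (congrArg (· + (m + 1) * ((4 * n + 2 * n ^ 2) * Real.exp (-(8 * l))))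
      (by ring : _ = (3 * (n : ℝ) ^ 2 + 4 * n) * Real.exp (-(8 * l))))
  push Not at hf
  obtain ⟨⟨hf1, hf2, hf3⟩, hf4⟩ := hf
  have hG := hf1.isLocalInverse hPs hPi hg hg0.le (by linarith)
  have hmain := h.prob_not_hasCertificate_le hU hV hG hp4 hp1
    (Z := -(localInverse (tangentProj U V) (labelled fun x => (f x).1) *ᵥ
      signPart K (penalty n ρ l) (fun x => (f x).1) fun x => (f x).2)) (b := 1 / 20)
    (by rw [mulVec_neg, mulVec_mulVec, hG.mul_eq])
    (fun x => by rw [Pi.neg_apply, abs_neg]; exact hf2 x)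
    (by rw [mulVec_neg]; exact hf3.neg) (by norm_num)
  refine (prob_mono hwp fun γ hγ hc => hγ ?_).trans hmain
  have := hasSignCertificate_of_hasCertificate hU hV h.penalty_pos hK (by norm_num) hG hf4 hc
  rwa [show (1 : ℝ) / 10 + (1 / 20 + 1 / 10) = 1 / 4 by norm_num] at this

end

end RobustMC

/-! ### The good event and its probability -/

namespace RobustMC

open Matrix

section

variable {n m r : ℕ} {ρ s g l : ℝ} {U V : Matrix (Fin n) (Fin r) ℝ}

/-- The property of the set `O` of observed entries and the set `Om` of corrupted ones that implies
recovery: certificates for the sign pattern `K` and for `U Vᵀ`, and injectivity of the sampling of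
the uncorrupted entries on the tangent space. -/
structure IsGoodPair (U V : Matrix (Fin n) (Fin r) ℝ) (K : Matrix (Fin n) (Fin n) ℝ) (lam ρ : ℝ)
    (O Om : Finset (Fin n × Fin n)) : Prop where
  sign : HasSignCertificate U V (fun x => K x.1 x.2) lam (1 / 4) (√(ρ / 8) * (lam / 16)) O Om
  lowRank : HasCertificate U V ∅ (fun x => (U * Vᵀ) x.1 x.2) (lam / 8) (1 / 10)
    (√(ρ / 8) * (lam / 16)) fun x => decide (x ∈ O) && !decide (x ∈ Om)
  inj : ∀ v, ρ / 8 * ((tangentProj U V *ᵥ v) ⬝ᵥ (tangentProj U V *ᵥ v)) ≤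
    ∑ x ∈ O \ Om, (tangentProj U V *ᵥ v) x ^ 2

lemma add_dotProduct_add_self_le {ι : Type*} [Fintype ι] (a b : ι → ℝ) :
    (a + b) ⬝ᵥ (a + b) ≤ 2 * (a ⬝ᵥ a) + 2 * (b ⬝ᵥ b) := by
  have h := dotProduct_self_nonneg' (a - b)
  rw [sub_dotProduct, dotProduct_sub, dotProduct_sub] at h
  rw [add_dotProduct, dotProduct_add, dotProduct_add]
  linarith

/-- The sum of the two certificates is a dual certificate. -/
lemma IsGoodPair.exactRecovery {L : Matrix (Fin n) (Fin n) ℝ} {σ : Fin r → ℝ}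
    (hsvd : IsReducedSVD L U σ V) {O Om : Finset (Fin n × Fin n)} {S K : Matrix (Fin n) (Fin n) ℝ}
    {lam : ℝ} (hlam : 0 < lam) (hlam1 : lam ≤ 1) (hρ : 0 < ρ)
    (hK : ∀ i j, K i j = 1 ∨ K i j = -1)
    (hS : ∀ i j, Real.sign (S i j) = proj Om K i j) (h : IsGoodPair U V K lam ρ O Om) :
    ExactRecovery lam O L S := by
  obtain ⟨W, hW0, hW1, hW2, hWT, hWε⟩ := h.sign
  obtain ⟨Y, hY0, hYB, hYT, hYε⟩ := h.lowRank
  have hU := hsvd.orthonormal_left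
  have hκ : 0 < √(ρ / 8) := Real.sqrt_pos.2 (by positivity)
  have hYout : ∀ x, (x ∉ O ∨ x ∈ Om) → Y x = 0 := fun x hx => by
    by_contra hY
    have := (hY0 x hY).2
    simp only [Bool.and_eq_true, decide_eq_true_eq, Bool.not_eq_true', decide_eq_false_iff_not]
      at this
    tauto
  refine exactRecovery_of_certificate hsvd (Q := W + Y) (κ := √(ρ / 8)) (ε := √(ρ / 8) * (lam / 8))
    hlam hlam1 hκ hK hS (fun x hx => ?_) (fun x hx => ?_) (fun x hx => ?_) ?_ (by positivity) ?_
    le_rfl fun v => ?_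
  · rw [Pi.add_apply, hW0 x hx, hYout x (Or.inl hx), add_zero]
  · rw [Pi.add_apply, hW1 x hx, hYout x (Or.inr hx), add_zero]
  · rw [Pi.add_apply]
    have := abs_add_le (W x) (Y x)
    have := hW2 x hx
    have := hYB x
    linarith
  · rw [mulVec_add]
    exact (hWT.add hYT).mono (by norm_num)
  · have hE : tangentProj U V *ᵥ (fun x => (U * Vᵀ) x.1 x.2) = fun x => (U * Vᵀ) x.1 x.2 :=
      tangentProj_mulVec_of_eq_mul Vᵀ hU
    have hmask : mask (∅ : Finset (Fin n × Fin n))ᶜ *ᵥ (fun x => (U * Vᵀ) x.1 x.2) =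
        fun x => (U * Vᵀ) x.1 x.2 := by
      rw [mask_mulVec]; funext x; simp
    have e : tangentProj U V *ᵥ (W + Y) - (fun x => (U * Vᵀ) x.1 x.2) =
        tangentProj U V *ᵥ W + tangentProj U V *ᵥ (Y - mask (∅ : Finset (Fin n × Fin n))ᶜ *ᵥ
          fun x => (U * Vᵀ) x.1 x.2) := by
      rw [hmask, mulVec_add, mulVec_sub, hE]; abel
    rw [e]
    refine (add_dotProduct_add_self_le _ _).trans ?_
    have e2 : (√(ρ / 8) * (lam / 8)) ^ 2 = 2 * (√(ρ / 8) * (lam / 16)) ^ 2 +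
      2 * (√(ρ / 8) * (lam / 16)) ^ 2 := by ring
    rw [e2]
    linarith
  · rw [Real.sq_sqrt (by positivity)]
    exact h.inj v

variable [NeZero n]

lemma IsRecoveryRegime.prob_not_isGoodPair_le (h : IsRecoveryRegime n m ρ s g l)
    (hU : Uᵀ * U = 1) (hV : Vᵀ * V = 1) (hg : ∀ x, tangentProj U V x x ≤ g)
    (hE : ∀ i j, (U * Vᵀ) i j ^ 2 * (2 * n) ≤ g) {K : Matrix (Fin n) (Fin n) ℝ}
    (hK : ∀ i j, K i j = 1 ∨ K i j = -1) :
    prob (obsWeight ρ s) (fun f => ¬ IsGoodPair U V K (penalty n ρ l) ρ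
      (labelled fun x => (f x).1) (labelled fun x => (f x).2)) ≤
      (4 * n ^ 2 + 4 * n + 2 * (m + 1) * (4 * n + 2 * n ^ 2)) * Real.exp (-(8 * l)) := by
  have hρ := h.rho_pos
  have hρ1 := h.rho_lt
  have hs0 := h.s_nonneg
  have hs1 : s ≤ 1 / 2 := by linarith [h.s_le]
  have hn := h.n_pos
  have hl : 0 < l := zero_lt_one.trans_le h.one_le_l
  have hw := isWeight_obsWeight hρ.le (by linarith) hs0 (by linarith : s ≤ 1)
  have hPs : (tangentProj U V)ᵀ = tangentProj U V := tangentProj_transpose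
  have hPi := tangentProj_mul_self hU hV
  have hp4 : ρ / 2 ≤ ρ * (1 - s) := by nlinarith
  have hp1 : ρ * (1 - s) ≤ 1 := by nlinarith
  have hK1 : ∀ x : Fin n × Fin n, |K x.1 x.2| ≤ 1 := fun x => by
    rcases hK x.1 x.2 with hk | hk <;> rw [hk] <;> norm_num
  have h1 := h.prob_not_hasSignCertificate_le hU hV hg hK1
  have hG := isLocalInverse_empty hPs hPi (g := 4 * g) (fun x => by linarith [hg x, h.g_pos])
    (by linarith [h.g_pos])
  have h2 := h.prob_not_hasCertificate_le hU hV hG (Z := fun x => (U * Vᵀ) x.1 x.2) (b := 0)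
    (by linarith) hp1 (tangentProj_mulVec_of_eq_mul Vᵀ hU)
    (fun x => abs_le_of_sq_le_sq (by
      have hpos : (0 : ℝ) < 16 * 10 ^ 6 * (n * l ^ 2) := by positivity
      refine le_of_mul_le_mul_right ?_ hpos
      rw [h.targetLevel_sq]
      have e1 := mul_le_mul_of_nonneg_right (hE x.1 x.2) (by positivity : 0 ≤ 8 * 10 ^ 6 * l ^ 2)
      have e2 := h.g_le
      have e3 : 0 < g * l ^ 2 := mul_pos h.g_pos (by positivity)
      linarith) h.targetLevel_pos.le)
    (by
      rw [show mask (∅ : Finset (Fin n × Fin n)) = 0 by simp [mask], zero_mulVec]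
      intro u v
      simp) le_rfl
  rw [zero_add] at h2
  have hcard : (Fintype.card (Fin n × Fin n) : ℝ) = n ^ 2 := by
    simp [Fintype.card_prod, sq]
  have h3 := prob_not_le_sum_sq_labelled_le hPs hPi hg h.g_pos (by linarith : 0 ≤ ρ * (1 - s)) hp1
    (8 * l)
  rw [hcard] at h3
  rw [← prob_berWeight_of_obsWeight] at h2 h3
  refine (prob_mono hw ?_).trans (((prob_or_le hw _ _).trans (add_le_add h1
    ((prob_or_le hw _ _).trans (add_le_add h2 h3)))).trans_eq (by ring))
  intro f hf
  by_contra hcon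
  rw [not_or, not_or, not_not, not_not, not_not] at hcon
  obtain ⟨c1, c2, c3⟩ := hcon
  have eset : labelled (fun x => (f x).1 && !(f x).2) =
      labelled (fun x => (f x).1) \ labelled fun x => (f x).2 := by
    ext x
    simp [mem_labelled]
  refine hf ⟨c1, ?_, fun v => ?_⟩
  · convert c2 using 2 with x
    simp [mem_labelled]
  · have c := c3 (tangentProj U V *ᵥ v)
    rw [eset, mulVec_mulVec, hPi] at c
    have hv := dotProduct_self_nonneg' (tangentProj U V *ᵥ v)
    have := h.g_mul_le
    have hk : ρ / 8 ≤ ρ * (1 - s) / 2 - 8 * l * g := by nlinarith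
    have := mul_le_mul_of_nonneg_right hk hv
    linarith

end

end RobustMC

/-! ### From the random model to the product law -/

namespace RobustMC

open Matrix

section

variable {n : ℕ} {α : Type*} [MeasurableSpace α] {P : Measure α}
  {ρ s : ℝ} {K : Matrix (Fin n) (Fin n) ℝ} {O Om : α → Finset (Fin n × Fin n)}
  {S : α → Matrix (Fin n) (Fin n) ℝ}

lemma IsCorruptionModel.measureReal_inter [IsFiniteMeasure P]
    (h : IsCorruptionModel P ρ s K O Om S)
    (x : Fin n × Fin n) : P.real {ω | x ∈ O ω ∧ x ∈ Om ω} = ρ * s := by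
  have h1 := h.prob_corr x
  rw [measureReal_def, cond_apply (h.measurable_obs x), ENNReal.toReal_mul, ENNReal.toReal_inv,
    ← measureReal_def, ← measureReal_def, h.prob_obs x] at h1
  have h2 := h.prob_obs x
  have e : {ω | x ∈ O ω ∧ x ∈ Om ω} = {ω | x ∈ O ω} ∩ {ω | x ∈ Om ω} := rfl
  rw [e, ← h1]
  -- for `ρ = 0` the conditional probability is a junk value, and both sides vanish
  by_cases hρ : ρ = 0
  · rw [hρ, zero_mul]
    refine le_antisymm ?_ measureReal_nonneg
    rw [← hρ, ← h2]
    exact measureReal_mono Set.inter_subset_left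
  · rw [mul_inv_cancel_left₀ hρ]

/-- The joint indicator of the observed and of the corrupted entries. -/
noncomputable def obsLabel (O Om : Finset (Fin n × Fin n)) : Fin n × Fin n → Bool × Bool :=
  fun x => (decide (x ∈ O), decide (x ∈ Om))

lemma labelled_obsLabel_fst (O Om : Finset (Fin n × Fin n)) :
    (labelled fun x => (obsLabel O Om x).1) = O := by
  ext x; simp [mem_labelled, obsLabel]

lemma labelled_obsLabel_snd (O Om : Finset (Fin n × Fin n)) :
    (labelled fun x => (obsLabel O Om x).2) = Om := by
  ext x; simp [mem_labelled, obsLabel]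

lemma IsCorruptionModel.measurableSet_obsLabel (h : IsCorruptionModel P ρ s K O Om S)
    (x : Fin n × Fin n) (b : Bool × Bool) : MeasurableSet {ω | obsLabel (O ω) (Om ω) x = b} := by
  have e : {ω | obsLabel (O ω) (Om ω) x = b} =
      {ω | x ∈ O ω ↔ b.1 = true} ∩ {ω | x ∈ Om ω ↔ b.2 = true} := by
    ext ω
    rcases b with ⟨b1, b2⟩
    cases b1 <;> cases b2 <;> simp [obsLabel]
  rw [e]
  exact ((h.measurable_obs x).iff (MeasurableSet.const _)).inter
    ((h.measurable_corr x).iff (MeasurableSet.const _))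

lemma IsCorruptionModel.measureReal_obsLabel [IsProbabilityMeasure P]
    (h : IsCorruptionModel P ρ s K O Om S)
    (x : Fin n × Fin n) (b : Bool × Bool) :
    P.real {ω | obsLabel (O ω) (Om ω) x = b} = obsWeight ρ s b := by
  have h1 := h.measureReal_inter x
  have hO := h.measurable_obs x
  have hOm := h.measurable_corr x
  have h2 := h.prob_obs x
  rcases b with ⟨b1, b2⟩
  cases b1 <;> cases b2
  · have e : {ω | obsLabel (O ω) (Om ω) x = (false, false)} = {ω | x ∈ O ω}ᶜ := by
      ext ω
      have := @h.subset ω x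
      simp [obsLabel]
      tauto
    rw [e, probReal_compl_eq_one_sub hO, h2]
    rfl
  · have e : {ω | obsLabel (O ω) (Om ω) x = (false, true)} = ∅ := by
      ext ω
      have := @h.subset ω x
      simp [obsLabel]
      tauto
    rw [e, measureReal_empty]
    rfl
  · have e : {ω | obsLabel (O ω) (Om ω) x = (true, false)} =
        {ω | x ∈ O ω} \ {ω | x ∈ O ω ∧ x ∈ Om ω} := by
      ext ω
      simp [obsLabel]
      tauto
    have hm : MeasurableSet {ω | x ∈ O ω ∧ x ∈ Om ω} := hO.inter hOm
    have hsub : {ω | x ∈ O ω ∧ x ∈ Om ω} ⊆ {ω | x ∈ O ω} := fun ω hω => hω.1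
    rw [e, measureReal_sdiff hsub hm, h1, h2]
    simp [obsWeight]; ring
  · have e : {ω | obsLabel (O ω) (Om ω) x = (true, true)} = {ω | x ∈ O ω ∧ x ∈ Om ω} := by
      ext ω
      simp [obsLabel]
    rw [e, h1]
    rfl

/-- The joint indicators have the product law. -/
lemma IsCorruptionModel.measureReal_obsLabel_eq [IsProbabilityMeasure P]
    (h : IsCorruptionModel P ρ s K O Om S)
    (f : Fin n × Fin n → Bool × Bool) :
    P.real {ω | obsLabel (O ω) (Om ω) = f} = ∏ x, obsWeight ρ s (f x) := by
  have hind := h.indep.measure_inter_preimage_eq_mul Finset.univ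
    (sets := fun x => {q : Prop × Prop | (q.1 ↔ (f x).1 = true) ∧ (q.2 ↔ (f x).2 = true)})
    fun x _ => MeasurableSet.of_discrete
  have e : ∀ x, (fun ω => ((x ∈ O ω, x ∈ Om ω) : Prop × Prop)) ⁻¹'
      {q : Prop × Prop | (q.1 ↔ (f x).1 = true) ∧ (q.2 ↔ (f x).2 = true)} =
      {ω | obsLabel (O ω) (Om ω) x = f x} := fun x => by
    ext ω
    rcases hb : f x with ⟨b1, b2⟩
    cases b1 <;> cases b2 <;> simp [obsLabel]
  simp only [e] at hind
  have e2 : {ω | obsLabel (O ω) (Om ω) = f} =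
      ⋂ x ∈ (Finset.univ : Finset (Fin n × Fin n)), {ω | obsLabel (O ω) (Om ω) x = f x} := by
    ext ω
    simp [funext_iff]
  rw [e2, measureReal_def, hind, ENNReal.toReal_prod]
  exact Finset.prod_congr rfl fun x _ => h.measureReal_obsLabel x (f x)

lemma IsCorruptionModel.measurableSet_obsLabel_eq (h : IsCorruptionModel P ρ s K O Om S)
    (f : Fin n × Fin n → Bool × Bool) : MeasurableSet {ω | obsLabel (O ω) (Om ω) = f} := by
  have e2 : {ω | obsLabel (O ω) (Om ω) = f} = ⋂ x, {ω | obsLabel (O ω) (Om ω) x = f x} := by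
    ext ω
    simp [funext_iff]
  rw [e2]
  exact MeasurableSet.iInter fun x => h.measurableSet_obsLabel x (f x)

lemma setOf_obsLabel_eq_biUnion {n : ℕ} {α : Type*} (O Om : α → Finset (Fin n × Fin n))
    (Q : (Fin n × Fin n → Bool × Bool) → Prop) [DecidablePred Q] :
    {ω | Q (obsLabel (O ω) (Om ω))} =
      ⋃ f ∈ Finset.univ.filter Q, {ω | obsLabel (O ω) (Om ω) = f} := by
  ext ω
  simp

lemma IsCorruptionModel.measurableSet_setOf (h : IsCorruptionModel P ρ s K O Om S)
    (Q : (Fin n × Fin n → Bool × Bool) → Prop) :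
    MeasurableSet {ω | Q (obsLabel (O ω) (Om ω))} := by
  classical
  rw [setOf_obsLabel_eq_biUnion]
  exact Finset.measurableSet_biUnion _ fun f _ => h.measurableSet_obsLabel_eq f

lemma IsCorruptionModel.measureReal_setOf [IsProbabilityMeasure P]
    (h : IsCorruptionModel P ρ s K O Om S)
    (Q : (Fin n × Fin n → Bool × Bool) → Prop) :
    P.real {ω | Q (obsLabel (O ω) (Om ω))} = prob (obsWeight ρ s) Q := by
  classical
  rw [setOf_obsLabel_eq_biUnion, measureReal_biUnion_finset _
    fun f _ => h.measurableSet_obsLabel_eq f]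
  · simp only [h.measureReal_obsLabel_eq, prob, expect, Finset.sum_filter]
    exact Finset.sum_congr rfl fun f _ => by split_ifs <;> simp
  · intro f _ f' _ hff
    refine Set.disjoint_left.2 fun ω hω hω' => hff ?_
    exact hω.symm.trans hω'

end

/-! ### Incoherence -/

section

variable {n r : ℕ} {U V : Matrix (Fin n) (Fin r) ℝ} {μ : ℝ}

lemma norm_mul_transpose_mulVec_single_sq (hU : Uᵀ * U = 1) (i : Fin n) :
    ‖WithLp.toLp 2 ((U * Uᵀ) *ᵥ Pi.single i 1)‖ ^ 2 = (U * Uᵀ) i i := by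
  rw [EuclideanSpace.real_norm_sq_eq, ← sum_sq_column_eq (by simp) (mul_transpose_proj hU) i]
  simp

lemma tangentProj_diagonal_le (hU : Uᵀ * U = 1) (hV : Vᵀ * V = 1) (h : IsIncoherent U V μ)
    (x : Fin n × Fin n) : tangentProj U V x x ≤ 2 * (μ * r / n) := by
  have h1 := h.left x.1
  have h2 := h.right x.2
  rw [norm_mul_transpose_mulVec_single_sq hU] at h1
  rw [norm_mul_transpose_mulVec_single_sq hV] at h2
  have h3 : 0 ≤ (U * Uᵀ) x.1 x.1 := by
    rw [← norm_mul_transpose_mulVec_single_sq hU]; positivity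
  have h4 : 0 ≤ (V * Vᵀ) x.2 x.2 := by
    rw [← norm_mul_transpose_mulVec_single_sq hV]; positivity
  have e : tangentProj U V x x = 1 - (1 - (U * Uᵀ) x.1 x.1) * (1 - (V * Vᵀ) x.2 x.2) := by
    simp [tangentProj, kroneckerMap_apply]
  rw [e]
  nlinarith

/-- Incoherence forces `μ ≥ 1` for `r ≥ 1`, since the diagonal entries of `U Uᵀ` sum to `r`. -/
lemma IsIncoherent.le_mul [NeZero n] (hU : Uᵀ * U = 1) (h : IsIncoherent U V μ) :
    (r : ℝ) ≤ μ * r := by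
  have hn : (0 : ℝ) < n := by exact_mod_cast Nat.pos_of_ne_zero (NeZero.ne n)
  have h1 : (U * Uᵀ).trace = r := by
    rw [trace_mul_comm, hU, trace_one, Fintype.card_fin]
  calc (r : ℝ) = ∑ i, (U * Uᵀ) i i := h1.symm
    _ ≤ ∑ _i : Fin n, μ * r / n := Finset.sum_le_sum fun i _ => by
        rw [← norm_mul_transpose_mulVec_single_sq hU]; exact h.left i
    _ = μ * r := by
        rw [Finset.sum_const, Finset.card_univ, Fintype.card_fin, nsmul_eq_mul]
        field_simp

/-- The numerical hypotheses of the recovery theorem put the parameters in the range in which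
the dual certificate exists. -/
lemma isRecoveryRegime_of_isIncoherent [NeZero n] (hU : Uᵀ * U = 1) (h : IsIncoherent U V μ)
    (hr : 1 ≤ r) {ρ s : ℝ} (hl : 1 ≤ Real.log n) (hρ0 : 0 < ρ) (hρ1 : ρ < 1 / 2) (hs0 : 0 ≤ s)
    (hs1 : 10 ^ 5 * s ≤ 1) (hρ : ρ > 2 * 10 ^ 10 * (μ * r * Real.log n ^ 2 / n)) :
    IsRecoveryRegime n ⌈2 * Real.log n⌉₊ ρ s (2 * (μ * r / n)) (Real.log n) where
  one_le_l := hl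
  rho_pos := hρ0
  rho_lt := hρ1
  s_nonneg := hs0
  s_le := hs1
  le_g := by
    have hn : (0 : ℝ) < n := by exact_mod_cast Nat.pos_of_ne_zero (NeZero.ne n)
    have h1 : (1 : ℝ) ≤ r := by exact_mod_cast hr
    have e : n * (2 * (μ * r / n)) = 2 * (μ * r) := by field_simp
    rw [e]
    linarith [h.le_mul hU]
  g_le := (le_of_eq (by ring)).trans hρ.le
  le_two_pow := by
    have hn : (0 : ℝ) < n := by exact_mod_cast Nat.pos_of_ne_zero (NeZero.ne n)
    have h1 := Nat.le_ceil (2 * Real.log n)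
    have h2 := Real.log_two_gt_d9
    rw [← Real.log_le_log_iff hn (by positivity), Real.log_pow]
    nlinarith
  m_le := by
    have := (Nat.ceil_lt_add_one (by positivity : 0 ≤ 2 * Real.log n)).le
    linarith

end

/-- The total failure probability, which is of order `n⁻⁶ log n`. -/
lemma failure_le {n : ℕ} (hn : 2 ≤ n) (hl : 1 ≤ Real.log n) :
    (4 * n ^ 2 + 4 * n + 2 * (⌈2 * Real.log n⌉₊ + 1) * (4 * n + 2 * n ^ 2)) *
      Real.exp (-(8 * Real.log n)) ≤ 38 * (n : ℝ) ^ (-3 : ℤ) := by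
  have hn2 : (2 : ℝ) ≤ n := by exact_mod_cast hn
  have hn0 : (0 : ℝ) < n := by linarith
  have hm := (Nat.ceil_lt_add_one (by positivity : 0 ≤ 2 * Real.log n)).le
  have hln := Real.log_le_sub_one_of_pos hn0
  have e : Real.exp (-(8 * Real.log n)) = (n : ℝ) ^ (-3 : ℤ) * ((n : ℝ) ^ 5)⁻¹ := by
    have e8 : Real.exp (8 * Real.log n) = (n : ℝ) ^ 8 := by
      rw [← Real.log_rpow hn0, Real.exp_log (by positivity)]
      exact_mod_cast Real.rpow_natCast (n : ℝ) 8
    rw [Real.exp_neg, e8, _root_.zpow_neg, ← mul_inv]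
    norm_cast
    rw [← pow_add]
  rw [e, mul_comm, mul_assoc, mul_comm 38]
  refine mul_le_mul_of_nonneg_left ?_ (by positivity)
  rw [inv_mul_le_iff₀ (by positivity)]
  calc (4 * n ^ 2 + 4 * n + 2 * (⌈2 * Real.log n⌉₊ + 1) * (4 * n + 2 * n ^ 2) : ℝ)
      ≤ 4 * n ^ 2 + 4 * n + 2 * (2 * n) * (4 * n + 2 * n ^ 2) := by gcongr; linarith
    _ ≤ n ^ 5 * 38 := by
        have h3 : (n : ℝ) ≤ n ^ 5 := le_self_pow₀ (by linarith) (by norm_num)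
        have h4 : (n : ℝ) ^ 2 ≤ n ^ 5 := pow_le_pow_right₀ (by linarith) (by norm_num)
        have h5 : (n : ℝ) ^ 3 ≤ n ^ 5 := pow_le_pow_right₀ (by linarith) (by norm_num)
        nlinarith

end RobustMC
theorem theorem1p3 :
    ∃ Cρ Cs C : ℝ, 0 < Cρ ∧ 0 < Cs ∧ 0 < C ∧
      ∀ (n r : ℕ) (L : Matrix (Fin n) (Fin n) ℝ) (U : Matrix (Fin n) (Fin r) ℝ) (σ : Fin r → ℝ)
        (V : Matrix (Fin n) (Fin r) ℝ) (μ ρ s : ℝ) (K : Matrix (Fin n) (Fin n) ℝ)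
        (α : Type*) [MeasurableSpace α] (P : Measure α) [IsProbabilityMeasure P]
        (O Om : α → Finset (Fin n × Fin n)) (S : α → Matrix (Fin n) (Fin n) ℝ),
        2 ≤ n → 1 ≤ r → L.rank = r →
        RobustMC.IsReducedSVD L U σ V →
        RobustMC.IsIncoherenceParameter U V μ →
        (∀ i j, K i j = 1 ∨ K i j = -1) →
        0 < ρ → ρ < 1 / 2 →
        RobustMC.IsCorruptionModel P ρ s K O Om S →
        ρ > Cρ * (μ * r * Real.log n ^ 2 / n) →
        s ≤ Cs →
        ∃ E : Set α, MeasurableSet E ∧ 1 - C * (n : ℝ) ^ (-3 : ℤ) ≤ P.real E ∧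
          ∀ ω ∈ E, RobustMC.ExactRecovery (1 / √(ρ * n * Real.log n)) (O ω) L (S ω) := by
  refine ⟨2 * 10 ^ 10, 1 / 10 ^ 5, 38, by norm_num, by norm_num, by norm_num, ?_⟩
  intro n r L U σ V μ ρ s K α _ P _ O Om S hn hr _ hsvd hμ hK hρ0 hρ1 hmodel hρ hs
  have hn0 : (0 : ℝ) < n := by exact_mod_cast (by omega : 0 < n)
  have : NeZero n := ⟨by omega⟩
  rcases lt_or_ge n 3 with hn3 | hn3
  · -- For `n = 2` the asserted lower bound for the probability is negative.
    obtain rfl : n = 2 := by omega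
    refine ⟨∅, MeasurableSet.empty, ?_, fun ω hω => absurd hω (Set.notMem_empty ω)⟩
    rw [measureReal_empty]
    norm_num
  · have hl : 1 ≤ Real.log n := by
      rw [Real.le_log_iff_exp_le hn0]
      have : (3 : ℝ) ≤ n := by exact_mod_cast hn3
      linarith [Real.exp_one_lt_d9]
    have hU := hsvd.orthonormal_left
    have hV := hsvd.orthonormal_right
    have hinc : RobustMC.IsIncoherent U V μ := hμ.1
    have hs0 : 0 ≤ s := by
      rw [← hmodel.prob_corr (⟨0, by omega⟩, ⟨0, by omega⟩)]
      exact measureReal_nonneg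
    have hreg := RobustMC.isRecoveryRegime_of_isIncoherent hU hinc hr hl hρ0 hρ1 hs0
      (by linarith) hρ
    have hg : ∀ x, RobustMC.tangentProj U V x x ≤ 2 * (μ * r / n) :=
      RobustMC.tangentProj_diagonal_le hU hV hinc
    have hE : ∀ i j, (U * V.transpose) i j ^ 2 * (2 * n) ≤ 2 * (μ * r / n) := fun i j => by
      have h1 : 0 ≤ μ * r := (Nat.cast_nonneg r).trans (hinc.le_mul hU)
      have h2 := pow_le_pow_left₀ (abs_nonneg _) (hinc.cross i j) 2
      rw [sq_abs, div_pow, Real.sq_sqrt h1] at h2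
      calc (U * V.transpose) i j ^ 2 * (2 * n) ≤ μ * r / n ^ 2 * (2 * n) := by gcongr
        _ = 2 * (μ * r / n) := by field_simp
    have hfail := (hreg.prob_not_isGoodPair_le hU hV hg hE hK).trans (RobustMC.failure_le hn hl)
    have hw := RobustMC.isWeight_obsWeight hρ0.le (by linarith) hs0 (by linarith : s ≤ 1)
    rw [RobustMC.prob_not hw] at hfail
    refine ⟨{ω | RobustMC.IsGoodPair U V K (RobustMC.penalty n ρ (Real.log n)) ρ
      (RobustMC.labelled fun x => (RobustMC.obsLabel (O ω) (Om ω) x).1)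
      (RobustMC.labelled fun x => (RobustMC.obsLabel (O ω) (Om ω) x).2)},
      hmodel.measurableSet_setOf fun f => RobustMC.IsGoodPair U V K
        (RobustMC.penalty n ρ (Real.log n)) ρ (RobustMC.labelled fun x => (f x).1)
        (RobustMC.labelled fun x => (f x).2), ?_, fun ω hω => ?_⟩
    · have e := hmodel.measureReal_setOf fun f => RobustMC.IsGoodPair U V K
        (RobustMC.penalty n ρ (Real.log n)) ρ (RobustMC.labelled fun x => (f x).1)
        (RobustMC.labelled fun x => (f x).2)
      rw [e]
      linarith
    · rw [Set.mem_ofPred_eq, RobustMC.labelled_obsLabel_fst, RobustMC.labelled_obsLabel_snd] at hω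
      exact hω.exactRecovery hsvd hreg.penalty_pos hreg.penalty_le_one hρ0 hK (hmodel.sign ω)
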